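/- Let $n\ge 2$, let $M$ be a smooth manifold of dimension $n+1$, let $L$ be a compact Lie group with Lie algebra $\mathfrak l$ and an $\mathrm{Ad}$-invariant inner product $q$ on $\mathfrak l$, and let $P\to M$ be a smooth principal $L$-bundle. **Notation.** For a metric $g$ let $\delta_g h_j=-\nabla^i h_{ij}$, let $\delta_g^*\eta$ be the symmetrization of $\nabla\eta$, let $\mathcal B_g=\delta_g+\frac12 d\,\mathrm{tr}_g$ be the Bianchi map, and let $$(\Delta_L h)_{jl}=(\nabla^*\nabla h)_{jl}+\mathrm{Ric}_{jk}h^k{}_l+\mathrm{Ric}_{lk}h^k{}_j-2\,\mathrm{Riem}_{ijkl}h^{ik}\qquad(g^{ik}\mathrm{Riem}_{ijkl}=\mathrm{Ric}_{jl})$$ be the Lichnerowicz Laplacian. Put $$\mathscr L_g h:=\Delta_L h+2n\,h-\mathbb L_{(\mathcal B_g h)^\sharp}g ,$$ where $\mathbb L$ is the Lie derivative. For a connection $\omega$ on $P$ with curvature $\Omega_\omega$ let $d_\omega$ be the exterior covariant derivative on forms with values in $\mathrm{Ad}\,\mathfrak l$, $d^*_{g,\omega}$ its formal adjoint, and $\Delta^1_{\omega}=d_\omega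 d^*_{g,\omega}+d^*_{g,\omega}d_\omega$ on 1-forms. Put $$Q=-\tfrac14 g^{ik}g^{jm}q(\Omega_{ij},\Omega_{km}),\quad K_{ij}=\tfrac12 g^{km}q(\Omega_{ik},\Omega_{jm})+\tfrac12 Q\,g_{ij},\quad \widetilde K_{g,\omega}=K-\tfrac{\mathrm{tr}_gK}{n-1}\,g .$$ Let $(g_0,\omega_0)$ be a trivial configuration: $g_0$ is a smooth metric with $\mathrm{Ric}_{g_0}=-n g_0$ (for instance a Poincaré–Einstein metric) and $\omega_0$ is a smooth connection with $\Omega_{\omega_0}=0$. Let $\Theta,A$ be symmetric 2-tensors on $M$ and $\epsilon,a$ be 1-forms on $M$ with values in $\mathrm{Ad}\,\mathfrak l$, all of class $C^2$; if $M$ is the interior of a compact manifold with boundary $Y$ and boundary defining function $x$, one may take in particular the extensions $\Theta=e_x(\Gamma)=x^{-2}e(\Gamma)$ and $\epsilon=\mathfrak e(\gamma)$ of boundary data $(\Gamma,\gamma)$ on $Y$. With $g=g_0+\Theta+A$ and $\omega=\omega_0+\epsilon+a$ the gauged Einstein–Yang–Mills operator is $$\mathscr P(\Theta,A;\epsilon,a)=\begin{pmatrix}\mathrm{Ric}_g+n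 g-\widetilde K_{g,\omega}+\delta_g^*\,\mathcal B_{g_0+\Theta}A\\[2pt] d^*_{g,\omega}\Omega_\omega+d_\omega\, d^*_{g_0+\Theta,\,\omega_0+\epsilon}\,a\end{pmatrix}.$$ **Claim.** $\mathscr P(0)=0$, and the linearization of $\mathscr P$ at $(g_0,\omega_0)$ is block-diagonal, with all geometric operators taken with respect to $g_0$: $$D\mathscr P_{(g_0,\omega_0)}(\Theta,A;\epsilon,a)=\begin{pmatrix}\tfrac12\big(\mathscr L_{g_0}\Theta+(\Delta_L+2n)A\big)\\[2pt] d^*_{\omega_0}d_{\omega_0}\epsilon+\Delta^1_{\omega_0}a\end{pmatrix}.$$ This holds in the following sense, in every chart of $M$ and every local smooth section of $P$ over its domain. 1. At every point, the $t$-derivative at $t=0$ of each component of $\mathscr P(t\Theta,tA;t\epsilon,ta)$ exists and is the corresponding component of the right-hand side; the $t$-derivative at $t=0$ of $\widetilde K_{g_0+t\Theta+tA,\;\omega_0+t\epsilon+ta}$ is $0$. 2. For every compact subset of the chart there are $C$ and $\rho>0$ such that, for all $(\Theta,A;\epsilon,a)$ as above, every point $y$ of the subset and every $r\le\rho$: if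 the components of $\Theta,A,\epsilon,a$ and their partial derivatives of order at most two are bounded by $r$ at $y$, then the components at $y$ of $\mathscr P(\Theta,A;\epsilon,a)$ and of the right-hand side differ by at most $Cr^2$. -/

import Mathlib

open scoped Manifold ContDiff

noncomputable section

namespace EYM

/-! ### Tensor calculus in local coordinates

Coordinates take values in `ℝ^(n+1)`; the index set is `Fin (n+1)`.  A covariant tensor field with
values in a vector space `F` is given by its components. -/

section Local

/-- The coordinate space `ℝ^(n+1)`. -/
abbrev Vec (n : ℕ) : Type := EuclideanSpace ℝ (Fin (n + 1))

/-- Components of a 1-tensor field. -/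
abbrev Cov1 (n : ℕ) (F : Type*) : Type _ := Vec n → Fin (n + 1) → F

/-- Components of a covariant 2-tensor field. -/
abbrev Cov2 (n : ℕ) (F : Type*) : Type _ := Vec n → Fin (n + 1) → Fin (n + 1) → F

/-- Components of a covariant 3-tensor field. -/
abbrev Cov3 (n : ℕ) (F : Type*) : Type _ :=
  Vec n → Fin (n + 1) → Fin (n + 1) → Fin (n + 1) → F

variable {n : ℕ} {F : Type*} [NormedAddCommGroup F] [NormedSpace ℝ F]

/-- The partial derivative `∂_i f`. -/
def pd (i : Fin (n + 1)) (f : Vec n → F) (y : Vec n) : F :=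
  fderiv ℝ f y (EuclideanSpace.single i 1)

/-- The components `g^{ij}` of the inverse of `(g_{ij})`. -/
def inv (g : Cov2 n ℝ) : Cov2 n ℝ := fun y i j => (Matrix.of (g y))⁻¹ i j

/-- The Christoffel symbols `Γ^k_{ij}` of the Levi-Civita connection (arguments `k i j`). -/
def christoffel (g : Cov2 n ℝ) : Cov3 n ℝ := fun y k i j =>
  (1 / 2 : ℝ) * ∑ l, inv g y k l *
    (pd i (fun z => g z j l) y + pd j (fun z => g z i l) y - pd l (fun z => g z i j) y)

/-- `∇_i a_j` (arguments `i j`). -/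
def cov1 (g : Cov2 n ℝ) (a : Cov1 n F) : Cov2 n F := fun y i j =>
  pd i (fun z => a z j) y - ∑ m, christoffel g y m i j • a y m

/-- `∇_i h_{jk}` (arguments `i j k`). -/
def cov2 (g : Cov2 n ℝ) (h : Cov2 n F) : Cov3 n F := fun y i j k =>
  pd i (fun z => h z j k) y
    - ∑ m, christoffel g y m i j • h y m k - ∑ m, christoffel g y m i k • h y j m

/-- `∇_i T_{jkl}` (arguments `i j k l`). -/
def cov3 (g : Cov2 n ℝ) (T : Cov3 n ℝ) (y : Vec n) (i j k l : Fin (n + 1)) : ℝ :=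
  pd i (fun z => T z j k l) y - ∑ m, christoffel g y m i j * T y m k l
    - ∑ m, christoffel g y m i k * T y j m l - ∑ m, christoffel g y m i l * T y j k m

/-- `R^i_{jkl}`, where `R(∂_k, ∂_l) ∂_j = R^i_{jkl} ∂_i` and
`R(X, Y) = [∇_X, ∇_Y] - ∇_{[X, Y]}` (arguments `i j k l`). -/
def curv (g : Cov2 n ℝ) (y : Vec n) (i j k l : Fin (n + 1)) : ℝ :=
  pd k (fun z => christoffel g z i l j) y - pd l (fun z => christoffel g z i k j) y
    + ∑ m, (christoffel g y i k m * christoffel g y m l j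
      - christoffel g y i l m * christoffel g y m k j)

/-- `Riem_{ijkl}`, normalized so that `g^{ik} Riem_{ijkl} = Ric_{jl}`. -/
def riem (g : Cov2 n ℝ) (y : Vec n) (i j k l : Fin (n + 1)) : ℝ :=
  ∑ m, g y i m * curv g y m j k l

/-- The Ricci tensor `Ric_{jl} = R^i_{jil}`. -/
def ricci (g : Cov2 n ℝ) : Cov2 n ℝ := fun y j l => ∑ i, curv g y i j i l

/-- The trace `g^{ij} h_{ij}`. -/
def trace (g h : Cov2 n ℝ) (y : Vec n) : ℝ := ∑ i, ∑ j, inv g y i j * h y i j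

/-- The divergence `(δh)_j = -∇^i h_{ij}`. -/
def divergence (g h : Cov2 n ℝ) : Cov1 n ℝ := fun y j =>
  -∑ i, ∑ k, inv g y i k * cov2 g h y k i j

/-- The Bianchi map `B = δ + (1/2) d tr`. -/
def bianchi (g h : Cov2 n ℝ) : Cov1 n ℝ := fun y j =>
  divergence g h y j + (1 / 2 : ℝ) * pd j (trace g h) y

/-- `δ^*`, the symmetrization of `∇` on 1-forms. -/
def deltaStar (g : Cov2 n ℝ) (η : Cov1 n ℝ) : Cov2 n ℝ := fun y i j =>
  (1 / 2 : ℝ) * (cov1 g η y i j + cov1 g η y j i)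

/-- The vector field `η^♯` dual to a 1-form `η`. -/
def sharp (g : Cov2 n ℝ) (η : Cov1 n ℝ) : Cov1 n ℝ := fun y k => ∑ l, inv g y k l * η y l

/-- The Lie derivative of the 2-tensor `h` along the vector field `X`. -/
def lieDeriv (X : Cov1 n ℝ) (h : Cov2 n ℝ) : Cov2 n ℝ := fun y i j =>
  ∑ k, (X y k * pd k (fun z => h z i j) y + h y k j * pd i (fun z => X z k) y
    + h y i k * pd j (fun z => X z k) y)

/-- The Bochner Laplacian `∇^*∇` on 2-tensors. -/
def bochner (g h : Cov2 n ℝ) : Cov2 n ℝ := fun y j l =>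
  -∑ i, ∑ m, inv g y i m * cov3 g (cov2 g h) y i m j l

/-- `(Ric~ h)_{jl} = (1/2) (Ric_{jk} h^k_l + Ric_{lk} h^k_j)`. -/
def ricAct (g h : Cov2 n ℝ) : Cov2 n ℝ := fun y j l =>
  (1 / 2 : ℝ) * ∑ k, ∑ m, inv g y k m * (ricci g y j k * h y m l + ricci g y l k * h y m j)

/-- `(Riem~ h)_{jl} = Riem_{ijkl} h^{ik}`. -/
def riemAct (g h : Cov2 n ℝ) : Cov2 n ℝ := fun y j l =>
  ∑ i, ∑ k, riem g y i j k l * ∑ a, ∑ b, inv g y i a * inv g y k b * h y a b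

/-- The Lichnerowicz Laplacian `Δ_L = ∇^*∇ + 2 (Ric~ - Riem~)`. -/
def lichnerowicz (g h : Cov2 n ℝ) : Cov2 n ℝ := fun y j l =>
  bochner g h y j l + 2 * (ricAct g h y j l - riemAct g h y j l)

/-- `Δ_(n) = Δ_L + 2n`. -/
def lichN (g h : Cov2 n ℝ) : Cov2 n ℝ := fun y j l =>
  lichnerowicz g h y j l + 2 * (n : ℝ) * h y j l

/-- `𝓛 h = Δ_L h + 2n h - L_{(B h)^♯} g`. -/
def einsteinLin (g h : Cov2 n ℝ) : Cov2 n ℝ := fun y j l =>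
  lichN g h y j l - lieDeriv (sharp g (bianchi g h)) g y j l

/-! Gauge theory in a local gauge.  `br` is the bracket of the Lie algebra `𝔩`, `q` an inner
product on it, and `ϖ` the gauge potential, i.e. the pull-back of the connection form by a local
section of the principal bundle.  Forms with values in the adjoint bundle are pulled back by the
same section. -/

variable {𝔩 : Type*} [NormedAddCommGroup 𝔩] [NormedSpace ℝ 𝔩]

/-- The curvature `Ω = dϖ + (1/2) [ϖ ∧ ϖ]`. -/
def ymCurv (br : 𝔩 → 𝔩 → 𝔩) (ϖ : Cov1 n 𝔩) : Cov2 n 𝔩 := fun y i j =>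
  pd i (fun z => ϖ z j) y - pd j (fun z => ϖ z i) y + br (ϖ y i) (ϖ y j)

/-- `d_ϖ` on 0-forms. -/
def dCov0 (br : 𝔩 → 𝔩 → 𝔩) (ϖ : Cov1 n 𝔩) (f : Vec n → 𝔩) : Cov1 n 𝔩 := fun y i =>
  pd i f y + br (ϖ y i) (f y)

/-- `d_ϖ` on 1-forms. -/
def dCov1 (br : 𝔩 → 𝔩 → 𝔩) (ϖ a : Cov1 n 𝔩) : Cov2 n 𝔩 := fun y i j =>
  pd i (fun z => a z j) y - pd j (fun z => a z i) y + br (ϖ y i) (a y j) - br (ϖ y j) (a y i)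

/-- The formal adjoint `d_ϖ^*` on 1-forms, `-g^{ij} ∇^ϖ_i a_j`. -/
def dStar1 (br : 𝔩 → 𝔩 → 𝔩) (g : Cov2 n ℝ) (ϖ a : Cov1 n 𝔩) (y : Vec n) : 𝔩 :=
  -∑ i, ∑ j, inv g y i j • (cov1 g a y i j + br (ϖ y i) (a y j))

/-- The formal adjoint `d_ϖ^*` on 2-forms, `-g^{ik} ∇^ϖ_i Φ_{kj}`. -/
def dStar2 (br : 𝔩 → 𝔩 → 𝔩) (g : Cov2 n ℝ) (ϖ : Cov1 n 𝔩) (Φ : Cov2 n 𝔩) : Cov1 n 𝔩 :=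
  fun y j => -∑ i, ∑ k, inv g y i k • (cov2 g Φ y i k j + br (ϖ y i) (Φ y k j))

/-- The twisted Hodge Laplacian `Δ^1_ϖ = d_ϖ d_ϖ^* + d_ϖ^* d_ϖ` on 1-forms. -/
def hodge1 (br : 𝔩 → 𝔩 → 𝔩) (g : Cov2 n ℝ) (ϖ a : Cov1 n 𝔩) : Cov1 n 𝔩 := fun y i =>
  dCov0 br ϖ (dStar1 br g ϖ a) y i + dStar2 br g ϖ (dCov1 br ϖ a) y i

/-- The self-action density `Q = -(1/4) g^{ik} g^{jm} q(Ω_{ij}, Ω_{km})`. -/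
def selfAction (br : 𝔩 → 𝔩 → 𝔩) (q : 𝔩 →L[ℝ] 𝔩 →L[ℝ] ℝ) (g : Cov2 n ℝ) (ϖ : Cov1 n 𝔩)
    (y : Vec n) : ℝ :=
  -(1 / 4 : ℝ) * ∑ i, ∑ j, ∑ k, ∑ m,
    inv g y i k * inv g y j m * q (ymCurv br ϖ y i j) (ymCurv br ϖ y k m)

/-- The stress-energy tensor `K_{ij} = (1/2) g^{km} q(Ω_{ik}, Ω_{jm}) + (1/2) Q g_{ij}`. -/
def stress (br : 𝔩 → 𝔩 → 𝔩) (q : 𝔩 →L[ℝ] 𝔩 →L[ℝ] ℝ) (g : Cov2 n ℝ) (ϖ : Cov1 n 𝔩) :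
    Cov2 n ℝ := fun y i j =>
  (1 / 2 : ℝ) * (∑ k, ∑ m, inv g y k m * q (ymCurv br ϖ y i k) (ymCurv br ϖ y j m))
    + (1 / 2 : ℝ) * selfAction br q g ϖ y * g y i j

/-- The modified stress-energy tensor `K~ = K - (tr K / (n - 1)) g`. -/
def stressMod (br : 𝔩 → 𝔩 → 𝔩) (q : 𝔩 →L[ℝ] 𝔩 →L[ℝ] ℝ) (g : Cov2 n ℝ) (ϖ : Cov1 n 𝔩) :
    Cov2 n ℝ := fun y i j =>
  stress br q g ϖ y i j - trace g (stress br q g ϖ) y / ((n : ℝ) - 1) * g y i j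

/-- The metric component of the gauged operator at
`(g, ϖ) = (g₀ + Θ + A, ϖ₀ + ε + a)`:
`Ric_g + n g - K~_{g,ϖ} + δ^*_g B_{g₀ + Θ} A`. -/
def opQ (br : 𝔩 → 𝔩 → 𝔩) (q : 𝔩 →L[ℝ] 𝔩 →L[ℝ] ℝ) (g₀ Θ A : Cov2 n ℝ) (ϖ₀ ε a : Cov1 n 𝔩) :
    Cov2 n ℝ := fun y i j =>
  ricci (g₀ + Θ + A) y i j + (n : ℝ) * (g₀ + Θ + A) y i j
    - stressMod br q (g₀ + Θ + A) (ϖ₀ + ε + a) y i j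
    + deltaStar (g₀ + Θ + A) (bianchi (g₀ + Θ) A) y i j

/-- The connection component of the gauged operator at
`(g, ϖ) = (g₀ + Θ + A, ϖ₀ + ε + a)`:
`d^*_{g,ϖ} Ω_ϖ + d_ϖ d^*_{g₀ + Θ, ϖ₀ + ε} a`. -/
def opR (br : 𝔩 → 𝔩 → 𝔩) (g₀ Θ A : Cov2 n ℝ) (ϖ₀ ε a : Cov1 n 𝔩) : Cov1 n 𝔩 := fun y i =>
  dStar2 br (g₀ + Θ + A) (ϖ₀ + ε + a) (ymCurv br (ϖ₀ + ε + a)) y i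
    + dCov0 br (ϖ₀ + ε + a) (dStar1 br (g₀ + Θ) (ϖ₀ + ε) a) y i

/-- All components of `h`, and their partial derivatives of order at most two, are bounded by `r`
at the point `y`. -/
def JetBound2 (h : Cov2 n ℝ) (y : Vec n) (r : ℝ) : Prop :=
  ∀ i j, |h y i j| ≤ r ∧ (∀ k, |pd k (fun z => h z i j) y| ≤ r) ∧
    ∀ k l, |pd k (pd l (fun z => h z i j)) y| ≤ r

/-- All components of `a`, and their partial derivatives of order at most two, are bounded by `r`
at the point `y`. -/
def JetBound1 (a : Cov1 n 𝔩) (y : Vec n) (r : ℝ) : Prop :=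
  ∀ i, ‖a y i‖ ≤ r ∧ (∀ k, ‖pd k (fun z => a z i) y‖ ≤ r) ∧
    ∀ k l, ‖pd k (pd l (fun z => a z i)) y‖ ≤ r

end Local

/-! ### Lie groups, principal bundles and connections -/

section Global

/-- The bracket of the Lie algebra `𝔩 = T_1 L`, which is identified with the model space. -/
def lieBr {EL : Type*} [NormedAddCommGroup EL] [NormedSpace ℝ EL] (L : Type*)
    [TopologicalSpace L] [ChartedSpace EL L] [Group L] (X Y : EL) : EL :=
  (Bracket.bracket : GroupLieAlgebra 𝓘(ℝ, EL) L → GroupLieAlgebra 𝓘(ℝ, EL) L →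
    GroupLieAlgebra 𝓘(ℝ, EL) L) X Y

/-- The adjoint representation of `L` on `𝔩 = T_1 L`. -/
def Ad {EL : Type*} [NormedAddCommGroup EL] [NormedSpace ℝ EL] {L : Type*}
    [TopologicalSpace L] [ChartedSpace EL L] [Group L] (l : L) : EL →L[ℝ] EL :=
  mfderiv 𝓘(ℝ, EL) 𝓘(ℝ, EL) (fun x : L => l * x * l⁻¹) 1

/-- `q` is an `Ad`-invariant inner product on the Lie algebra of `L`. -/
structure IsAdInvariantInner {EL : Type*} [NormedAddCommGroup EL] [NormedSpace ℝ EL] (L : Type*)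
    [TopologicalSpace L] [ChartedSpace EL L] [Group L] (q : EL →L[ℝ] EL →L[ℝ] ℝ) : Prop where
  symm : ∀ X Y, q X Y = q Y X
  pos : ∀ X, X ≠ 0 → 0 < q X X
  invariant : ∀ (l : L) (X Y : EL), q (Ad l X) (Ad l Y) = q X Y

/-- `π : P → M` is a smooth principal bundle with structure group `L`, which acts on `P` from the
right (i.e. `Lᵐᵒᵖ` acts from the left).  Over `U`, the map `(p, l) ↦ s(p) l` is an equivariant
diffeomorphism `U × L → π⁻¹(U)` with inverse `(π, τ)`. -/
structure IsPrincipalBundle (n : ℕ) {M : Type*} [TopologicalSpace M] [ChartedSpace (Vec n) M]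
    (EL : Type*) [NormedAddCommGroup EL] [NormedSpace ℝ EL] (L : Type*) [TopologicalSpace L]
    [ChartedSpace EL L] [Group L] (EP : Type*) [NormedAddCommGroup EP] [NormedSpace ℝ EP]
    {P : Type*} [TopologicalSpace P] [ChartedSpace EP P] [MulAction Lᵐᵒᵖ P] (π : P → M) :
    Prop where
  smooth_proj : ContMDiff 𝓘(ℝ, EP) (𝓡 (n + 1)) ∞ π
  smooth_act : ContMDiff (𝓘(ℝ, EP).prod 𝓘(ℝ, EL)) 𝓘(ℝ, EP) ∞
    (fun z : P × L => MulOpposite.op z.2 • z.1)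
  proj_act : ∀ (u : P) (l : L), π (MulOpposite.op l • u) = π u
  free : ∀ (u : P) (l : L), MulOpposite.op l • u = u → l = 1
  locally_trivial : ∀ p : M, ∃ U : Set M, IsOpen U ∧ p ∈ U ∧ ∃ (s : M → P) (τ : P → L),
    ContMDiffOn (𝓡 (n + 1)) 𝓘(ℝ, EP) ∞ s U ∧ (∀ p' ∈ U, π (s p') = p') ∧
    ContMDiffOn 𝓘(ℝ, EP) 𝓘(ℝ, EL) ∞ τ (π ⁻¹' U) ∧
    ∀ u ∈ π ⁻¹' U, u = MulOpposite.op (τ u) • s (π u)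

/-- `s` restricts to a smooth local section of `π` over the set `U`. -/
def IsLocalSection (n : ℕ) {M : Type*} [TopologicalSpace M] [ChartedSpace (Vec n) M]
    (EP : Type*) [NormedAddCommGroup EP] [NormedSpace ℝ EP] {P : Type*} [TopologicalSpace P]
    [ChartedSpace EP P] (π : P → M) (U : Set M) (s : M → P) : Prop :=
  ContMDiffOn (𝓡 (n + 1)) 𝓘(ℝ, EP) ∞ s U ∧ ∀ p ∈ U, π (s p) = p

/-- Covariant 2-tensor fields on `M`. -/
abbrev Tensor2 (n : ℕ) (M : Type*) [TopologicalSpace M] [ChartedSpace (Vec n) M] : Type _ :=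
  ∀ p : M, TangentSpace (𝓡 (n + 1)) p →L[ℝ] TangentSpace (𝓡 (n + 1)) p →L[ℝ] ℝ

/-- 1-forms on `P` with values in the vector space `𝔩`. -/
abbrev Form1 (EP : Type*) [NormedAddCommGroup EP] [NormedSpace ℝ EP] (P : Type*)
    [TopologicalSpace P] [ChartedSpace EP P] (𝔩 : Type*) [NormedAddCommGroup 𝔩]
    [NormedSpace ℝ 𝔩] : Type _ :=
  ∀ u : P, TangentSpace 𝓘(ℝ, EP) u →L[ℝ] 𝔩

/-- `h` is a symmetric 2-tensor field of class `C^r` on `M`. -/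
structure IsSymTensor {n : ℕ} {M : Type*} [TopologicalSpace M] [ChartedSpace (Vec n) M]
    [IsManifold (𝓡 (n + 1)) ∞ M] (r : WithTop ℕ∞) (h : Tensor2 n M) : Prop where
  symm : ∀ p v w, h p v w = h p w v
  contMDiff : ContMDiff (𝓡 (n + 1)) ((𝓡 (n + 1)).prod 𝓘(ℝ, Vec n →L[ℝ] Vec n →L[ℝ] ℝ)) r
    (fun p => Bundle.TotalSpace.mk' (Vec n →L[ℝ] Vec n →L[ℝ] ℝ)
      (E := fun p : M => TangentSpace (𝓡 (n + 1)) p →L[ℝ] TangentSpace (𝓡 (n + 1)) p →L[ℝ] ℝ)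
      p (h p))

/-- The 1-form `α` on `P` is of class `C^r`. -/
def IsCForm {EP : Type*} [NormedAddCommGroup EP] [NormedSpace ℝ EP] {P : Type*}
    [TopologicalSpace P] [ChartedSpace EP P] [IsManifold 𝓘(ℝ, EP) ∞ P] {𝔩 : Type*}
    [NormedAddCommGroup 𝔩] [NormedSpace ℝ 𝔩] (r : WithTop ℕ∞) (α : Form1 EP P 𝔩) : Prop :=
  ContMDiff 𝓘(ℝ, EP) (𝓘(ℝ, EP).prod 𝓘(ℝ, EP →L[ℝ] 𝔩)) r
    (fun u => Bundle.TotalSpace.mk' (EP →L[ℝ] 𝔩)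
      (E := fun u : P => TangentSpace 𝓘(ℝ, EP) u →L[ℝ] Bundle.Trivial P 𝔩 u) u (α u))

section Forms

variable {EL : Type*} [NormedAddCommGroup EL] [NormedSpace ℝ EL] (L : Type*) [TopologicalSpace L]
  [ChartedSpace EL L] [Group L] {EP : Type*} [NormedAddCommGroup EP] [NormedSpace ℝ EP]
  {P : Type*} [TopologicalSpace P] [ChartedSpace EP P] [MulAction Lᵐᵒᵖ P]

/-- `R_l^* α = Ad_{l⁻¹} α` for all `l ∈ L`. -/
def IsEquivariant (α : Form1 EP P EL) : Prop :=
  ∀ (l : L) (u : P) (v : TangentSpace 𝓘(ℝ, EP) u),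
    α (MulOpposite.op l • u)
      (mfderiv 𝓘(ℝ, EP) 𝓘(ℝ, EP) (fun u' : P => MulOpposite.op l • u') u v)
      = Ad l⁻¹ (α u v)

/-- The value at `u` of the fundamental vector field `X^*` of `X ∈ 𝔩`. -/
def fundamental (u : P) (X : EL) : EP :=
  (mfderiv 𝓘(ℝ, EL) 𝓘(ℝ, EP) (fun l : L => MulOpposite.op l • u) 1 : EL →L[ℝ] EP) X

/-- `ϖ` is a smooth connection form. -/
structure IsConnection [IsManifold 𝓘(ℝ, EP) ∞ P] (ϖ : Form1 EP P EL) : Prop where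
  smooth : IsCForm ∞ ϖ
  equivariant : IsEquivariant L ϖ
  vertical : ∀ (u : P) (X : EL), ϖ u (fundamental L u X : EP) = X

/-- `α` is an equivariant horizontal 1-form of class `C^r`, i.e. a 1-form on the base with values
in the adjoint bundle. -/
structure IsAdForm [IsManifold 𝓘(ℝ, EP) ∞ P] (r : WithTop ℕ∞) (α : Form1 EP P EL) : Prop where
  contMDiff : IsCForm r α
  equivariant : IsEquivariant L α
  horizontal : ∀ (u : P) (X : EL), α u (fundamental L u X : EP) = 0

end Forms

/-- The components of the 2-tensor `h` in the chart `φ`. -/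
def rep2 {n : ℕ} {M : Type*} [TopologicalSpace M] [ChartedSpace (Vec n) M]
    (φ : OpenPartialHomeomorph M (Vec n)) (h : Tensor2 n M) : Cov2 n ℝ := fun y i j =>
  h (φ.symm y)
    (mfderiv (𝓡 (n + 1)) (𝓡 (n + 1)) φ.symm y (EuclideanSpace.single i (1 : ℝ) : Vec n))
    (mfderiv (𝓡 (n + 1)) (𝓡 (n + 1)) φ.symm y (EuclideanSpace.single j (1 : ℝ) : Vec n))

/-- The components in the chart `φ` of the pull-back `s^* α` of a 1-form on `P`. -/
def rep1 {n : ℕ} {M : Type*} [TopologicalSpace M] [ChartedSpace (Vec n) M]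
    {EP : Type*} [NormedAddCommGroup EP] [NormedSpace ℝ EP] {P : Type*} [TopologicalSpace P]
    [ChartedSpace EP P] {𝔩 : Type*} [NormedAddCommGroup 𝔩] [NormedSpace ℝ 𝔩]
    (φ : OpenPartialHomeomorph M (Vec n)) (s : M → P) (α : Form1 EP P 𝔩) : Cov1 n 𝔩 := fun y i =>
  α (s (φ.symm y))
    (mfderiv (𝓡 (n + 1)) 𝓘(ℝ, EP) (fun z => s (φ.symm z)) y
      (EuclideanSpace.single i (1 : ℝ) : Vec n))

/-- `Ric_g = -n g`. -/
def IsEinstein (n : ℕ) {M : Type*} [TopologicalSpace M] [ChartedSpace (Vec n) M]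
    (g : Tensor2 n M) : Prop :=
  ∀ φ ∈ IsManifold.maximalAtlas (𝓡 (n + 1)) ∞ M, ∀ y ∈ φ.target, ∀ i j,
    ricci (rep2 φ g) y i j = -(n : ℝ) * rep2 φ g y i j

/-- The connection form `ϖ` is flat: its curvature vanishes in all charts and local gauges. -/
def IsFlat (n : ℕ) {M : Type*} [TopologicalSpace M] [ChartedSpace (Vec n) M]
    {EL : Type*} [NormedAddCommGroup EL] [NormedSpace ℝ EL] (L : Type*) [TopologicalSpace L]
    [ChartedSpace EL L] [Group L]
    {EP : Type*} [NormedAddCommGroup EP] [NormedSpace ℝ EP] {P : Type*} [TopologicalSpace P]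
    [ChartedSpace EP P] (π : P → M) (ϖ : Form1 EP P EL) : Prop :=
  ∀ φ ∈ IsManifold.maximalAtlas (𝓡 (n + 1)) ∞ M, ∀ s, IsLocalSection n EP π φ.source s →
    ∀ y ∈ φ.target, ∀ i j, ymCurv (lieBr L) (rep1 φ s ϖ) y i j = 0

/-! The gauged operator and the two blocks, in a chart `φ` of `M` and a local gauge `s`. -/

section Operator

variable {n : ℕ} {M : Type*} [TopologicalSpace M] [ChartedSpace (Vec n) M]
  {EL : Type*} [NormedAddCommGroup EL] [NormedSpace ℝ EL] (L : Type*) [TopologicalSpace L]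
  [ChartedSpace EL L] [Group L]
  {EP : Type*} [NormedAddCommGroup EP] [NormedSpace ℝ EP] {P : Type*} [TopologicalSpace P]
  [ChartedSpace EP P]

/-- Components of `Ric_g + n g - K~_{g,ϖ} + δ^*_g B_{g₀ + Θ} A`, where
`(g, ϖ) = (g₀ + Θ + A, ϖ₀ + ε + a)`. -/
def gaugedQ (q : EL →L[ℝ] EL →L[ℝ] ℝ) (φ : OpenPartialHomeomorph M (Vec n)) (s : M → P)
    (g₀ : Tensor2 n M) (ϖ₀ : Form1 EP P EL) (Θ A : Tensor2 n M) (ε a : Form1 EP P EL) :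
    Cov2 n ℝ :=
  opQ (lieBr L) q (rep2 φ g₀) (rep2 φ Θ) (rep2 φ A) (rep1 φ s ϖ₀) (rep1 φ s ε) (rep1 φ s a)

/-- Components of `d^*_{g,ϖ} Ω_ϖ + d_ϖ d^*_{g₀ + Θ, ϖ₀ + ε} a`, where
`(g, ϖ) = (g₀ + Θ + A, ϖ₀ + ε + a)`. -/
def gaugedR (φ : OpenPartialHomeomorph M (Vec n)) (s : M → P)
    (g₀ : Tensor2 n M) (ϖ₀ : Form1 EP P EL) (Θ A : Tensor2 n M) (ε a : Form1 EP P EL) :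
    Cov1 n EL :=
  opR (lieBr L) (rep2 φ g₀) (rep2 φ Θ) (rep2 φ A) (rep1 φ s ϖ₀) (rep1 φ s ε) (rep1 φ s a)

/-- Components of the modified stress-energy tensor `K~_{g,ϖ}`. -/
def stressModRep (q : EL →L[ℝ] EL →L[ℝ] ℝ) (φ : OpenPartialHomeomorph M (Vec n)) (s : M → P)
    (g : Tensor2 n M) (ϖ : Form1 EP P EL) : Cov2 n ℝ :=
  stressMod (lieBr L) q (rep2 φ g) (rep1 φ s ϖ)

/-- Components of the metric block `(1/2) (𝓛 Θ + Δ_(n) A)`. -/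
def metricBlock (φ : OpenPartialHomeomorph M (Vec n)) (g₀ Θ A : Tensor2 n M) : Cov2 n ℝ :=
  fun y i j => (1 / 2 : ℝ) *
    (einsteinLin (rep2 φ g₀) (rep2 φ Θ) y i j + lichN (rep2 φ g₀) (rep2 φ A) y i j)

/-- Components of the connection block `d^*_{ϖ₀} d_{ϖ₀} ε + Δ^1_{ϖ₀} a`. -/
def connectionBlock (φ : OpenPartialHomeomorph M (Vec n)) (s : M → P)
    (g₀ : Tensor2 n M) (ϖ₀ ε a : Form1 EP P EL) : Cov1 n EL :=
  fun y i =>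
    dStar2 (lieBr L) (rep2 φ g₀) (rep1 φ s ϖ₀) (dCov1 (lieBr L) (rep1 φ s ϖ₀) (rep1 φ s ε)) y i
      + hodge1 (lieBr L) (rep2 φ g₀) (rep1 φ s ϖ₀) (rep1 φ s a) y i

end Operator

end Global

end EYM

end

/-! Every operator in sight is a polynomial in the 2-jets of `g`, `ϖ` and in the inverse metric, so
the claim is a local one about components in a chart and a gauge, and only the terms of first order
in the perturbation have to be identified.

Metric component. With `h = Θ + A`, the Christoffel symbols of `g₀ + h` are exactly those of `g₀`
plus a tensor `C`, obtained by raising an index of `(1/2) (∇_i h_{jl} + ∇_j h_{il} - ∇_l h_{ij})`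
with the inverse of `g₀ + h` (`christoffel_add`). The Ricci tensor is then exactly `Ric` plus a part
linear in `C` plus a part quadratic in `C` (`ricci_add`). Replacing the inverse of `g₀ + h` by that
of `g₀` in the linear part and commuting two covariant derivatives gives the classical formula
`(1/2) Δ_L h - δ^* B h` (`IsMetricAt.ricciPolar_eq`). The gauge term contributes `+ δ^* B A` and so
removes the degenerate part for `A`; for `Θ` that part remains, and it is half a Lie derivative of
the metric because `L_{η^♯} g = 2 δ^* η` (`IsMetricAt.lieDeriv_sharp`). The zeroth-order part `Ric +
n g₀` vanishes by the Einstein equation. The stress-energy tensor is quadratic in the curvature, and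
the curvature is itself of first order since `ϖ₀` is flat, so it does not contribute.

Connection component. Flatness gives `Ω = d_{ϖ₀}(ε + a) + [·,·]`, whose last term is of second
order. As `Ω` is already of first order, `d^*_{g,ϖ}` may be taken at the trivial configuration. The
gauge term adds `d d^* a`, completing `d^* d a` to the Hodge Laplacian.

Uniformity. Rather than differentiating along curves, the proof bounds the remainder for all
perturbations at once. `JetO 𝒥 k p f` says that the `k`-jets at the base points are `O(r ^ p)`
uniformly over a family, and `JetClose` says that two such families agree to leading order. Both
notions are stable under sums, products and partial derivatives, so each geometric operator is
treated by following its definition. The outcome is `exists_quadratic_bound`. The directional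
derivatives and the vanishing at the trivial configuration follow from it along rays `t ↦ t • (Θ, A;
ε, a)`. The remaining work is to see that components in a chart and a gauge satisfy the hypotheses
of the local result. -/

namespace EYM

open Filter Topology Asymptotics Bundle

/-! ### Rules for partial derivatives. -/

section Calculus

variable {n : ℕ} {F : Type*} [NormedAddCommGroup F] [NormedSpace ℝ F]
  {G : Type*} [NormedAddCommGroup G] [NormedSpace ℝ G]
  {H : Type*} [NormedAddCommGroup H] [NormedSpace ℝ H] {y : Vec n}

theorem pd_congr {f f' : Vec n → F} (h : f =ᶠ[𝓝 y] f') (i : Fin (n + 1)) :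
    pd i f y = pd i f' y := by
  simp only [pd, h.fderiv_eq]

theorem pd_eventuallyEq {f f' : Vec n → F} (h : f =ᶠ[𝓝 y] f') (i : Fin (n + 1)) :
    pd i f =ᶠ[𝓝 y] pd i f' := by
  filter_upwards [h.fderiv (𝕜 := ℝ)] with z hz
  simp only [pd, hz]

theorem pd_add {f f' : Vec n → F} (hf : DifferentiableAt ℝ f y) (hf' : DifferentiableAt ℝ f' y)
    (i : Fin (n + 1)) : pd i (fun z => f z + f' z) y = pd i f y + pd i f' y := by
  simp only [pd, fderiv_fun_add hf hf', add_apply]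

theorem pd_sub {f f' : Vec n → F} (hf : DifferentiableAt ℝ f y) (hf' : DifferentiableAt ℝ f' y)
    (i : Fin (n + 1)) : pd i (fun z => f z - f' z) y = pd i f y - pd i f' y := by
  simp only [pd, fderiv_fun_sub hf hf', sub_apply]

theorem pd_neg (f : Vec n → F) (i : Fin (n + 1)) : pd i (fun z => - f z) y = - pd i f y := by
  simp only [pd, fderiv_fun_neg, neg_apply]

theorem pd_sum {ι : Type*} (s : Finset ι) {f : ι → Vec n → F}
    (hf : ∀ a ∈ s, DifferentiableAt ℝ (f a) y) (i : Fin (n + 1)) :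
    pd i (fun z => ∑ a ∈ s, f a z) y = ∑ a ∈ s, pd i (f a) y := by
  simp only [pd, fderiv_fun_sum hf, sum_apply]

theorem pd_bilin (B : F →L[ℝ] G →L[ℝ] H) {f : Vec n → F} {f' : Vec n → G}
    (hf : DifferentiableAt ℝ f y) (hf' : DifferentiableAt ℝ f' y) (i : Fin (n + 1)) :
    pd i (fun z => B (f z) (f' z)) y = B (pd i f y) (f' y) + B (f y) (pd i f' y) := by
  have h := (B.hasFDerivAt_of_bilinear hf.hasFDerivAt hf'.hasFDerivAt).fderiv
  simp only [pd, h]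
  simp [add_comm]

theorem pd_mul {f f' : Vec n → ℝ} (hf : DifferentiableAt ℝ f y) (hf' : DifferentiableAt ℝ f' y)
    (i : Fin (n + 1)) : pd i (fun z => f z * f' z) y = pd i f y * f' y + f y * pd i f' y :=
  pd_bilin (ContinuousLinearMap.mul ℝ ℝ) hf hf' i

theorem pd_sum_mul {ι : Type*} (s : Finset ι) {f f' : ι → Vec n → ℝ}
    (hf : ∀ a, DifferentiableAt ℝ (f a) y) (hf' : ∀ a, DifferentiableAt ℝ (f' a) y)
    (i : Fin (n + 1)) : pd i (fun z => ∑ a ∈ s, f a z * f' a z) y =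
      ∑ a ∈ s, pd i (f a) y * f' a y + ∑ a ∈ s, f a y * pd i (f' a) y := by
  rw [pd_sum s fun a _ => (hf a).fun_mul (hf' a), ← Finset.sum_add_distrib]
  exact Finset.sum_congr rfl fun a _ => pd_mul (hf a) (hf' a) i

/-- A scalar factor passes through `fderiv` with no differentiability hypothesis, since the scalars
form a field. The homogeneity lemmas for the geometric operators therefore need no regularity. -/
theorem pd_const_smul (c : ℝ) (f : Vec n → F) (i : Fin (n + 1)) :
    pd i (fun z => c • f z) y = c • pd i f y := by
  have h := congrFun (fderiv_const_smul_field (𝕜 := ℝ) (f := f) c) y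
  simp only [pd]
  rw [show (fun z => c • f z) = c • f from rfl, h]
  rfl

theorem pd_const_mul (c : ℝ) (f : Vec n → ℝ) (i : Fin (n + 1)) :
    pd i (fun z => c * f z) y = c * pd i f y :=
  pd_const_smul c f i

theorem pd_const (c : F) (i : Fin (n + 1)) : pd i (fun _ : Vec n => c) y = 0 := by
  simp [pd]

theorem contDiffAt_pd {k m : ℕ∞ω} {f : Vec n → F} (hf : ContDiffAt ℝ m f y) (hkm : k + 1 ≤ m)
    (i : Fin (n + 1)) : ContDiffAt ℝ k (pd i f) y :=
  (hf.fderiv_right hkm).clm_apply contDiffAt_const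

theorem pd_comm {f : Vec n → F} (hf : ContDiffAt ℝ 2 f y) (i j : Fin (n + 1)) :
    pd i (pd j f) y = pd j (pd i f) y := by
  have hd : DifferentiableAt ℝ (fderiv ℝ f) y :=
    (hf.fderiv_right (m := 1) (by norm_num)).differentiableAt (by norm_num)
  have key : ∀ a b : Fin (n + 1), pd a (pd b f) y =
      fderiv ℝ (fderiv ℝ f) y (EuclideanSpace.single a 1) (EuclideanSpace.single b 1) := by
    intro a b
    simp only [pd]
    rw [show pd b f = fun z => fderiv ℝ f z (EuclideanSpace.single b 1) from rfl,
      fderiv_clm_apply hd (differentiableAt_const _)]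
    simp
  rw [key, key]
  exact (hf.isSymmSndFDerivAt (by simp)).eq _ _

end Calculus

/-! ### Inverse metric, Christoffel symbols and metric compatibility. -/

section Metric

variable {n : ℕ} {g h : Cov2 n ℝ} {y : Vec n}

/-- The components of `g` are symmetric, of class `C^k` near `y`, and invertible at `y`. -/
structure IsMetricAt (k : ℕ∞ω) (g : Cov2 n ℝ) (y : Vec n) : Prop where
  symm : ∀ z i j, g z i j = g z j i
  smooth : ∀ i j, ContDiffAt ℝ k (fun z => g z i j) y
  det_ne : (Matrix.of (g y)).det ≠ 0

theorem contDiffAt_det {ι : Type*} [Fintype ι] [DecidableEq ι] {k : ℕ∞ω}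
    {A : Vec n → Matrix ι ι ℝ} (hA : ∀ i j, ContDiffAt ℝ k (fun z => A z i j) y) :
    ContDiffAt ℝ k (fun z => (A z).det) y := by
  simp only [Matrix.det_apply]
  refine ContDiffAt.sum fun σ _ => ContDiffAt.const_smul _ ?_
  exact contDiffAt_prod fun i _ => hA _ _

theorem eventually_det_ne {k : ℕ∞ω} (hg : ∀ i j, ContDiffAt ℝ k (fun z => g z i j) y)
    (hdet : (Matrix.of (g y)).det ≠ 0) : ∀ᶠ z in 𝓝 y, (Matrix.of (g z)).det ≠ 0 :=
  (contDiffAt_det (A := fun z => Matrix.of (g z)) hg).continuousAt.eventually_ne hdet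

/-- By Cramer's rule the entries of the inverse are quotients of polynomials in the entries of `g`.
-/
theorem contDiffAt_inv {k : ℕ∞ω} (hg : ∀ i j, ContDiffAt ℝ k (fun z => g z i j) y)
    (hdet : (Matrix.of (g y)).det ≠ 0) (i j : Fin (n + 1)) :
    ContDiffAt ℝ k (fun z => inv g z i j) y := by
  simp only [inv, Matrix.inv_def, Ring.inverse_eq_inv', Matrix.smul_apply, smul_eq_mul,
    Matrix.adjugate_apply]
  refine ((contDiffAt_det (A := fun z => Matrix.of (g z)) hg).inv hdet).mul
    (contDiffAt_det fun a b => ?_)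
  -- An entry of the adjugate is the determinant of the matrix with row `j` replaced by a basis
  -- vector; that row is constant and the others are rows of `g`.
  by_cases ha : a = j
  · subst ha
    simp only [Matrix.updateRow_self]
    exact contDiffAt_const
  · simp only [Matrix.updateRow_ne ha]
    exact hg a b

theorem sum_inv_mul (hdet : (Matrix.of (g y)).det ≠ 0) (i j : Fin (n + 1)) :
    ∑ m, inv g y i m * g y m j = if i = j then 1 else 0 := by
  have := congrFun (congrFun (Matrix.nonsing_inv_mul _ (isUnit_iff_ne_zero.mpr hdet)) i) j
  simpa [Matrix.mul_apply, Matrix.one_apply, inv] using this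

theorem sum_mul_inv (hdet : (Matrix.of (g y)).det ≠ 0) (i j : Fin (n + 1)) :
    ∑ m, g y i m * inv g y m j = if i = j then 1 else 0 := by
  have := congrFun (congrFun (Matrix.mul_nonsing_inv _ (isUnit_iff_ne_zero.mpr hdet)) i) j
  simpa [Matrix.mul_apply, Matrix.one_apply, inv] using this

theorem inv_symm (hs : ∀ i j, g y i j = g y j i) (i j : Fin (n + 1)) :
    inv g y i j = inv g y j i := by
  have h1 : (Matrix.of (g y)).transpose = Matrix.of (g y) := by
    ext a b; exact hs b a
  have h2 := congrFun (congrFun (Matrix.transpose_nonsing_inv (Matrix.of (g y))) i) j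
  rw [h1] at h2
  exact h2.symm

theorem pd_inv_eq (hg : ∀ i j, ContDiffAt ℝ 1 (fun z => g z i j) y)
    (hdet : (Matrix.of (g y)).det ≠ 0) (m i j : Fin (n + 1)) :
    pd m (fun z => inv g z i j) y =
      -∑ a, ∑ b, inv g y i a * pd m (fun z => g z a b) y * inv g y b j := by
  have hG := contDiffAt_inv hg hdet
  have hmat : Matrix.of (fun i j => pd m (fun z => inv g z i j) y) * Matrix.of (g y)
      + (Matrix.of (g y))⁻¹ * Matrix.of (fun i j => pd m (fun z => g z i j) y) = 0 := by
    ext a b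
    -- The determinant stays nonzero near `y`, so the product of the inverse and `g` is the identity
    -- on a neighbourhood and can be differentiated there.
    have h0 : pd m (fun z => ∑ c, inv g z a c * g z c b) y = 0 := by
      rw [pd_congr (f' := fun _ => if a = b then 1 else 0), pd_const]
      filter_upwards [eventually_det_ne hg hdet] with z hz using sum_inv_mul hz a b
    rw [pd_sum_mul _ (fun c => (hG a c).differentiableAt one_ne_zero)
      (fun c => (hg c b).differentiableAt one_ne_zero)] at h0
    exact h0
  have h1 : Matrix.of (fun i j => pd m (fun z => inv g z i j) y) =
      -((Matrix.of (g y))⁻¹ * (Matrix.of (fun i j => pd m (fun z => g z i j) y)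
        * (Matrix.of (g y))⁻¹)) := by
    have h2 := congrArg (· * (Matrix.of (g y))⁻¹) hmat
    simp only [add_mul, zero_mul] at h2
    rw [Matrix.mul_nonsing_inv_cancel_right _ _ (isUnit_iff_ne_zero.mpr hdet), mul_assoc] at h2
    exact eq_neg_of_add_eq_zero_left h2
  have h3 := congrFun (congrFun h1 i) j
  simp only [Matrix.of_apply, Matrix.neg_apply, Matrix.mul_apply, Finset.mul_sum] at h3
  rw [h3]
  simp only [inv, mul_assoc]

theorem christoffel_symm (hs : ∀ z i j, g z i j = g z j i) (z : Vec n) (a i j : Fin (n + 1)) :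
    christoffel g z a i j = christoffel g z a j i := by
  simp only [christoffel, fun z => hs z i j]
  congr 1
  exact Finset.sum_congr rfl fun l _ => by ring

namespace IsMetricAt

variable {k : ℕ∞ω}

theorem of_le {m : ℕ∞ω} (hg : IsMetricAt k g y) (hm : m ≤ k) : IsMetricAt m g y :=
  ⟨hg.symm, fun i j => (hg.smooth i j).of_le hm, hg.det_ne⟩

theorem eventually (hg : IsMetricAt k g y) (hk : k ≠ ∞) : ∀ᶠ z in 𝓝 y, IsMetricAt k g z := by
  have h1 : ∀ᶠ z in 𝓝 y, ∀ i j, ContDiffAt ℝ k (fun z => g z i j) z :=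
    eventually_all.2 fun i => eventually_all.2 fun j => (hg.smooth i j).eventually hk
  filter_upwards [h1, eventually_det_ne hg.smooth hg.det_ne] with z h1 h2
  exact ⟨hg.symm, h1, h2⟩

theorem contDiffAt_inv (hg : IsMetricAt k g y) (i j : Fin (n + 1)) :
    ContDiffAt ℝ k (fun z => inv g z i j) y :=
  EYM.contDiffAt_inv hg.smooth hg.det_ne i j

theorem contDiffAt_christoffel {m : ℕ∞ω} (hg : IsMetricAt k g y) (hm : m + 1 ≤ k)
    (a i j : Fin (n + 1)) : ContDiffAt ℝ m (fun z => christoffel g z a i j) y := by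
  have hm' : m ≤ k := le_self_add.trans hm
  refine contDiffAt_const.mul (ContDiffAt.sum fun l _ =>
    ((hg.contDiffAt_inv a l).of_le hm').mul ?_)
  exact ((contDiffAt_pd (hg.smooth _ _) hm i).add (contDiffAt_pd (hg.smooth _ _) hm j)).sub
    (contDiffAt_pd (hg.smooth _ _) hm l)

theorem inv_symm (hg : IsMetricAt k g y) (i j : Fin (n + 1)) : inv g y i j = inv g y j i :=
  EYM.inv_symm (hg.symm y) i j

theorem christoffel_symm (hg : IsMetricAt k g y) (a i j : Fin (n + 1)) :
    christoffel g y a i j = christoffel g y a j i :=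
  EYM.christoffel_symm hg.symm y a i j

theorem sum_mul_christoffel (hg : IsMetricAt k g y) (l i j : Fin (n + 1)) :
    ∑ m, g y l m * christoffel g y m i j = (1 / 2 : ℝ) *
      (pd i (fun z => g z j l) y + pd j (fun z => g z i l) y - pd l (fun z => g z i j) y) := by
  simp only [christoffel, Finset.mul_sum]
  rw [Finset.sum_comm]
  have : ∀ a, ∑ m, g y l m * ((1 / 2 : ℝ) * (inv g y m a *
      (pd i (fun z => g z j a) y + pd j (fun z => g z i a) y - pd a (fun z => g z i j) y)))
      = (if l = a then 1 else 0) * ((1 / 2 : ℝ) *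
      (pd i (fun z => g z j a) y + pd j (fun z => g z i a) y - pd a (fun z => g z i j) y)) := by
    intro a
    rw [← sum_mul_inv hg.det_ne l a, Finset.sum_mul]
    exact Finset.sum_congr rfl fun m _ => by ring
  simp only [this]
  simp

/-- This is `∇g = 0` solved for `∂g`: lowering the index of two Christoffel symbols and adding
cancels all derivatives of `g` but one. -/
theorem pd_metric (hg : IsMetricAt k g y) (i j l : Fin (n + 1)) :
    pd i (fun z => g z j l) y = ∑ m, christoffel g y m i j * g y m l
      + ∑ m, christoffel g y m i l * g y j m := by
  have h1 := hg.sum_mul_christoffel l i j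
  have h2 := hg.sum_mul_christoffel j i l
  have e1 : ∑ m, christoffel g y m i j * g y m l = ∑ m, g y l m * christoffel g y m i j :=
    Finset.sum_congr rfl fun m _ => by rw [hg.symm y m l, mul_comm]
  have e2 : ∑ m, christoffel g y m i l * g y j m = ∑ m, g y j m * christoffel g y m i l :=
    Finset.sum_congr rfl fun m _ => by rw [mul_comm]
  rw [e1, e2, h1, h2]
  simp only [fun z => hg.symm z l j]
  ring

theorem cov2_self (hg : IsMetricAt k g y) (i j l : Fin (n + 1)) : cov2 g g y i j l = 0 := by
  simp only [cov2, smul_eq_mul, hg.pd_metric i j l]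
  ring

/-- This is `∇(g⁻¹) = 0`. In matrix form `∂g = Γᵀ g + g Γ`, and it is inserted into `∂(g⁻¹) = -g⁻¹
(∂g) g⁻¹`. -/
theorem pd_inv (hg : IsMetricAt k g y) (hk : 1 ≤ k) (i a b : Fin (n + 1)) :
    pd i (fun z => inv g z a b) y = -∑ m, christoffel g y a i m * inv g y m b
      - ∑ m, christoffel g y b i m * inv g y a m := by
  have h := pd_inv_eq (fun i j => (hg.smooth i j).of_le hk) hg.det_ne i
  have hM : Matrix.of (fun a b => pd i (fun z => inv g z a b) y) =
      -((Matrix.of (g y))⁻¹ * (Matrix.of (fun j l => pd i (fun z => g z j l) y))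
        * (Matrix.of (g y))⁻¹) := by
    ext a b
    simp only [Matrix.of_apply, h, Matrix.neg_apply, Matrix.mul_apply, Finset.sum_mul]
    rw [Finset.sum_comm]
    rfl
  have hD : Matrix.of (fun j l => pd i (fun z => g z j l) y) =
      (Matrix.of (fun m j => christoffel g y m i j)).transpose * Matrix.of (g y)
      + Matrix.of (g y) * Matrix.of (fun m j => christoffel g y m i j) := by
    ext j l
    simp only [Matrix.of_apply, hg.pd_metric i j l, Matrix.add_apply, Matrix.mul_apply,
      Matrix.transpose_apply, mul_comm]
  have hu := isUnit_iff_ne_zero.mpr hg.det_ne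
  rw [hD, mul_add, add_mul, ← mul_assoc, Matrix.mul_nonsing_inv_cancel_right _ _ hu,
    Matrix.nonsing_inv_mul_cancel_left _ _ hu] at hM
  have h3 := congrFun (congrFun hM a) b
  simp only [Matrix.of_apply, Matrix.neg_apply, Matrix.add_apply, Matrix.mul_apply,
    Matrix.transpose_apply] at h3
  rw [h3]
  simp only [inv, mul_comm]
  ring

end IsMetricAt

end Metric

/-! ### Raising indices, the Ricci identity and the symmetries of the curvature. -/

section Identities

variable {n : ℕ} {g h : Cov2 n ℝ} {y : Vec n}

namespace IsMetricAt

variable {k : ℕ∞ω}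

/-- Since the inverse metric is parallel, raising an index commutes with `∇`. -/
theorem pd_sharp (hg : IsMetricAt k g y) (hk : 1 ≤ k) {v : Cov1 n ℝ}
    (hv : ∀ a, DifferentiableAt ℝ (fun z => v z a) y) (i b : Fin (n + 1)) :
    pd i (fun z => sharp g v z b) y = ∑ a, inv g y b a * cov1 g v y i a
      - ∑ m, christoffel g y b i m * sharp g v y m := by
  simp only [sharp]
  rw [pd_sum_mul _ (fun a => ((hg.contDiffAt_inv b a).of_le hk).differentiableAt one_ne_zero) hv]
  simp only [hg.pd_inv hk, cov1, smul_eq_mul, sub_mul, neg_mul, mul_sub,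
    Finset.sum_sub_distrib, Finset.sum_neg_distrib, Finset.sum_mul, Finset.mul_sum]
  have e1 : ∑ a, ∑ m, christoffel g y b i m * inv g y m a * v y a
      = ∑ m, ∑ a, christoffel g y b i m * (inv g y m a * v y a) := by
    rw [Finset.sum_comm]
    simp only [mul_assoc]
  have e2 : ∑ a, ∑ m, christoffel g y a i m * inv g y b m * v y a
      = ∑ a, ∑ m, inv g y b a * (christoffel g y m i a * v y m) := by
    rw [Finset.sum_comm]
    exact Finset.sum_congr rfl fun _ _ => Finset.sum_congr rfl fun _ _ => by ring
  rw [e1, e2]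
  ring

/-- Since the inverse metric is parallel, the trace commutes with `∇`. -/
theorem pd_trace (hg : IsMetricAt k g y) (hk : 1 ≤ k) {T : Cov2 n ℝ}
    (hT : ∀ a b, DifferentiableAt ℝ (fun z => T z a b) y) (i : Fin (n + 1)) :
    pd i (trace g T) y = ∑ a, ∑ b, inv g y a b * cov2 g T y i a b := by
  have hG : ∀ a b, DifferentiableAt ℝ (fun z => inv g z a b) y := fun a b =>
    ((hg.contDiffAt_inv a b).of_le hk).differentiableAt one_ne_zero
  rw [show trace g T = fun z => ∑ a, ∑ b, inv g z a b * T z a b from rfl,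
    pd_sum _ fun a _ => DifferentiableAt.fun_sum fun b _ => (hG a b).fun_mul (hT a b)]
  simp only [fun a => pd_sum_mul Finset.univ (hG a) (hT a) i, hg.pd_inv hk, cov2, smul_eq_mul,
    sub_mul, neg_mul, mul_sub, Finset.sum_sub_distrib, Finset.sum_neg_distrib,
    Finset.sum_add_distrib, Finset.sum_mul, Finset.mul_sum]
  have e1 : ∑ a, ∑ b, ∑ m, christoffel g y a i m * inv g y m b * T y a b
      = ∑ a, ∑ b, ∑ m, inv g y a b * (christoffel g y m i a * T y m b) := by
    rw [Finset.sum_comm]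
    conv_rhs => rw [Finset.sum_comm]
    refine Finset.sum_congr rfl fun b _ => ?_
    rw [Finset.sum_comm]
    exact Finset.sum_congr rfl fun _ _ => Finset.sum_congr rfl fun _ _ => by ring
  have e2 : ∑ a, ∑ b, ∑ m, christoffel g y b i m * inv g y a m * T y a b
      = ∑ a, ∑ b, ∑ m, inv g y a b * (christoffel g y m i b * T y a m) := by
    refine Finset.sum_congr rfl fun a _ => ?_
    rw [Finset.sum_comm]
    exact Finset.sum_congr rfl fun _ _ => Finset.sum_congr rfl fun _ _ => by ring
  rw [e1, e2]
  ring

theorem sum_mul_sum_inv (hg : IsMetricAt k g y) (w : Fin (n + 1) → ℝ) (j : Fin (n + 1)) :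
    ∑ b, g y j b * ∑ a, inv g y b a * w a = w j := by
  simp only [Finset.mul_sum]
  rw [Finset.sum_comm]
  simp only [← mul_assoc, ← Finset.sum_mul, sum_mul_inv hg.det_ne]
  simp

/-- `L_{η^♯} g = 2 δ^* η`. -/
theorem lieDeriv_sharp (hg : IsMetricAt k g y) (hk : 1 ≤ k) {v : Cov1 n ℝ}
    (hv : ∀ a, DifferentiableAt ℝ (fun z => v z a) y) (i j : Fin (n + 1)) :
    lieDeriv (sharp g v) g y i j = 2 * deltaStar g v y i j := by
  simp only [lieDeriv, deltaStar, hg.pd_sharp hk hv, hg.pd_metric, Finset.sum_add_distrib, mul_sub,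
    Finset.sum_sub_distrib]
  -- Lowering the index just raised turns the derivatives of `η^♯` into `∇_i η_j + ∇_j η_i`; the
  -- Christoffel terms left over cancel by symmetry of the lower indices.
  simp only [fun b => hg.symm y b j, hg.sum_mul_sum_inv (fun a => cov1 g v y i a) j,
    hg.sum_mul_sum_inv (fun a => cov1 g v y j a) i]
  simp only [mul_add, Finset.sum_add_distrib, Finset.mul_sum]
  have e1 : ∑ b, ∑ m, sharp g v y b * (christoffel g y m b i * g y j m)
      = ∑ b, ∑ m, g y j b * (christoffel g y b i m * sharp g v y m) := by
    rw [Finset.sum_comm]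
    exact Finset.sum_congr rfl fun b _ => Finset.sum_congr rfl fun m _ => by
      rw [hg.christoffel_symm b m i]; ring
  have e2 : ∑ b, ∑ m, sharp g v y b * (christoffel g y m b j * g y i m)
      = ∑ b, ∑ m, g y i b * (christoffel g y b j m * sharp g v y m) := by
    rw [Finset.sum_comm]
    exact Finset.sum_congr rfl fun b _ => Finset.sum_congr rfl fun m _ => by
      rw [hg.christoffel_symm b m j]; ring
  rw [e1, e2]
  ring

end IsMetricAt

/-- The matrix `(Γ^m_{ij})_{m j}`. -/
noncomputable def christoffelMatrix (g : Cov2 n ℝ) (y : Vec n) (i : Fin (n + 1)) :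
    Matrix (Fin (n + 1)) (Fin (n + 1)) ℝ := Matrix.of fun m j => christoffel g y m i j

theorem of_cov2 (g h : Cov2 n ℝ) (y : Vec n) (i : Fin (n + 1)) :
    Matrix.of (cov2 g h y i) = Matrix.of (fun j l => pd i (fun z => h z j l) y)
      - (christoffelMatrix g y i).transpose * Matrix.of (h y)
      - Matrix.of (h y) * christoffelMatrix g y i := by
  ext j l
  simp only [Matrix.of_apply, cov2, Matrix.sub_apply, Matrix.mul_apply, Matrix.transpose_apply,
    christoffelMatrix, smul_eq_mul]
  simp only [mul_comm]

/-- With the first tensor index frozen, tensors become matrices and the Christoffel corrections of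
the last two slots become multiplications by the connection matrices. This turns the Ricci identity
into a computation in a noncommutative ring. -/
theorem of_cov3 (g : Cov2 n ℝ) (T : Cov3 n ℝ) (y : Vec n) (i l : Fin (n + 1)) :
    Matrix.of (cov3 g T y i l) = Matrix.of (fun j a => pd i (fun z => T z l j a) y)
      - ∑ m, christoffel g y m i l • Matrix.of (T y m)
      - (christoffelMatrix g y i).transpose * Matrix.of (T y l)
      - Matrix.of (T y l) * christoffelMatrix g y i := by
  ext j a
  simp only [Matrix.of_apply, cov3, Matrix.sub_apply, Matrix.mul_apply, Matrix.transpose_apply,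
    christoffelMatrix, Matrix.sum_apply, Matrix.smul_apply, smul_eq_mul]
  congr 1
  exact Finset.sum_congr rfl fun _ _ => mul_comm _ _

theorem of_curv (g : Cov2 n ℝ) (y : Vec n) (i l : Fin (n + 1)) :
    Matrix.of (fun m j => curv g y m j i l) =
      Matrix.of (fun m j => pd i (fun z => christoffel g z m l j) y)
      - Matrix.of (fun m j => pd l (fun z => christoffel g z m i j) y)
      + christoffelMatrix g y i * christoffelMatrix g y l
      - christoffelMatrix g y l * christoffelMatrix g y i := by
  ext m j
  simp only [Matrix.of_apply, curv, Matrix.sub_apply, Matrix.add_apply, Matrix.mul_apply,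
    christoffelMatrix, Finset.sum_sub_distrib]
  ring

namespace IsMetricAt

variable {k : ℕ∞ω}

theorem differentiableAt_christoffel (hg : IsMetricAt k g y) (hk : 2 ≤ k) (m i j : Fin (n + 1)) :
    DifferentiableAt ℝ (fun z => christoffel g z m i j) y :=
  (hg.contDiffAt_christoffel (m := 1) hk m i j).differentiableAt one_ne_zero

theorem contDiffAt_cov2 (hg : IsMetricAt k g y) {m : ℕ∞ω} (hm : m + 1 ≤ k)
    {h : Cov2 n ℝ} (hh : ∀ i j, ContDiffAt ℝ (m + 1) (fun z => h z i j) y) (i j l : Fin (n + 1)) :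
    ContDiffAt ℝ m (fun z => cov2 g h z i j l) y := by
  have hh' : ∀ i j, ContDiffAt ℝ m (fun z => h z i j) y := fun i j => (hh i j).of_le le_self_add
  exact ((contDiffAt_pd (hh _ _) le_rfl i).sub (ContDiffAt.sum fun a _ =>
    (hg.contDiffAt_christoffel hm _ _ _).smul (hh' _ _))).sub (ContDiffAt.sum fun a _ =>
    (hg.contDiffAt_christoffel hm _ _ _).smul (hh' _ _))

theorem of_pd_cov2 (hg : IsMetricAt k g y) (hk : 2 ≤ k)
    (hh : ∀ i j, ContDiffAt ℝ 2 (fun z => h z i j) y) (i l : Fin (n + 1)) :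
    Matrix.of (fun j a => pd i (fun z => cov2 g h z l j a) y) =
      Matrix.of (fun j a => pd i (pd l (fun z => h z j a)) y)
      - (Matrix.of (fun m j => pd i (fun z => christoffel g z m l j) y)).transpose * Matrix.of (h y)
      - (christoffelMatrix g y l).transpose * Matrix.of (fun j a => pd i (fun z => h z j a) y)
      - Matrix.of (h y) * Matrix.of (fun m j => pd i (fun z => christoffel g z m l j) y)
      - Matrix.of (fun j a => pd i (fun z => h z j a) y) * christoffelMatrix g y l := by
  ext j a
  have hΓ := hg.differentiableAt_christoffel hk
  have hd : ∀ i j, DifferentiableAt ℝ (fun z => h z i j) y := fun i j =>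
    (hh i j).differentiableAt two_ne_zero
  have hp : DifferentiableAt ℝ (fun z => pd l (fun w => h w j a) z) y :=
    (contDiffAt_pd (hh j a) (k := 1) (by norm_num) l).differentiableAt one_ne_zero
  have h1 : DifferentiableAt ℝ (fun z => ∑ m, christoffel g z m l j * h z m a) y :=
    DifferentiableAt.fun_sum fun m _ => (hΓ _ _ _).fun_mul (hd _ _)
  have h2 : DifferentiableAt ℝ (fun z => ∑ m, christoffel g z m l a * h z j m) y :=
    DifferentiableAt.fun_sum fun m _ => (hΓ _ _ _).fun_mul (hd _ _)
  simp only [Matrix.of_apply, cov2, smul_eq_mul]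
  rw [pd_sub (hp.fun_sub h1) h2, pd_sub hp h1,
    pd_sum_mul _ (fun m => hΓ m l j) (fun m => hd m a),
    pd_sum_mul _ (fun m => hΓ m l a) (fun m => hd j m)]
  simp only [Matrix.sub_apply, Matrix.mul_apply, Matrix.transpose_apply, christoffelMatrix,
    Matrix.of_apply]
  simp only [mul_comm]
  ring

/-- The Ricci identity for covariant 2-tensors. -/
theorem ricci_identity (hg : IsMetricAt k g y) (hk : 2 ≤ k)
    (hh : ∀ i j, ContDiffAt ℝ 2 (fun z => h z i j) y) (i l j a : Fin (n + 1)) :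
    cov3 g (cov2 g h) y i l j a - cov3 g (cov2 g h) y l i j a =
      -∑ m, curv g y m j i l * h y m a - ∑ m, curv g y m a i l * h y j m := by
  have hc : Matrix.of (fun j a => pd i (pd l (fun z => h z j a)) y) =
      Matrix.of (fun j a => pd l (pd i (fun z => h z j a)) y) := by
    ext j a; exact pd_comm (hh j a) i l
  have hM : Matrix.of (cov3 g (cov2 g h) y i l) - Matrix.of (cov3 g (cov2 g h) y l i) =
      -((Matrix.of (fun m j => curv g y m j i l)).transpose * Matrix.of (h y))
        - Matrix.of (h y) * Matrix.of (fun m j => curv g y m j i l) := by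
    rw [of_cov3, of_cov3, hg.of_pd_cov2 hk hh i l, hg.of_pd_cov2 hk hh l i, of_curv, of_cov2,
      of_cov2, hc]
    -- By torsion-freeness the terms `Γ^m_{il} ∇_m h` are the same in both orders of differentiation
    -- and cancel; what remains is an identity between noncommuting matrices.
    simp only [fun m => hg.christoffel_symm m l i, Matrix.transpose_sub, Matrix.transpose_add,
      Matrix.transpose_mul]
    noncomm_ring
  have h3 := congrFun (congrFun hM j) a
  simp only [Matrix.of_apply, Matrix.neg_apply, Matrix.sub_apply, Matrix.mul_apply,
    Matrix.transpose_apply] at h3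
  rw [h3]
  simp only [mul_comm]

theorem riem_swap_right (g : Cov2 n ℝ) (y : Vec n) (i j k l : Fin (n + 1)) :
    riem g y i j k l = -riem g y i j l k := by
  simp only [riem, curv, Finset.sum_sub_distrib, ← Finset.sum_neg_distrib]
  exact Finset.sum_congr rfl fun _ _ => by ring

/-- The first Bianchi identity: after the Christoffel symbols are symmetrized in their lower
indices, the cyclic sum cancels term by term. -/
theorem riem_bianchi (hg : IsMetricAt k g y) (a j b l : Fin (n + 1)) :
    riem g y a j b l + riem g y a b l j + riem g y a l j b = 0 := by
  simp only [riem, ← Finset.sum_add_distrib, ← mul_add]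
  refine Finset.sum_eq_zero fun m _ => ?_
  have hs := EYM.christoffel_symm hg.symm
  have : curv g y m j b l + curv g y m b l j + curv g y m l j b = 0 := by
    simp only [curv, Finset.sum_sub_distrib, fun z => hs z m l j, fun z => hs z m b j,
      fun z => hs z m l b, fun c => hs y c l j, fun c => hs y c b j, fun c => hs y c l b]
    ring
  rw [this, mul_zero]

/-- The Ricci identity is applied to `g` itself. Its left side involves derivatives of `∇g`, so `∇g
= 0` is needed on a neighbourhood; this is why `k ≠ ∞`, since only `C^k` regularity at a point with
`k ≠ ∞` passes to nearby points. -/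
theorem riem_swap_left (hg : IsMetricAt k g y) (hk : 2 ≤ k) (hk' : k ≠ ∞) (a j b l : Fin (n + 1)) :
    riem g y a j b l = -riem g y j a b l := by
  have hz : ∀ i j l, (fun z => cov2 g g z i j l) =ᶠ[𝓝 y] fun _ => 0 := fun i j l => by
    filter_upwards [hg.eventually hk'] with z hz using hz.cov2_self i j l
  have h0 : ∀ i l j a, cov3 g (cov2 g g) y i l j a = 0 := fun i l j a => by
    simp only [cov3, hg.cov2_self, pd_congr (hz l j a), pd_const]
    simp
  have h1 := hg.ricci_identity hk (fun i j => (hg.smooth i j).of_le hk) b l j a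
  rw [h0, h0] at h1
  simp only [riem]
  simp only [mul_comm (curv _ _ _ _ _ _), hg.symm y _ a] at h1
  linarith

/-- The usual octahedron argument: the pair symmetry is a linear combination of four Bianchi
identities and the two antisymmetries. -/
theorem riem_pair (hg : IsMetricAt k g y) (hk : 2 ≤ k) (hk' : k ≠ ∞) (a j b l : Fin (n + 1)) :
    riem g y a j b l = riem g y b l a j := by
  have hL := hg.riem_swap_left hk hk'
  have hR := riem_swap_right g y
  have hB := hg.riem_bianchi
  have b1 := hB a j b l
  have b2 := hB j b l a
  have b3 := hB b l a j
  have b4 := hB l a j b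
  linarith [hL a j b l, hL a b l j, hL a l j b, hL j b l a, hL j l a b, hL j a b l, hL b l a j,
    hL b a j l, hL b j l a, hL l a j b, hL l j b a, hL l b a j, hR a j b l, hR a b l j, hR a l j b,
    hR j b l a, hR j l a b, hR j a b l, hR b l a j, hR b a j l, hR b j l a, hR l a j b, hR l j b a,
    hR l b a j]

end IsMetricAt

end Identities

/-! ### The exact change of the Ricci tensor and its linear part. -/

section RicciVariation

variable {n : ℕ} {g h : Cov2 n ℝ} {y : Vec n} {k : ℕ∞ω}

/-- `(1/2) (∇_i h_{jl} + ∇_j h_{il} - ∇_l h_{ij})` (arguments `i j l`). -/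
noncomputable def christoffelVar (g h : Cov2 n ℝ) : Cov3 n ℝ := fun y i j l =>
  (1 / 2 : ℝ) * (cov2 g h y i j l + cov2 g h y j i l - cov2 g h y l i j)

/-- `G^{kl} D_{ijl}` (arguments `k i j`). -/
noncomputable def raiseLast (G : Cov2 n ℝ) (D : Cov3 n ℝ) : Cov3 n ℝ := fun y a i j =>
  ∑ l, G y a l * D y i j l

/-- The polarization of the Ricci tensor: `∇_i C^i_{lj} - ∇_l C^i_{ij}` for a connection with
symbols `Γ`. -/
noncomputable def ricciPolar (Γ C : Cov3 n ℝ) : Cov2 n ℝ := fun y j l =>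
  ∑ i, (pd i (fun z => C z i l j) y - pd l (fun z => C z i i j) y
    + ∑ m, (Γ y i i m * C y m l j + C y i i m * Γ y m l j
      - Γ y i l m * C y m i j - C y i l m * Γ y m i j))

theorem cov2_symm (hs : ∀ z i j, h z i j = h z j i) (g : Cov2 n ℝ) (y : Vec n)
    (i j l : Fin (n + 1)) : cov2 g h y i j l = cov2 g h y i l j := by
  simp only [cov2, fun z => hs z l j, fun m => hs y m j, fun m => hs y l m]
  abel

theorem cov3_symm {T : Cov3 n ℝ} (hs : ∀ z i j l, T z i j l = T z i l j) (g : Cov2 n ℝ) (y : Vec n)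
    (i a j l : Fin (n + 1)) : cov3 g T y i a j l = cov3 g T y i a l j := by
  simp only [cov3, fun z => hs z a j l, fun m => hs y m l j, fun m => hs y a m j,
    fun m => hs y a l m]
  ring

/-- Contracting with `g + h` reduces the identity to Christoffel symbols of the first kind, which
are linear in the metric: those of `h` are its covariant version `christoffelVar` plus the term
`h_{lm} Γ^m_{ij}`. The index is raised by the inverse of `g + h`, so the formula is exact and not
only infinitesimal. -/
theorem christoffel_add (hg : IsMetricAt k g y) (hk : 1 ≤ k) (hh : IsMetricAt 1 (g + h) y)
    (a i j : Fin (n + 1)) : christoffel (g + h) y a i j =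
      christoffel g y a i j + raiseLast (inv (g + h)) (christoffelVar g h) y a i j := by
  have hs : ∀ z i j, h z i j = h z j i := fun z i j => by
    have := hh.symm z i j
    simp only [Pi.add_apply, hg.symm z i j] at this
    linarith
  have hgd : ∀ i j, DifferentiableAt ℝ (fun z => g z i j) y := fun i j =>
    ((hg.smooth i j).of_le hk).differentiableAt one_ne_zero
  have hhd : ∀ i j, DifferentiableAt ℝ (fun z => h z i j) y := fun i j => by
    have := ((hh.smooth i j).differentiableAt one_ne_zero).fun_sub (hgd i j)
    simpa using this
  have hΓ : ∀ m i j, christoffel g y m i j = christoffel g y m j i := hg.christoffel_symm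
  have key : ∀ l, ∑ m, (g + h) y l m * christoffel g y m i j + christoffelVar g h y i j l =
      (1 / 2 : ℝ) * (pd i (fun z => (g + h) z j l) y + pd j (fun z => (g + h) z i l) y
        - pd l (fun z => (g + h) z i j) y) := by
    intro l
    simp only [Pi.add_apply, add_mul, Finset.sum_add_distrib, hg.sum_mul_christoffel,
      christoffelVar, cov2, smul_eq_mul, pd_add (hgd _ _) (hhd _ _)]
    have e1 : ∑ m, h y l m * christoffel g y m i j = ∑ m, christoffel g y m i j * h y m l :=
      Finset.sum_congr rfl fun m _ => by rw [hs y l m, mul_comm]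
    simp only [e1, hΓ _ j i, hΓ _ l i, hΓ _ l j, fun m => hs y j m]
    ring
  have key2 : ∀ l, ∑ m, (g + h) y l m * (christoffel g y m i j
      + raiseLast (inv (g + h)) (christoffelVar g h) y m i j) =
      ∑ m, (g + h) y l m * christoffel (g + h) y m i j := by
    intro l
    rw [hh.sum_mul_christoffel, ← key l]
    simp only [mul_add, Finset.sum_add_distrib, raiseLast,
      hh.sum_mul_sum_inv (fun l => christoffelVar g h y i j l) l]
  have inj : ∀ w : Fin (n + 1) → ℝ, w a = ∑ l, inv (g + h) y a l * ∑ m, (g + h) y l m * w m := by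
    intro w
    simp only [Finset.mul_sum]
    rw [Finset.sum_comm]
    simp only [← mul_assoc, ← Finset.sum_mul, sum_inv_mul hh.det_ne]
    simp
  rw [inj fun m => christoffel (g + h) y m i j,
    inj fun m => christoffel g y m i j + raiseLast (inv (g + h)) (christoffelVar g h) y m i j]
  simp only [key2]

/-- The Ricci tensor is linear in `∂Γ` and quadratic in `Γ`, so its expansion in `C` stops at second
order; `ricciPolar` is the part linear in `C`. -/
theorem ricci_add {C : Cov3 n ℝ} {g g' : Cov2 n ℝ}
    (hΓ : ∀ᶠ z in 𝓝 y, ∀ a i j, christoffel g' z a i j = christoffel g z a i j + C z a i j)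
    (hg : ∀ a i j, DifferentiableAt ℝ (fun z => christoffel g z a i j) y)
    (hC : ∀ a i j, DifferentiableAt ℝ (fun z => C z a i j) y) (j l : Fin (n + 1)) :
    ricci g' y j l = ricci g y j l + ricciPolar (christoffel g) C y j l
      + ∑ i, ∑ m, (C y i i m * C y m l j - C y i l m * C y m i j) := by
  have hp : ∀ b a i j, pd b (fun z => christoffel g' z a i j) y =
      pd b (fun z => christoffel g z a i j) y + pd b (fun z => C z a i j) y := by
    intro b a i j
    rw [← pd_add (hg a i j) (hC a i j)]
    exact pd_congr (hΓ.mono fun z hz => hz a i j) b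
  simp only [ricci, curv, ricciPolar, hp, hΓ.self_of_nhds, ← Finset.sum_add_distrib]
  refine Finset.sum_congr rfl fun i _ => ?_
  have e : ∑ m, ((christoffel g y i i m + C y i i m) * (christoffel g y m l j + C y m l j)
      - (christoffel g y i l m + C y i l m) * (christoffel g y m i j + C y m i j)) =
      ∑ m, (christoffel g y i i m * christoffel g y m l j
        - christoffel g y i l m * christoffel g y m i j)
      + ∑ m, (christoffel g y i i m * C y m l j + C y i i m * christoffel g y m l j
        - christoffel g y i l m * C y m i j - C y i l m * christoffel g y m i j)
      + ∑ m, (C y i i m * C y m l j - C y i l m * C y m i j) := by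
    simp only [← Finset.sum_add_distrib]
    exact Finset.sum_congr rfl fun m _ => by ring
  rw [e]
  ring

namespace IsMetricAt

theorem curv_eq_sum_riem (hg : IsMetricAt k g y) (a j b l : Fin (n + 1)) :
    curv g y a j b l = ∑ p, inv g y a p * riem g y p j b l := by
  simp only [riem, Finset.mul_sum]
  rw [Finset.sum_comm]
  simp only [← mul_assoc, ← Finset.sum_mul, sum_inv_mul hg.det_ne]
  simp

theorem ricci_eq_sum_riem (hg : IsMetricAt k g y) (j l : Fin (n + 1)) :
    ricci g y j l = ∑ i, ∑ p, inv g y i p * riem g y p j i l := by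
  simp only [ricci, hg.curv_eq_sum_riem]

theorem ricci_symm (hg : IsMetricAt k g y) (hk : 2 ≤ k) (hk' : k ≠ ∞) (j l : Fin (n + 1)) :
    ricci g y j l = ricci g y l j := by
  rw [hg.ricci_eq_sum_riem, hg.ricci_eq_sum_riem, Finset.sum_comm]
  exact Finset.sum_congr rfl fun i _ => Finset.sum_congr rfl fun p _ => by
    rw [hg.inv_symm p i, hg.riem_pair hk hk' i j p l]

theorem riemAct_symm (hg : IsMetricAt k g y) (hk : 2 ≤ k) (hk' : k ≠ ∞)
    (hs : ∀ z i j, h z i j = h z j i) (j l : Fin (n + 1)) :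
    riemAct g h y j l = riemAct g h y l j := by
  simp only [riemAct]
  rw [Finset.sum_comm]
  refine Finset.sum_congr rfl fun i _ => Finset.sum_congr rfl fun p _ => ?_
  rw [hg.riem_pair hk hk' p j i l]
  congr 1
  rw [Finset.sum_comm]
  exact Finset.sum_congr rfl fun a _ => Finset.sum_congr rfl fun b _ => by
    rw [hs y b a]; ring

/-- This is the source of the curvature terms of `Δ_L`. Contracting the Ricci identity with
`g^{ib}`, the curvature acting on the free slot `j` gives the Riemann term, while the curvature
acting on the contracted slot collapses to the Ricci tensor. -/
theorem contraction_ricci_identity (hg : IsMetricAt k g y) (hk : 2 ≤ k) (hk' : k ≠ ∞)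
    (hs : ∀ z i j, h z i j = h z j i)
    (hh : ∀ i j, ContDiffAt ℝ 2 (fun z => h z i j) y) (j l : Fin (n + 1)) :
    ∑ i, ∑ b, inv g y i b * (cov3 g (cov2 g h) y i l j b - cov3 g (cov2 g h) y l i j b) =
      ∑ c, ∑ m, inv g y c m * (ricci g y l c * h y m j) - riemAct g h y j l := by
  simp only [hg.ricci_identity hk hh, mul_sub, mul_neg, Finset.sum_sub_distrib,
    Finset.sum_neg_distrib]
  have e1 : ∑ i, ∑ b, inv g y i b * ∑ m, curv g y m j i l * h y m b = riemAct g h y j l := by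
    simp only [riemAct, hg.curv_eq_sum_riem, Finset.mul_sum, Finset.sum_mul]
    rw [Finset.sum_comm (s := Finset.univ (α := Fin (n + 1))) (t := Finset.univ)
      (f := fun i c => ∑ a, ∑ b, riem g y i j c l * (inv g y i a * inv g y c b * h y a b))]
    refine Finset.sum_congr rfl fun i _ => ?_
    rw [Finset.sum_comm]
    calc _ = ∑ m, ∑ p, ∑ b, inv g y i b * (inv g y m p * riem g y p j i l * h y m b) :=
          Finset.sum_congr rfl fun m _ => Finset.sum_comm
      _ = _ := by
          rw [Finset.sum_comm]
          exact Finset.sum_congr rfl fun p _ => Finset.sum_congr rfl fun m _ =>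
            Finset.sum_congr rfl fun b _ => by rw [hg.inv_symm m p]; ring
  have e2 : ∑ i, ∑ b, inv g y i b * ∑ m, curv g y m b i l * h y j m =
      -∑ c, ∑ m, inv g y c m * (ricci g y l c * h y m j) := by
    simp only [hg.ricci_symm hk hk' l, hg.ricci_eq_sum_riem, hg.curv_eq_sum_riem, Finset.mul_sum,
      Finset.sum_mul]
    simp only [← Finset.sum_neg_distrib]
    calc ∑ i, ∑ b, ∑ m, ∑ p, inv g y i b * (inv g y m p * riem g y p b i l * h y j m)
        = ∑ i, ∑ b, ∑ p, ∑ m, inv g y i b * (inv g y m p * riem g y p b i l * h y j m) :=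
          Finset.sum_congr rfl fun i _ => Finset.sum_congr rfl fun b _ => Finset.sum_comm
      _ = ∑ i, ∑ p, ∑ b, ∑ m, inv g y i b * (inv g y m p * riem g y p b i l * h y j m) :=
          Finset.sum_congr rfl fun i _ => Finset.sum_comm
      _ = ∑ p, ∑ i, ∑ b, ∑ m, inv g y i b * (inv g y m p * riem g y p b i l * h y j m) :=
          Finset.sum_comm
      _ = ∑ p, ∑ i, ∑ m, ∑ b, inv g y i b * (inv g y m p * riem g y p b i l * h y j m) :=
          Finset.sum_congr rfl fun p _ => Finset.sum_congr rfl fun i _ => Finset.sum_comm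
      _ = ∑ p, ∑ m, ∑ i, ∑ b, inv g y i b * (inv g y m p * riem g y p b i l * h y j m) :=
          Finset.sum_congr rfl fun p _ => Finset.sum_comm
      _ = _ := by
          refine Finset.sum_congr rfl fun p _ => Finset.sum_congr rfl fun m _ =>
            Finset.sum_congr rfl fun i _ => Finset.sum_congr rfl fun b _ => ?_
          rw [hg.riem_swap_left hk hk' p b, hg.inv_symm m p, hs y m j]
          ring
  rw [e1, e2]
  ring

theorem contDiffAt_trace (hg : IsMetricAt k g y)
    (hh : ∀ i j, ContDiffAt ℝ k (fun z => h z i j) y) : ContDiffAt ℝ k (trace g h) y :=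
  ContDiffAt.sum fun _ _ => ContDiffAt.sum fun _ _ => (hg.contDiffAt_inv _ _).mul (hh _ _)

theorem differentiableAt_cov2 (hg : IsMetricAt k g y) (hk : 2 ≤ k)
    (hh : ∀ i j, ContDiffAt ℝ 2 (fun z => h z i j) y) (i j l : Fin (n + 1)) :
    DifferentiableAt ℝ (fun z => cov2 g h z i j l) y :=
  (hg.contDiffAt_cov2 (m := 1) hk hh i j l).differentiableAt one_ne_zero

theorem differentiableAt_pd_trace (hg : IsMetricAt 2 g y)
    (hh : ∀ i j, ContDiffAt ℝ 2 (fun z => h z i j) y) (i : Fin (n + 1)) :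
    DifferentiableAt ℝ (fun z => pd i (trace g h) z) y :=
  (contDiffAt_pd (hg.contDiffAt_trace hh) (k := 1) (by norm_num) i).differentiableAt one_ne_zero

theorem differentiableAt_divergence (hg : IsMetricAt 2 g y)
    (hh : ∀ i j, ContDiffAt ℝ 2 (fun z => h z i j) y) (j : Fin (n + 1)) :
    DifferentiableAt ℝ (fun z => divergence g h z j) y :=
  (DifferentiableAt.fun_sum fun _ _ => DifferentiableAt.fun_sum fun _ _ =>
    ((hg.contDiffAt_inv _ _).differentiableAt two_ne_zero).fun_mul
      (hg.differentiableAt_cov2 le_rfl hh _ _ _)).fun_neg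

theorem differentiableAt_bianchi (hg : IsMetricAt 2 g y)
    (hh : ∀ i j, ContDiffAt ℝ 2 (fun z => h z i j) y) (j : Fin (n + 1)) :
    DifferentiableAt ℝ (fun z => bianchi g h z j) y :=
  (hg.differentiableAt_divergence hh j).fun_add
    ((hg.differentiableAt_pd_trace hh j).const_mul _)

theorem cov1_bianchi (hg : IsMetricAt 2 g y)
    (hh : ∀ i j, ContDiffAt ℝ 2 (fun z => h z i j) y) (l j : Fin (n + 1)) :
    cov1 g (bianchi g h) y l j = -∑ i, ∑ b, inv g y i b * cov3 g (cov2 g h) y l b i j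
      + (1 / 2 : ℝ) * (pd l (pd j (trace g h)) y
        - ∑ m, christoffel g y m l j * pd m (trace g h) y) := by
  have hT := hg.differentiableAt_cov2 le_rfl hh
  -- For fixed `j` the divergence is minus the trace of the 2-tensor `(i, b) ↦ ∇_b h_{ij}`, so
  -- `pd_trace` applies; the Christoffel term for the frozen slot `j` is restored in `e''`.
  have hdiv : pd l (fun z => divergence g h z j) y =
      -∑ i, ∑ b, inv g y i b * cov2 g (fun z i b => cov2 g h z b i j) y l i b := by
    rw [← hg.pd_trace one_le_two (fun a b => hT b a j) l, ← pd_neg]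
    rfl
  have hb : pd l (fun z => bianchi g h z j) y = pd l (fun z => divergence g h z j) y
      + (1 / 2 : ℝ) * pd l (pd j (trace g h)) y := by
    simp only [bianchi]
    rw [pd_add (hg.differentiableAt_divergence hh j)
      ((hg.differentiableAt_pd_trace hh j).const_mul _), pd_const_mul]
  have e : ∑ m, christoffel g y m l j * divergence g h y m =
      -∑ i, ∑ b, inv g y i b * ∑ m, christoffel g y m l j * cov2 g h y b i m := by
    simp only [divergence, mul_neg, Finset.sum_neg_distrib, Finset.mul_sum]
    rw [Finset.sum_comm]
    congr 1
    refine Finset.sum_congr rfl fun i _ => ?_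
    rw [Finset.sum_comm]
    exact Finset.sum_congr rfl fun b _ => Finset.sum_congr rfl fun m _ => by ring
  have e' : ∑ m, christoffel g y m l j * ((1 / 2 : ℝ) * pd m (trace g h) y) =
      (1 / 2 : ℝ) * ∑ m, christoffel g y m l j * pd m (trace g h) y := by
    rw [Finset.mul_sum]
    exact Finset.sum_congr rfl fun m _ => by ring
  have e'' : ∀ i b, cov3 g (cov2 g h) y l b i j = cov2 g (fun z i b => cov2 g h z b i j) y l i b
      - ∑ m, christoffel g y m l j * cov2 g h y b i m := fun i b => by
    rw [show cov2 g (fun z i b => cov2 g h z b i j) y l i b =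
      pd l (fun z => cov2 g h z b i j) y - ∑ m, christoffel g y m l i * cov2 g h y b m j
        - ∑ m, christoffel g y m l b * cov2 g h y m i j from rfl]
    simp only [cov3]
    ring
  rw [cov1, hb, hdiv]
  simp only [smul_eq_mul, bianchi, mul_add, Finset.sum_add_distrib, e, e', e'',
    mul_sub, Finset.sum_sub_distrib]
  ring

/-- In the contraction the first and third terms of `christoffelVar` cancel by symmetry of `h`,
leaving half the trace of `∇_j h`. -/
theorem sum_raiseLast_christoffelVar (hg : IsMetricAt k g y) (hk : 1 ≤ k)
    (hs : ∀ z i j, h z i j = h z j i)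
    (hh : ∀ i j, DifferentiableAt ℝ (fun z => h z i j) y) (j : Fin (n + 1)) :
    ∑ i, raiseLast (inv g) (christoffelVar g h) y i i j = (1 / 2 : ℝ) * pd j (trace g h) y := by
  rw [hg.pd_trace hk hh]
  simp only [raiseLast, christoffelVar]
  have e : ∑ i, ∑ b, inv g y i b * cov2 g h y i j b = ∑ i, ∑ b, inv g y i b * cov2 g h y b i j := by
    rw [Finset.sum_comm]
    exact Finset.sum_congr rfl fun i _ => Finset.sum_congr rfl fun b _ => by
      rw [hg.inv_symm b i, cov2_symm hs g y b j i]
  have : ∀ i b, inv g y i b * ((1 / 2 : ℝ) * (cov2 g h y i j b + cov2 g h y j i b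
      - cov2 g h y b i j)) = (1 / 2 : ℝ) * (inv g y i b * cov2 g h y i j b
        + inv g y i b * cov2 g h y j i b - inv g y i b * cov2 g h y b i j) := fun i b => by ring
  simp only [this, ← Finset.mul_sum, Finset.sum_add_distrib, Finset.sum_sub_distrib, e]
  ring

theorem cov3_christoffelVar (hg : IsMetricAt 2 g y)
    (hh : ∀ i j, ContDiffAt ℝ 2 (fun z => h z i j) y) (i l j b : Fin (n + 1)) :
    cov3 g (christoffelVar g h) y i l j b = (1 / 2 : ℝ) * (cov3 g (cov2 g h) y i l j b
      + cov3 g (cov2 g h) y i j l b - cov3 g (cov2 g h) y i b l j) := by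
  have hT := hg.differentiableAt_cov2 le_rfl hh
  have hp : pd i (fun z => christoffelVar g h z l j b) y = (1 / 2 : ℝ) *
      (pd i (fun z => cov2 g h z l j b) y + pd i (fun z => cov2 g h z j l b) y
        - pd i (fun z => cov2 g h z b l j) y) := by
    simp only [christoffelVar]
    rw [pd_const_mul, pd_sub ((hT _ _ _).fun_add (hT _ _ _)) (hT _ _ _),
      pd_add (hT _ _ _) (hT _ _ _)]
  simp only [cov3, hp]
  have e : ∀ (c u v w : Fin (n + 1) → ℝ), ∑ m, c m * ((1 / 2 : ℝ) * (u m + v m - w m)) =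
      (1 / 2 : ℝ) * (∑ m, c m * u m + ∑ m, c m * v m - ∑ m, c m * w m) := by
    intro c u v w
    rw [← Finset.sum_add_distrib, ← Finset.sum_sub_distrib, Finset.mul_sum]
    exact Finset.sum_congr rfl fun m _ => by ring
  simp only [christoffelVar, e]
  ring

/-- The linearization of the Ricci tensor, `(1/2) Δ_L h - δ^* B h`. -/
theorem ricciPolar_eq (hg : IsMetricAt 2 g y) (hs : ∀ z i j, h z i j = h z j i)
    (hh : ∀ i j, ContDiffAt ℝ 2 (fun z => h z i j) y) (j l : Fin (n + 1)) :
    ricciPolar (christoffel g) (raiseLast (inv g) (christoffelVar g h)) y j l =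
      (1 / 2 : ℝ) * lichnerowicz g h y j l - deltaStar g (bianchi g h) y j l := by
  set D := christoffelVar g h with hD
  set C := raiseLast (inv g) D with hC
  set T := cov2 g h with hTdef
  have hT := hg.differentiableAt_cov2 le_rfl hh
  have hDd : ∀ i j l, DifferentiableAt ℝ (fun z => D z i j l) y := fun i j l =>
    (((hT _ _ _).fun_add (hT _ _ _)).fun_sub (hT _ _ _)).const_mul _
  have hCd : ∀ a i j, DifferentiableAt ℝ (fun z => C z a i j) y := fun a i j =>
    DifferentiableAt.fun_sum fun b _ =>
      ((hg.contDiffAt_inv a b).differentiableAt two_ne_zero).fun_mul (hDd i j b)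
  -- These terms make up the divergence `∇_i C^i_{lj}`. As `g⁻¹` is parallel, it equals the
  -- contraction of `∇D` with the inverse metric.
  have hdivC : ∑ i, (pd i (fun z => C z i l j) y + ∑ m, (christoffel g y i i m * C y m l j
      - christoffel g y i l m * C y m i j - C y i l m * christoffel g y m i j)) =
      ∑ i, ∑ b, inv g y i b * cov3 g D y i l j b := by
    have hpd : ∀ i, pd i (fun z => C z i l j) y =
        ∑ b, inv g y i b * cov1 g (fun z b => D z l j b) y i b
          - ∑ m, christoffel g y i i m * C y m l j := fun i =>
      hg.pd_sharp one_le_two (v := fun z b => D z l j b) (fun b => hDd l j b) i i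
    have e3 : ∀ i b, cov3 g D y i l j b = cov1 g (fun z b => D z l j b) y i b
        - ∑ m, christoffel g y m i l * D y m j b - ∑ m, christoffel g y m i j * D y l m b := by
      intro i b
      simp only [cov3, cov1, smul_eq_mul]
      ring
    have e4 : ∀ i, ∑ b, inv g y i b * ∑ m, christoffel g y m i l * D y m j b =
        ∑ m, christoffel g y m i l * C y i m j := by
      intro i
      simp only [hC, raiseLast, Finset.mul_sum]
      rw [Finset.sum_comm]
      exact Finset.sum_congr rfl fun _ _ => Finset.sum_congr rfl fun _ _ => by ring
    have e5 : ∀ i, ∑ b, inv g y i b * ∑ m, christoffel g y m i j * D y l m b =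
        ∑ m, C y i l m * christoffel g y m i j := by
      intro i
      simp only [hC, raiseLast, Finset.mul_sum, Finset.sum_mul]
      rw [Finset.sum_comm]
      exact Finset.sum_congr rfl fun _ _ => Finset.sum_congr rfl fun _ _ => by ring
    have e6 : ∑ i, ∑ m, christoffel g y i l m * C y m i j =
        ∑ i, ∑ m, christoffel g y m i l * C y i m j := by
      rw [Finset.sum_comm]
      exact Finset.sum_congr rfl fun i _ => Finset.sum_congr rfl fun m _ => by
        rw [hg.christoffel_symm m l i]
    simp only [hpd, e3, mul_sub, Finset.sum_sub_distrib, Finset.sum_add_distrib, e4, e5, e6]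
    ring
  have htr : ∀ m, ∑ i, C y i i m = (1 / 2 : ℝ) * pd m (trace g h) y :=
    hg.sum_raiseLast_christoffelVar one_le_two hs fun i j => (hh i j).differentiableAt two_ne_zero
  -- The contraction `C^i_{ij} = (1/2) ∂_j tr h` is differentiated, hence it is needed at all points
  -- near `y`.
  have hptr : ∑ i, pd l (fun z => C z i i j) y = (1 / 2 : ℝ) * pd l (pd j (trace g h)) y := by
    rw [← pd_sum _ fun i _ => hCd i i j, ← pd_const_mul]
    refine pd_congr ?_ l
    have h1 : ∀ᶠ z in 𝓝 y, ∀ a b, ContDiffAt ℝ 2 (fun z => h z a b) z :=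
      eventually_all.2 fun a => eventually_all.2 fun b => (hh a b).eventually (by simp)
    filter_upwards [h1, hg.eventually (by simp)] with z h1 h2
    exact h2.sum_raiseLast_christoffelVar one_le_two hs
      (fun i j => (h1 i j).differentiableAt two_ne_zero) j
  have htrΓ : ∑ i, ∑ m, C y i i m * christoffel g y m l j =
      (1 / 2 : ℝ) * ∑ m, christoffel g y m l j * pd m (trace g h) y := by
    rw [Finset.sum_comm]
    simp only [← Finset.sum_mul, htr, Finset.mul_sum]
    exact Finset.sum_congr rfl fun _ _ => by ring
  have hlhs : ricciPolar (christoffel g) C y j l = ∑ i, ∑ b, inv g y i b * cov3 g D y i l j b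
      - (1 / 2 : ℝ) * (pd l (pd j (trace g h)) y
        - ∑ m, christoffel g y m l j * pd m (trace g h) y) := by
    rw [← hdivC, mul_sub, ← hptr, ← htrΓ, ← Finset.sum_sub_distrib, ← Finset.sum_sub_distrib]
    simp only [ricciPolar]
    refine Finset.sum_congr rfl fun i _ => ?_
    simp only [Finset.sum_sub_distrib, Finset.sum_add_distrib]
    ring
  have hhess : pd j (pd l (trace g h)) y - ∑ m, christoffel g y m j l * pd m (trace g h) y =
      pd l (pd j (trace g h)) y - ∑ m, christoffel g y m l j * pd m (trace g h) y := by
    rw [pd_comm (hg.contDiffAt_trace hh)]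
    simp only [fun m => hg.christoffel_symm m j l]
  have hTs : ∀ z i a b, T z i a b = T z i b a := fun z => cov2_symm hs g z
  have hswap : ∀ l j, ∑ i, ∑ b, inv g y i b * cov3 g T y l b i j =
      ∑ i, ∑ b, inv g y i b * cov3 g T y l i j b := by
    intro l j
    rw [Finset.sum_comm]
    exact Finset.sum_congr rfl fun i _ => Finset.sum_congr rfl fun b _ => by
      rw [hg.inv_symm b i, cov3_symm hTs g y l i b j]
  have hboch : bochner g h y j l = -∑ i, ∑ b, inv g y i b * cov3 g T y i b l j := by
    simp only [bochner, ← hTdef, fun i m => cov3_symm hTs g y i m j l]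
  have hsplit : ∑ i, ∑ b, inv g y i b * cov3 g D y i l j b = (1 / 2 : ℝ) *
      (∑ i, ∑ b, inv g y i b * cov3 g T y i l j b + ∑ i, ∑ b, inv g y i b * cov3 g T y i j l b
        - ∑ i, ∑ b, inv g y i b * cov3 g T y i b l j) := by
    simp only [← Finset.sum_add_distrib, ← Finset.sum_sub_distrib, Finset.mul_sum]
    exact Finset.sum_congr rfl fun i _ => Finset.sum_congr rfl fun b _ => by
      rw [hg.cov3_christoffelVar hh]; ring
  -- Of the three second-derivative terms in `hsplit`, the first two become `∇_l` and `∇_j` of the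
  -- divergence once the derivatives are commuted, at the price of the curvature terms of `Δ_L`; the
  -- third is the Bochner Laplacian.
  have hR1 := hg.contraction_ricci_identity le_rfl (by simp) hs hh j l
  have hR2 := hg.contraction_ricci_identity le_rfl (by simp) hs hh l j
  simp only [mul_sub, Finset.sum_sub_distrib] at hR1 hR2
  rw [← hTdef] at hR1 hR2
  have hric : ricAct g h y j l = (1 / 2 : ℝ) * (∑ c, ∑ m, inv g y c m * (ricci g y j c * h y m l)
      + ∑ c, ∑ m, inv g y c m * (ricci g y l c * h y m j)) := by
    simp only [ricAct, mul_add, Finset.sum_add_distrib]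
  have hriem := hg.riemAct_symm le_rfl (by simp) hs j l
  simp only [lichnerowicz, deltaStar, hg.cov1_bianchi hh, ← hTdef, hswap, hhess, hlhs, hsplit,
    hboch, hric]
  linarith

end IsMetricAt

end RicciVariation

/-! ### Uniform orders of jets over a family of perturbations. -/

section Jets

/-- A family of base points `pt x` and sizes `r x ∈ [0, 1]`, for `x` in a set `S`. -/
structure JetParam (n : ℕ) (X : Type*) where
  /-- The parameter set. -/
  S : Set X
  /-- The size. -/
  r : X → ℝ
  /-- The base point. -/
  pt : X → Vec n
  r_nonneg : ∀ x ∈ S, 0 ≤ r x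
  r_le_one : ∀ x ∈ S, r x ≤ 1

variable {n : ℕ} {X : Type*} {F : Type*} [NormedAddCommGroup F] [NormedSpace ℝ F]
  {G : Type*} [NormedAddCommGroup G] [NormedSpace ℝ G]
  {H : Type*} [NormedAddCommGroup H] [NormedSpace ℝ H] {𝒥 : JetParam n X}

/-- The functions `f x` are of class `C^k` near `pt x`, and their partial derivatives of order at
most `k` at `pt x` are `O(r ^ p)`, uniformly in `x ∈ S`. -/
def JetO (𝒥 : JetParam n X) : ℕ → ℕ → (X → Vec n → F) → Prop
  | 0, p, f => (fun x => f x (𝒥.pt x)) =O[𝓟 𝒥.S] fun x => 𝒥.r x ^ p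
  | k + 1, p, f => ((fun x => f x (𝒥.pt x)) =O[𝓟 𝒥.S] fun x => 𝒥.r x ^ p) ∧
      (∀ x ∈ 𝒥.S, ContDiffAt ℝ ((k + 1 : ℕ) : ℕ∞ω) (f x) (𝒥.pt x)) ∧
      ∀ i, JetO 𝒥 k p fun x => pd i (f x)

namespace JetO

theorem isBigO {k p : ℕ} {f : X → Vec n → F} (hf : JetO 𝒥 k p f) :
    (fun x => f x (𝒥.pt x)) =O[𝓟 𝒥.S] fun x => 𝒥.r x ^ p := by
  cases k with
  | zero => exact hf
  | succ k => exact hf.1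

theorem contDiffAt {k p : ℕ} {f : X → Vec n → F} (hf : JetO 𝒥 (k + 1) p f) {x : X}
    (hx : x ∈ 𝒥.S) : ContDiffAt ℝ ((k + 1 : ℕ) : ℕ∞ω) (f x) (𝒥.pt x) :=
  hf.2.1 x hx

theorem differentiableAt {k p : ℕ} {f : X → Vec n → F} (hf : JetO 𝒥 (k + 1) p f) {x : X}
    (hx : x ∈ 𝒥.S) : DifferentiableAt ℝ (f x) (𝒥.pt x) :=
  (hf.contDiffAt hx).differentiableAt (by simp)

theorem eventually_differentiableAt {k p : ℕ} {f : X → Vec n → F} (hf : JetO 𝒥 (k + 1) p f) {x : X}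
    (hx : x ∈ 𝒥.S) : ∀ᶠ z in 𝓝 (𝒥.pt x), DifferentiableAt ℝ (f x) z :=
  ((hf.contDiffAt hx).eventually (by simp)).mono fun _ hz => hz.differentiableAt (by simp)

theorem pd {k p : ℕ} {f : X → Vec n → F} (hf : JetO 𝒥 (k + 1) p f) (i : Fin (n + 1)) :
    JetO 𝒥 k p fun x => EYM.pd i (f x) :=
  hf.2.2 i

theorem congr {k p : ℕ} {f f' : X → Vec n → F} (hf : JetO 𝒥 k p f)
    (h : ∀ x ∈ 𝒥.S, f x =ᶠ[𝓝 (𝒥.pt x)] f' x) : JetO 𝒥 k p f' := by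
  induction k generalizing f f' with
  | zero =>
    exact IsBigO.congr' hf (eventually_principal.2 fun x hx => (h x hx).self_of_nhds)
      EventuallyEq.rfl
  | succ k ih =>
    exact ⟨hf.1.congr' (eventually_principal.2 fun x hx => (h x hx).self_of_nhds)
      EventuallyEq.rfl, fun x hx => (hf.2.1 x hx).congr_of_eventuallyEq (h x hx).symm,
      fun i => ih (hf.2.2 i) fun x hx => pd_eventuallyEq (h x hx) i⟩

theorem pred {k p : ℕ} {f : X → Vec n → F} (hf : JetO 𝒥 (k + 1) p f) : JetO 𝒥 k p f := by
  induction k generalizing f with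
  | zero => exact hf.1
  | succ k ih =>
    exact ⟨hf.1, fun x hx => (hf.2.1 x hx).of_le (by exact_mod_cast Nat.le_succ _),
      fun i => ih (hf.2.2 i)⟩

/-- A higher power of `r` is the smaller one because `r ≤ 1` on the parameter set. -/
theorem mono {k p q : ℕ} {f : X → Vec n → F} (hf : JetO 𝒥 k p f) (hq : q ≤ p) : JetO 𝒥 k q f := by
  have hr : (fun x => 𝒥.r x ^ p) =O[𝓟 𝒥.S] fun x => 𝒥.r x ^ q :=
    IsBigO.of_bound 1 <| eventually_principal.2 fun x hx => by
      have h0 := 𝒥.r_nonneg x hx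
      rw [one_mul, Real.norm_of_nonneg (pow_nonneg h0 _), Real.norm_of_nonneg (pow_nonneg h0 _)]
      exact pow_le_pow_of_le_one h0 (𝒥.r_le_one x hx) hq
  induction k generalizing f with
  | zero => exact IsBigO.trans hf hr
  | succ k ih => exact ⟨hf.1.trans hr, hf.2.1, fun i => ih (hf.2.2 i)⟩

theorem zero {k p : ℕ} : JetO 𝒥 k p (fun _ _ => (0 : F)) := by
  induction k with
  | zero => exact isBigO_zero _ _
  | succ k ih =>
    refine ⟨isBigO_zero _ _, fun x _ => contDiffAt_const, fun i => ?_⟩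
    refine ih.congr fun x _ => Eventually.of_forall fun z => ?_
    exact (pd_const (0 : F) i).symm

theorem add {k p : ℕ} {f f' : X → Vec n → F} (hf : JetO 𝒥 k p f) (hf' : JetO 𝒥 k p f') :
    JetO 𝒥 k p fun x z => f x z + f' x z := by
  induction k generalizing f f' with
  | zero => exact IsBigO.add hf hf'
  | succ k ih =>
    refine ⟨hf.1.add hf'.1, fun x hx => (hf.2.1 x hx).add (hf'.2.1 x hx), fun i => ?_⟩
    refine (ih (hf.2.2 i) (hf'.2.2 i)).congr fun x hx => ?_
    filter_upwards [hf.eventually_differentiableAt hx, hf'.eventually_differentiableAt hx]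
      with z h1 h2 using (pd_add h1 h2 i).symm

/-- Orders add under products, by the Leibniz rule and induction on the number of derivatives. Every
nonlinear term is estimated through this lemma, with `B` a product, a scalar action, the Lie bracket
or the inner product. -/
theorem bilin (B : F →L[ℝ] G →L[ℝ] H) {k p q : ℕ} {f : X → Vec n → F} {f' : X → Vec n → G}
    (hf : JetO 𝒥 k p f) (hf' : JetO 𝒥 k q f') :
    JetO 𝒥 k (p + q) fun x z => B (f x z) (f' x z) := by
  have base : ∀ {k : ℕ} {f : X → Vec n → F} {f' : X → Vec n → G}, JetO 𝒥 k p f → JetO 𝒥 k q f' →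
      (fun x => B (f x (𝒥.pt x)) (f' x (𝒥.pt x))) =O[𝓟 𝒥.S] fun x => 𝒥.r x ^ (p + q) := by
    intro k f f' hf hf'
    have h1 : (fun x => B (f x (𝒥.pt x)) (f' x (𝒥.pt x))) =O[𝓟 𝒥.S]
        fun x => ‖f x (𝒥.pt x)‖ * ‖f' x (𝒥.pt x)‖ :=
      IsBigO.of_bound ‖B‖ <| Eventually.of_forall fun x => by
        rw [Real.norm_of_nonneg (by positivity), ← mul_assoc]
        exact B.le_opNorm₂ _ _
    simp only [pow_add]
    exact h1.trans (hf.isBigO.norm_left.mul hf'.isBigO.norm_left)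
  induction k generalizing f f' with
  | zero => exact base hf hf'
  | succ k ih =>
    refine ⟨base hf hf', fun x hx => ?_, fun i => ?_⟩
    · exact (B.contDiff.contDiffAt.comp _ (hf.2.1 x hx)).clm_apply (hf'.2.1 x hx)
    · refine ((ih (hf.2.2 i) hf'.pred).add (ih hf.pred (hf'.2.2 i))).congr fun x hx => ?_
      filter_upwards [hf.eventually_differentiableAt hx, hf'.eventually_differentiableAt hx]
        with z h1 h2 using (pd_bilin B h1 h2 i).symm

theorem smul {k p q : ℕ} {f : X → Vec n → ℝ} {f' : X → Vec n → F} (hf : JetO 𝒥 k p f)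
    (hf' : JetO 𝒥 k q f') : JetO 𝒥 k (p + q) fun x z => f x z • f' x z :=
  bilin (ContinuousLinearMap.lsmul ℝ ℝ) hf hf'

theorem mul {k p q : ℕ} {f f' : X → Vec n → ℝ} (hf : JetO 𝒥 k p f) (hf' : JetO 𝒥 k q f') :
    JetO 𝒥 k (p + q) fun x z => f x z * f' x z :=
  hf.smul hf'

theorem const_smul {k p : ℕ} {f : X → Vec n → F} (hf : JetO 𝒥 k p f) (c : ℝ) :
    JetO 𝒥 k p fun x z => c • f x z := by
  induction k generalizing f with
  | zero => exact IsBigO.const_smul_left hf c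
  | succ k ih =>
    refine ⟨hf.1.const_smul_left c, fun x hx => (hf.2.1 x hx).const_smul c, fun i => ?_⟩
    exact (ih (hf.2.2 i)).congr fun x _ => Eventually.of_forall fun z => (pd_const_smul c _ i).symm

theorem const_mul {k p : ℕ} {f : X → Vec n → ℝ} (hf : JetO 𝒥 k p f) (c : ℝ) :
    JetO 𝒥 k p fun x z => c * f x z :=
  hf.const_smul c

theorem neg {k p : ℕ} {f : X → Vec n → F} (hf : JetO 𝒥 k p f) : JetO 𝒥 k p fun x z => -f x z := by
  simpa using hf.const_smul (-1)

theorem sub {k p : ℕ} {f f' : X → Vec n → F} (hf : JetO 𝒥 k p f) (hf' : JetO 𝒥 k p f') :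
    JetO 𝒥 k p fun x z => f x z - f' x z := by
  simpa only [sub_eq_add_neg] using hf.add hf'.neg

theorem sum {ι : Type*} {s : Finset ι} {k p : ℕ} {f : ι → X → Vec n → F}
    (hf : ∀ a, JetO 𝒥 k p (f a)) : JetO 𝒥 k p fun x z => ∑ a ∈ s, f a x z := by
  classical
  induction s using Finset.induction_on with
  | empty => simpa using zero
  | insert a s ha ih => simpa only [Finset.sum_insert ha] using (hf a).add ih

/-- The unperturbed data have order `0`: each partial derivative is continuous, hence bounded on the
compact set of base points. -/
theorem of_contDiffAt {U K : Set (Vec n)} (hK : IsCompact K) (hKU : K ⊆ U)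
    (hpt : ∀ x ∈ 𝒥.S, 𝒥.pt x ∈ K) {f : Vec n → F} (hf : ∀ z ∈ U, ContDiffAt ℝ ∞ f z) (k : ℕ) :
    JetO 𝒥 k 0 fun _ => f := by
  have base : ∀ f : Vec n → F, (∀ z ∈ U, ContDiffAt ℝ ∞ f z) →
      (fun x => f (𝒥.pt x)) =O[𝓟 𝒥.S] fun x => 𝒥.r x ^ 0 := by
    intro f hf
    obtain ⟨C, hC⟩ := hK.exists_bound_of_continuousOn (f := f)
      fun z hz => (hf z (hKU hz)).continuousAt.continuousWithinAt
    exact IsBigO.of_bound C <| eventually_principal.2 fun x hx => by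
      simpa using hC _ (hpt x hx)
  induction k generalizing f with
  | zero => exact base f hf
  | succ k ih =>
    exact ⟨base f hf, fun x hx => (hf _ (hKU (hpt x hx))).of_le (by exact_mod_cast le_top),
      fun i => ih fun z hz => contDiffAt_pd (hf z hz) (by simp) i⟩

/-- Only the inverse itself needs a bound by hypothesis; its derivatives are controlled recursively
by `∂(g⁻¹) = -g⁻¹ (∂g) g⁻¹`. -/
theorem inv {g : X → Cov2 n ℝ} {k : ℕ} (hg : ∀ i j, JetO 𝒥 k 0 fun x z => g x z i j)
    (hdet : ∀ x ∈ 𝒥.S, (Matrix.of (g x (𝒥.pt x))).det ≠ 0)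
    (hb : ∀ i j, JetO 𝒥 0 0 fun x z => EYM.inv (g x) z i j) (i j : Fin (n + 1)) :
    JetO 𝒥 k 0 fun x z => EYM.inv (g x) z i j := by
  induction k generalizing i j with
  | zero => exact hb i j
  | succ k ih =>
    have ih' := ih fun i j => (hg i j).pred
    refine ⟨hb i j, fun x hx => contDiffAt_inv (fun i j => (hg i j).contDiffAt hx) (hdet x hx) i j,
      fun m => ?_⟩
    have h1 : JetO 𝒥 k 0 fun x z => -∑ a, ∑ b, EYM.inv (g x) z i a
        * EYM.pd m (fun w => g x w a b) z * EYM.inv (g x) z b j :=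
      (sum fun a => sum fun b => ((ih' i a).mul ((hg a b).pd m)).mul (ih' b j)).neg
    refine h1.congr fun x hx => ?_
    have h2 : ∀ᶠ z in 𝓝 (𝒥.pt x), ∀ a b, ContDiffAt ℝ ((k + 1 : ℕ) : ℕ∞ω) (fun w => g x w a b) z :=
      eventually_all.2 fun a => eventually_all.2 fun b =>
        ((hg a b).contDiffAt hx).eventually (by simp)
    filter_upwards [h2, eventually_det_ne (fun a b => (hg a b).contDiffAt hx) (hdet x hx)]
      with z hz hd
    exact (pd_inv_eq (fun a b => (hz a b).of_le (by exact_mod_cast Nat.le_add_left 1 k)) hd m i j).symm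

end JetO

/-- The jets of `f` and `f'` are `O(r ^ p)` and differ by `O(r ^ (p + 1))`. -/
structure JetClose (𝒥 : JetParam n X) (k p : ℕ) (f f' : X → Vec n → F) : Prop where
  left : JetO 𝒥 k p f
  right : JetO 𝒥 k p f'
  sub : JetO 𝒥 k (p + 1) fun x z => f x z - f' x z

namespace JetClose

variable {k p q : ℕ}

theorem refl {f : X → Vec n → F} (hf : JetO 𝒥 k p f) : JetClose 𝒥 k p f f :=
  ⟨hf, hf, by simpa using JetO.zero⟩

theorem of_sub {f f' : X → Vec n → F} (hf : JetO 𝒥 k p f')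
    (h : JetO 𝒥 k (p + 1) fun x z => f x z - f' x z) : JetClose 𝒥 k p f f' :=
  ⟨by simpa using hf.add (h.mono (Nat.le_succ p)), hf, h⟩

theorem of_add {f f' : X → Vec n → F} (hf : JetO 𝒥 k p f) (h : JetO 𝒥 k (p + 1) f') :
    JetClose 𝒥 k p (fun x z => f x z + f' x z) f :=
  of_sub hf (by simpa using h)

theorem congr_left {f f' f'' : X → Vec n → F} (h : JetClose 𝒥 k p f f')
    (he : ∀ x ∈ 𝒥.S, f x =ᶠ[𝓝 (𝒥.pt x)] f'' x) : JetClose 𝒥 k p f'' f' :=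
  ⟨h.left.congr he, h.right, h.sub.congr fun x hx => (he x hx).sub EventuallyEq.rfl⟩

theorem pred {f f' : X → Vec n → F} (h : JetClose 𝒥 (k + 1) p f f') : JetClose 𝒥 k p f f' :=
  ⟨h.left.pred, h.right.pred, h.sub.pred⟩

theorem pd {f f' : X → Vec n → F} (h : JetClose 𝒥 (k + 1) p f f') (i : Fin (n + 1)) :
    JetClose 𝒥 k p (fun x => EYM.pd i (f x)) (fun x => EYM.pd i (f' x)) :=
  ⟨h.left.pd i, h.right.pd i, (h.sub.pd i).congr fun x hx => by
    filter_upwards [h.left.eventually_differentiableAt hx, h.right.eventually_differentiableAt hx]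
      with z h1 h2 using pd_sub h1 h2 i⟩

theorem add {f f' e e' : X → Vec n → F} (h : JetClose 𝒥 k p f f') (h' : JetClose 𝒥 k p e e') :
    JetClose 𝒥 k p (fun x z => f x z + e x z) (fun x z => f' x z + e' x z) :=
  ⟨h.left.add h'.left, h.right.add h'.right, by simpa only [add_sub_add_comm] using h.sub.add h'.sub⟩

theorem const_smul {f f' : X → Vec n → F} (h : JetClose 𝒥 k p f f') (c : ℝ) :
    JetClose 𝒥 k p (fun x z => c • f x z) (fun x z => c • f' x z) :=
  ⟨h.left.const_smul c, h.right.const_smul c, by simpa only [smul_sub] using h.sub.const_smul c⟩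

theorem const_mul {f f' : X → Vec n → ℝ} (h : JetClose 𝒥 k p f f') (c : ℝ) :
    JetClose 𝒥 k p (fun x z => c * f x z) (fun x z => c * f' x z) :=
  h.const_smul c

theorem neg {f f' : X → Vec n → F} (h : JetClose 𝒥 k p f f') :
    JetClose 𝒥 k p (fun x z => -f x z) (fun x z => -f' x z) := by
  simpa using h.const_smul (-1)

theorem fun_sub {f f' e e' : X → Vec n → F} (h : JetClose 𝒥 k p f f')
    (h' : JetClose 𝒥 k p e e') :
    JetClose 𝒥 k p (fun x z => f x z - e x z) (fun x z => f' x z - e' x z) := by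
  simpa only [sub_eq_add_neg] using h.add h'.neg

theorem sum {ι : Type*} {s : Finset ι} {f f' : ι → X → Vec n → F}
    (h : ∀ a, JetClose 𝒥 k p (f a) (f' a)) :
    JetClose 𝒥 k p (fun x z => ∑ a ∈ s, f a x z) (fun x z => ∑ a ∈ s, f' a x z) :=
  ⟨JetO.sum fun a => (h a).left, JetO.sum fun a => (h a).right, by
    simpa only [Finset.sum_sub_distrib] using JetO.sum (s := s) fun a => (h a).sub⟩

/-- The difference of products telescopes as `(f - f') e + f' (e - e')`, and each summand gains one
order. -/
theorem bilin (B : F →L[ℝ] G →L[ℝ] H) {f f' : X → Vec n → F} {e e' : X → Vec n → G}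
    (h : JetClose 𝒥 k p f f') (h' : JetClose 𝒥 k q e e') :
    JetClose 𝒥 k (p + q) (fun x z => B (f x z) (e x z)) (fun x z => B (f' x z) (e' x z)) := by
  refine ⟨h.left.bilin B h'.left, h.right.bilin B h'.right, ?_⟩
  have h1 := h.sub.bilin B h'.left
  have h2 := h.right.bilin B h'.sub
  rw [show p + 1 + q = p + q + 1 by ring] at h1
  refine (h1.add h2).congr fun x _ => Eventually.of_forall fun z => ?_
  simp

theorem smul {f f' : X → Vec n → ℝ} {e e' : X → Vec n → F} (h : JetClose 𝒥 k p f f')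
    (h' : JetClose 𝒥 k q e e') :
    JetClose 𝒥 k (p + q) (fun x z => f x z • e x z) (fun x z => f' x z • e' x z) :=
  bilin (ContinuousLinearMap.lsmul ℝ ℝ) h h'

end JetClose

end Jets

/-! ### Orders of the geometric and gauge-theoretic operators. -/

section JetGeometry

variable {n : ℕ} {X : Type*} {F : Type*} [NormedAddCommGroup F] [NormedSpace ℝ F]
  {𝔩 : Type*} [NormedAddCommGroup 𝔩] [NormedSpace ℝ 𝔩] {𝒥 : JetParam n X} {k p : ℕ}

namespace JetClose

/-- Coefficients of order `0`, such as inverse metrics, Christoffel symbols and potentials, may be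
replaced by close ones without changing the order of what they multiply. -/
theorem zero_smul {f f' : X → Vec n → ℝ} {e e' : X → Vec n → F} (h : JetClose 𝒥 k 0 f f')
    (h' : JetClose 𝒥 k p e e') :
    JetClose 𝒥 k p (fun x z => f x z • e x z) (fun x z => f' x z • e' x z) := by
  simpa only [zero_add] using h.smul h'

theorem zero_mul {f f' e e' : X → Vec n → ℝ} (h : JetClose 𝒥 k 0 f f')
    (h' : JetClose 𝒥 k p e e') :
    JetClose 𝒥 k p (fun x z => f x z * e x z) (fun x z => f' x z * e' x z) :=
  h.zero_smul h'

theorem zero_bilin (B : 𝔩 →L[ℝ] 𝔩 →L[ℝ] 𝔩) {f f' e e' : X → Vec n → 𝔩} (h : JetClose 𝒥 k 0 f f')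
    (h' : JetClose 𝒥 k p e e') :
    JetClose 𝒥 k p (fun x z => B (f x z) (e x z)) (fun x z => B (f' x z) (e' x z)) := by
  simpa only [zero_add] using h.bilin B h'

/-- The reason is `g⁻¹ - g'⁻¹ = -g⁻¹ (g - g') g'⁻¹`. Continuity is assumed separately because a jet
condition with `k = 0` carries none, while the formula is needed on a neighbourhood. -/
theorem inv {g g' : X → Cov2 n ℝ}
    (hg : ∀ i j, JetClose 𝒥 k 0 (fun x z => g x z i j) (fun x z => g' x z i j))
    (hc : ∀ x ∈ 𝒥.S, ∀ i j, ContDiffAt ℝ 0 (fun z => g x z i j) (𝒥.pt x))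
    (hc' : ∀ x ∈ 𝒥.S, ∀ i j, ContDiffAt ℝ 0 (fun z => g' x z i j) (𝒥.pt x))
    (hdet : ∀ x ∈ 𝒥.S, (Matrix.of (g x (𝒥.pt x))).det ≠ 0)
    (hdet' : ∀ x ∈ 𝒥.S, (Matrix.of (g' x (𝒥.pt x))).det ≠ 0)
    (hb : ∀ i j, JetO 𝒥 0 0 fun x z => EYM.inv (g x) z i j)
    (hb' : ∀ i j, JetO 𝒥 0 0 fun x z => EYM.inv (g' x) z i j) (i j : Fin (n + 1)) :
    JetClose 𝒥 k 0 (fun x z => EYM.inv (g x) z i j) (fun x z => EYM.inv (g' x) z i j) := by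
  have h1 := JetO.inv (fun i j => (hg i j).left) hdet hb
  have h2 := JetO.inv (fun i j => (hg i j).right) hdet' hb'
  refine ⟨h1 i j, h2 i j, ?_⟩
  have h3 : JetO 𝒥 k 1 fun x z => -∑ a, ∑ b, EYM.inv (g x) z i a
      * (g x z a b - g' x z a b) * EYM.inv (g' x) z b j :=
    (JetO.sum fun a => JetO.sum fun b => ((h1 i a).mul (hg a b).sub).mul (h2 b j)).neg
  refine h3.congr fun x hx => ?_
  filter_upwards [eventually_det_ne (hc x hx) (hdet x hx), eventually_det_ne (hc' x hx) (hdet' x hx)]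
    with z hz hz'
  have hM : (Matrix.of (g x z))⁻¹ - (Matrix.of (g' x z))⁻¹ = -((Matrix.of (g x z))⁻¹
      * (Matrix.of (g x z) - Matrix.of (g' x z)) * (Matrix.of (g' x z))⁻¹) := by
    rw [mul_sub, sub_mul, Matrix.nonsing_inv_mul _ (isUnit_iff_ne_zero.mpr hz), one_mul,
      Matrix.mul_nonsing_inv_cancel_right _ _ (isUnit_iff_ne_zero.mpr hz')]
    abel
  have h4 := congrFun (congrFun hM i) j
  simp only [Matrix.sub_apply, Matrix.neg_apply, Matrix.mul_apply, Matrix.of_apply,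
    Finset.sum_mul] at h4
  rw [Finset.sum_comm] at h4
  exact h4.symm

variable {g g' : X → Cov2 n ℝ}

theorem christoffel
    (hg : ∀ i j, JetClose 𝒥 (k + 1) 0 (fun x z => g x z i j) (fun x z => g' x z i j))
    (hG : ∀ i j, JetClose 𝒥 k 0 (fun x z => EYM.inv (g x) z i j) (fun x z => EYM.inv (g' x) z i j))
    (a i j : Fin (n + 1)) : JetClose 𝒥 k 0 (fun x z => EYM.christoffel (g x) z a i j)
      (fun x z => EYM.christoffel (g' x) z a i j) :=
  const_mul (sum fun l => (hG a l).zero_mul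
    ((((hg j l).pd i).add ((hg i l).pd j)).fun_sub ((hg i j).pd l))) _

theorem cov1 (hΓ : ∀ a i j, JetClose 𝒥 k 0 (fun x z => EYM.christoffel (g x) z a i j)
      (fun x z => EYM.christoffel (g' x) z a i j))
    {a a' : X → Cov1 n F}
    (ha : ∀ i, JetClose 𝒥 (k + 1) p (fun x z => a x z i) (fun x z => a' x z i))
    (i j : Fin (n + 1)) : JetClose 𝒥 k p (fun x z => EYM.cov1 (g x) (a x) z i j)
      (fun x z => EYM.cov1 (g' x) (a' x) z i j) :=
  ((ha j).pd i).fun_sub (sum fun m => (hΓ m i j).zero_smul (ha m).pred)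

theorem cov2 (hΓ : ∀ a i j, JetClose 𝒥 k 0 (fun x z => EYM.christoffel (g x) z a i j)
      (fun x z => EYM.christoffel (g' x) z a i j))
    {h h' : X → Cov2 n F}
    (hh : ∀ i j, JetClose 𝒥 (k + 1) p (fun x z => h x z i j) (fun x z => h' x z i j))
    (i j l : Fin (n + 1)) : JetClose 𝒥 k p (fun x z => EYM.cov2 (g x) (h x) z i j l)
      (fun x z => EYM.cov2 (g' x) (h' x) z i j l) :=
  (((hh j l).pd i).fun_sub (sum fun m => (hΓ m i j).zero_smul (hh m l).pred)).fun_sub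
    (sum fun m => (hΓ m i l).zero_smul (hh j m).pred)

theorem deltaStar (hΓ : ∀ a i j, JetClose 𝒥 k 0 (fun x z => EYM.christoffel (g x) z a i j)
      (fun x z => EYM.christoffel (g' x) z a i j))
    {a a' : X → Cov1 n ℝ}
    (ha : ∀ i, JetClose 𝒥 (k + 1) p (fun x z => a x z i) (fun x z => a' x z i))
    (i j : Fin (n + 1)) : JetClose 𝒥 k p (fun x z => EYM.deltaStar (g x) (a x) z i j)
      (fun x z => EYM.deltaStar (g' x) (a' x) z i j) :=
  ((cov1 hΓ ha i j).add (cov1 hΓ ha j i)).const_mul _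

theorem dStar1 (hΓ : ∀ a i j, JetClose 𝒥 k 0 (fun x z => EYM.christoffel (g x) z a i j)
      (fun x z => EYM.christoffel (g' x) z a i j))
    (hG : ∀ i j, JetClose 𝒥 k 0 (fun x z => EYM.inv (g x) z i j)
      (fun x z => EYM.inv (g' x) z i j))
    (B : 𝔩 →L[ℝ] 𝔩 →L[ℝ] 𝔩) {ϖ ϖ' a a' : X → Cov1 n 𝔩}
    (hϖ : ∀ i, JetClose 𝒥 k 0 (fun x z => ϖ x z i) (fun x z => ϖ' x z i))
    (ha : ∀ i, JetClose 𝒥 (k + 1) p (fun x z => a x z i) (fun x z => a' x z i)) :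
    JetClose 𝒥 k p (fun x => EYM.dStar1 (fun u v => B u v) (g x) (ϖ x) (a x))
      (fun x => EYM.dStar1 (fun u v => B u v) (g' x) (ϖ' x) (a' x)) :=
  neg (sum fun i => sum fun j => (hG i j).zero_smul
    ((cov1 hΓ ha i j).add ((hϖ i).zero_bilin B (ha j).pred)))

theorem dStar2 (hΓ : ∀ a i j, JetClose 𝒥 k 0 (fun x z => EYM.christoffel (g x) z a i j)
      (fun x z => EYM.christoffel (g' x) z a i j))
    (hG : ∀ i j, JetClose 𝒥 k 0 (fun x z => EYM.inv (g x) z i j)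
      (fun x z => EYM.inv (g' x) z i j))
    (B : 𝔩 →L[ℝ] 𝔩 →L[ℝ] 𝔩) {ϖ ϖ' : X → Cov1 n 𝔩} {Φ Φ' : X → Cov2 n 𝔩}
    (hϖ : ∀ i, JetClose 𝒥 k 0 (fun x z => ϖ x z i) (fun x z => ϖ' x z i))
    (hΦ : ∀ i j, JetClose 𝒥 (k + 1) p (fun x z => Φ x z i j) (fun x z => Φ' x z i j))
    (j : Fin (n + 1)) :
    JetClose 𝒥 k p (fun x z => EYM.dStar2 (fun u v => B u v) (g x) (ϖ x) (Φ x) z j)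
      (fun x z => EYM.dStar2 (fun u v => B u v) (g' x) (ϖ' x) (Φ' x) z j) :=
  neg (sum fun i => sum fun m => (hG i m).zero_smul
    ((cov2 hΓ hΦ i m j).add ((hϖ i).zero_bilin B (hΦ m j).pred)))

/-- The inverse metric is required with one derivative more than the result, since the trace is
differentiated. -/
theorem bianchi (hΓ : ∀ a i j, JetClose 𝒥 k 0 (fun x z => EYM.christoffel (g x) z a i j)
      (fun x z => EYM.christoffel (g' x) z a i j))
    (hG : ∀ i j, JetClose 𝒥 (k + 1) 0 (fun x z => EYM.inv (g x) z i j)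
      (fun x z => EYM.inv (g' x) z i j)) {h h' : X → Cov2 n ℝ}
    (hh : ∀ i j, JetClose 𝒥 (k + 1) p (fun x z => h x z i j) (fun x z => h' x z i j))
    (j : Fin (n + 1)) : JetClose 𝒥 k p (fun x z => EYM.bianchi (g x) (h x) z j)
      (fun x z => EYM.bianchi (g' x) (h' x) z j) := by
  have htr : JetClose 𝒥 (k + 1) p (fun x => EYM.trace (g x) (h x))
      (fun x => EYM.trace (g' x) (h' x)) :=
    sum fun i => sum fun l => (hG i l).zero_mul (hh i l)
  exact (neg (sum fun i => sum fun m => (hG i m).pred.zero_mul (cov2 hΓ hh m i j))).add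
    ((htr.pd j).const_mul _)

theorem dCov0 (B : 𝔩 →L[ℝ] 𝔩 →L[ℝ] 𝔩) {ϖ ϖ' : X → Cov1 n 𝔩} {f f' : X → Vec n → 𝔩}
    (hϖ : ∀ i, JetClose 𝒥 k 0 (fun x z => ϖ x z i) (fun x z => ϖ' x z i))
    (hf : JetClose 𝒥 (k + 1) p f f') (i : Fin (n + 1)) :
    JetClose 𝒥 k p (fun x z => EYM.dCov0 (fun u v => B u v) (ϖ x) (f x) z i)
      (fun x z => EYM.dCov0 (fun u v => B u v) (ϖ' x) (f' x) z i) :=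
  (hf.pd i).add ((hϖ i).zero_bilin B hf.pred)

end JetClose

/-- The curvature is a quadratic polynomial in the potential; skew-symmetry of the bracket turns the
mixed terms into those of `d_ϖ α`. -/
theorem ymCurv_add (B : 𝔩 →L[ℝ] 𝔩 →L[ℝ] 𝔩) (hB : ∀ u v, B u v = -B v u) {ϖ α : Cov1 n 𝔩} {y : Vec n}
    (hϖ : ∀ i, DifferentiableAt ℝ (fun z => ϖ z i) y)
    (hα : ∀ i, DifferentiableAt ℝ (fun z => α z i) y) (i j : Fin (n + 1)) :
    ymCurv (fun u v => B u v) (ϖ + α) y i j = ymCurv (fun u v => B u v) ϖ y i j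
      + dCov1 (fun u v => B u v) ϖ α y i j + B (α y i) (α y j) := by
  simp only [ymCurv, dCov1, Pi.add_apply, pd_add (hϖ _) (hα _), map_add, add_apply,
    hB (α y i) (ϖ y j)]
  abel

theorem JetO.dCov1 (B : 𝔩 →L[ℝ] 𝔩 →L[ℝ] 𝔩) {ϖ a : X → Cov1 n 𝔩}
    (hϖ : ∀ i, JetO 𝒥 k 0 (fun x z => ϖ x z i))
    (ha : ∀ i, JetO 𝒥 (k + 1) p (fun x z => a x z i)) (i j : Fin (n + 1)) :
    JetO 𝒥 k p (fun x z => EYM.dCov1 (fun u v => B u v) (ϖ x) (a x) z i j) := by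
  have h : ∀ i j, JetO 𝒥 k p fun x z => B (ϖ x z i) (a x z j) := fun i j => by
    simpa only [zero_add] using (hϖ i).bilin B (ha j).pred
  exact ((((ha j).pd i).sub ((ha i).pd j)).add (h i j)).sub (h j i)

/-- To first order, the curvature of `ϖ + α` is `d_ϖ α` if `ϖ` is flat. -/
theorem JetClose.ymCurv (B : 𝔩 →L[ℝ] 𝔩 →L[ℝ] 𝔩) (hB : ∀ u v, B u v = -B v u) {ϖ α : X → Cov1 n 𝔩}
    (hϖ : ∀ i, JetO 𝒥 (k + 1) 0 (fun x z => ϖ x z i))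
    (hα : ∀ i, JetO 𝒥 (k + 1) 1 (fun x z => α x z i))
    (hflat : ∀ x ∈ 𝒥.S, ∀ᶠ z in 𝓝 (𝒥.pt x), ∀ i j, EYM.ymCurv (fun u v => B u v) (ϖ x) z i j = 0)
    (i j : Fin (n + 1)) :
    JetClose 𝒥 k 1 (fun x z => EYM.ymCurv (fun u v => B u v) (ϖ x + α x) z i j)
      (fun x z => dCov1 (fun u v => B u v) (ϖ x) (α x) z i j) := by
  refine (JetClose.of_add (JetO.dCov1 B (fun i => (hϖ i).pred) hα i j)
    ((hα i).pred.bilin B (hα j).pred)).congr_left fun x hx => ?_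
  have h1 : ∀ᶠ z in 𝓝 (𝒥.pt x), ∀ i, DifferentiableAt ℝ (fun z => ϖ x z i) z :=
    eventually_all.2 fun i => (hϖ i).eventually_differentiableAt hx
  have h2 : ∀ᶠ z in 𝓝 (𝒥.pt x), ∀ i, DifferentiableAt ℝ (fun z => α x z i) z :=
    eventually_all.2 fun i => (hα i).eventually_differentiableAt hx
  filter_upwards [hflat x hx, h1, h2] with z hz h1 h2
  rw [ymCurv_add B hB h1 h2, hz, zero_add]

/-- Each summand contains two curvature factors of order `1` and coefficients of order `0`, whence
order `2`. -/
theorem JetO.stressMod {𝒥 : JetParam n X} (B : 𝔩 →L[ℝ] 𝔩 →L[ℝ] 𝔩) (q : 𝔩 →L[ℝ] 𝔩 →L[ℝ] ℝ)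
    {g : X → Cov2 n ℝ}
    {ϖ : X → Cov1 n 𝔩} (hg : ∀ i j, JetO 𝒥 k 0 fun x z => g x z i j)
    (hG : ∀ i j, JetO 𝒥 k 0 fun x z => EYM.inv (g x) z i j)
    (hΩ : ∀ i j, JetO 𝒥 k 1 fun x z => EYM.ymCurv (fun u v => B u v) (ϖ x) z i j)
    (i j : Fin (n + 1)) :
    JetO 𝒥 k 2 fun x z => EYM.stressMod (fun u v => B u v) q (g x) (ϖ x) z i j := by
  have hq : ∀ a b c d, JetO 𝒥 k 2 fun x z => q (EYM.ymCurv (fun u v => B u v) (ϖ x) z a b)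
      (EYM.ymCurv (fun u v => B u v) (ϖ x) z c d) := fun a b c d => (hΩ a b).bilin q (hΩ c d)
  have hQ : JetO 𝒥 k 2 fun x z => selfAction (fun u v => B u v) q (g x) (ϖ x) z :=
    const_mul (sum fun a => sum fun b => sum fun c => sum fun d => by
      simpa only [zero_add] using ((hG a c).mul (hG b d)).mul (hq a b c d)) _
  have hK : ∀ i j, JetO 𝒥 k 2 fun x z => stress (fun u v => B u v) q (g x) (ϖ x) z i j :=
    fun i j => (const_mul (sum fun a => sum fun b => by
      simpa only [zero_add] using (hG a b).mul (hq i a j b)) _).add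
        ((hQ.const_mul _).mul (hg i j))
  have htr : JetO 𝒥 k 2 fun x z => trace (g x) (stress (fun u v => B u v) q (g x) (ϖ x)) z :=
    sum fun a => sum fun b => by simpa only [zero_add] using (hG a b).mul (hK a b)
  have htr' : JetO 𝒥 k 2 fun x z =>
      trace (g x) (stress (fun u v => B u v) q (g x) (ϖ x)) z / ((n : ℝ) - 1) := by
    simpa only [div_eq_inv_mul] using htr.const_mul ((n : ℝ) - 1)⁻¹
  exact (hK i j).sub (htr'.mul (hg i j))

theorem JetClose.ricciPolar {Γ C C' : X → Cov3 n ℝ}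
    (hΓ : ∀ a i j, JetO 𝒥 k 0 fun x z => Γ x z a i j)
    (hC : ∀ a i j, JetClose 𝒥 (k + 1) p (fun x z => C x z a i j) (fun x z => C' x z a i j))
    (j l : Fin (n + 1)) : JetClose 𝒥 k p (fun x z => EYM.ricciPolar (Γ x) (C x) z j l)
      (fun x z => EYM.ricciPolar (Γ x) (C' x) z j l) := by
  have h1 : ∀ a b c d e f, JetClose 𝒥 k p (fun x z => Γ x z a b c * C x z d e f)
      (fun x z => Γ x z a b c * C' x z d e f) := fun a b c d e f =>
    (JetClose.refl (hΓ a b c)).zero_mul (hC d e f).pred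
  have h2 : ∀ a b c d e f, JetClose 𝒥 k p (fun x z => C x z d e f * Γ x z a b c)
      (fun x z => C' x z d e f * Γ x z a b c) := fun a b c d e f => by
    simpa only [mul_comm] using h1 a b c d e f
  exact sum fun i => (((hC i l j).pd i).fun_sub ((hC i i j).pd l)).add
    (sum fun m => (((h1 _ _ _ _ _ _).add (h2 _ _ _ _ _ _)).fun_sub (h1 _ _ _ _ _ _)).fun_sub
      (h2 _ _ _ _ _ _))

/-- To first order, the Ricci tensor of `g₀ + h` is
`Ric + (1/2) Δ_L h - δ^* B h` (in its polarized form). -/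
theorem JetO.ricci_add_sub {g₀ h : X → Cov2 n ℝ}
    (hm₀ : ∀ x ∈ 𝒥.S, IsMetricAt 2 (g₀ x) (𝒥.pt x))
    (hm : ∀ x ∈ 𝒥.S, IsMetricAt 2 (g₀ x + h x) (𝒥.pt x))
    (hΓ : ∀ a i j, JetO 𝒥 1 0 fun x z => EYM.christoffel (g₀ x) z a i j)
    (hG : ∀ i j, JetClose 𝒥 1 0 (fun x z => EYM.inv (g₀ x + h x) z i j)
      (fun x z => EYM.inv (g₀ x) z i j))
    (hh : ∀ i j, JetO 𝒥 2 1 fun x z => h x z i j) (j l : Fin (n + 1)) :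
    JetO 𝒥 0 2 fun x z => ricci (g₀ x + h x) z j l - (ricci (g₀ x) z j l
      + EYM.ricciPolar (EYM.christoffel (g₀ x))
        (raiseLast (EYM.inv (g₀ x)) (christoffelVar (g₀ x) (h x))) z j l) := by
  have hT : ∀ i j l, JetO 𝒥 1 1 fun x z => EYM.cov2 (g₀ x) (h x) z i j l := fun i j l =>
    (JetClose.cov2 (fun a i j => JetClose.refl (hΓ a i j)) (fun i j => JetClose.refl (hh i j))
      i j l).left
  have hD : ∀ i j l, JetO 𝒥 1 1 fun x z => christoffelVar (g₀ x) (h x) z i j l := fun i j l =>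
    (((hT i j l).add (hT j i l)).sub (hT l i j)).const_mul _
  have hC : ∀ a i j, JetClose 𝒥 1 1
      (fun x z => raiseLast (EYM.inv (g₀ x + h x)) (christoffelVar (g₀ x) (h x)) z a i j)
      (fun x z => raiseLast (EYM.inv (g₀ x)) (christoffelVar (g₀ x) (h x)) z a i j) :=
    fun a i j => JetClose.sum fun l => (hG a l).zero_mul (JetClose.refl (hD i j l))
  have hP := (JetClose.ricciPolar (fun a i j => (hΓ a i j).pred) hC j l).sub
  have hCC : JetO 𝒥 0 2 fun x z => ∑ i, ∑ m,
      (raiseLast (EYM.inv (g₀ x + h x)) (christoffelVar (g₀ x) (h x)) z i i m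
        * raiseLast (EYM.inv (g₀ x + h x)) (christoffelVar (g₀ x) (h x)) z m l j
      - raiseLast (EYM.inv (g₀ x + h x)) (christoffelVar (g₀ x) (h x)) z i l m
        * raiseLast (EYM.inv (g₀ x + h x)) (christoffelVar (g₀ x) (h x)) z m i j) :=
    JetO.sum fun i => JetO.sum fun m =>
      ((hC i i m).left.pred.mul (hC m l j).left.pred).sub
        ((hC i l m).left.pred.mul (hC m i j).left.pred)
  -- The error has two sources: raising the index with the inverse of `g₀ + h` instead of that of
  -- `g₀` in the linear part, and the part quadratic in `C`.
  refine IsBigO.congr' (hP.add hCC) (eventually_principal.2 fun x hx => ?_) EventuallyEq.rfl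
  have hev : ∀ᶠ z in 𝓝 (𝒥.pt x), ∀ a i j, EYM.christoffel (g₀ x + h x) z a i j =
      EYM.christoffel (g₀ x) z a i j
        + raiseLast (EYM.inv (g₀ x + h x)) (christoffelVar (g₀ x) (h x)) z a i j := by
    filter_upwards [(hm₀ x hx).eventually (by simp), (hm x hx).eventually (by simp)] with z h1 h2
    exact fun a i j => christoffel_add h1 one_le_two (h2.of_le one_le_two) a i j
  simp only [ricci_add hev (fun a i j => (hΓ a i j).differentiableAt hx)
    (fun a i j => (hC a i j).left.differentiableAt hx) j l]
  ring

end JetGeometry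

/-! ### Linearity of the blocks, uniform invertibility, and jets along rays. -/

section Linearity

variable {n : ℕ} {F : Type*} [NormedAddCommGroup F] [NormedSpace ℝ F]
  {𝔩 : Type*} [NormedAddCommGroup 𝔩] [NormedSpace ℝ 𝔩] {y : Vec n}

theorem cov2_add (g : Cov2 n ℝ) {h h' h'' : Cov2 n F}
    (he : ∀ᶠ z in 𝓝 y, ∀ i j, h'' z i j = h z i j + h' z i j)
    (hh : ∀ i j, DifferentiableAt ℝ (fun z => h z i j) y)
    (hh' : ∀ i j, DifferentiableAt ℝ (fun z => h' z i j) y) (i j l : Fin (n + 1)) :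
    cov2 g h'' y i j l = cov2 g h y i j l + cov2 g h' y i j l := by
  have hp : pd i (fun z => h'' z j l) y = pd i (fun z => h z j l) y + pd i (fun z => h' z j l) y := by
    rw [← pd_add (hh j l) (hh' j l)]
    exact pd_congr (he.mono fun z hz => hz j l) i
  simp only [cov2, hp, he.self_of_nhds, smul_add, Finset.sum_add_distrib]
  abel

theorem cov1_smul (g : Cov2 n ℝ) (c : ℝ) (a : Cov1 n F) (y : Vec n) (i j : Fin (n + 1)) :
    cov1 g (fun z i => c • a z i) y i j = c • cov1 g a y i j := by
  simp only [cov1, pd_const_smul, smul_sub, Finset.smul_sum, smul_comm c]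

theorem cov2_smul (g : Cov2 n ℝ) (c : ℝ) (h : Cov2 n F) (y : Vec n) (i j l : Fin (n + 1)) :
    cov2 g (fun z i j => c • h z i j) y i j l = c • cov2 g h y i j l := by
  simp only [cov2, pd_const_smul, smul_sub, Finset.smul_sum, smul_comm c]

theorem deltaStar_bianchi_smul (g h : Cov2 n ℝ) (c : ℝ) (y : Vec n) (i j : Fin (n + 1)) :
    deltaStar g (bianchi g (c • h)) y i j = c * deltaStar g (bianchi g h) y i j := by
  have htr : trace g (c • h) = fun z => c * trace g h z := by
    funext z
    simp only [trace, Pi.smul_apply, smul_eq_mul, Finset.mul_sum, mul_left_comm c]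
  have hb : bianchi g (c • h) = fun z j => c • bianchi g h z j := by
    funext z j
    simp only [bianchi, htr, pd_const_mul, divergence]
    rw [show (c • h) = fun z i j => c • h z i j from rfl]
    simp only [cov2_smul]
    simp only [smul_eq_mul, mul_left_comm _ c, ← Finset.mul_sum]
    ring
  simp only [deltaStar, hb, cov1_smul]
  simp only [smul_eq_mul]
  ring

/-- The linearization of the Ricci tensor at `g` in the direction `h`. -/
noncomputable def ricciVar (g h : Cov2 n ℝ) : Cov2 n ℝ :=
  ricciPolar (christoffel g) (raiseLast (inv g) (christoffelVar g h))

theorem ricciVar_smul (g h : Cov2 n ℝ) (c : ℝ) (y : Vec n) (j l : Fin (n + 1)) :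
    ricciVar g (c • h) y j l = c * ricciVar g h y j l := by
  have hC : raiseLast (inv g) (christoffelVar g (c • h)) =
      fun z a i j => c * raiseLast (inv g) (christoffelVar g h) z a i j := by
    funext z a i j
    simp only [raiseLast, christoffelVar, Finset.mul_sum]
    rw [show (c • h) = fun z i j => c • h z i j from rfl]
    simp only [cov2_smul]
    simp only [smul_eq_mul]
    exact Finset.sum_congr rfl fun _ _ => by ring
  simp only [ricciVar, hC, ricciPolar, pd_const_mul]
  rw [Finset.mul_sum]
  refine Finset.sum_congr rfl fun i _ => ?_
  rw [mul_add, mul_sub, Finset.mul_sum]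
  congr 1
  exact Finset.sum_congr rfl fun m _ => by ring

theorem IsMetricAt.differentiableAt_raiseLast {g h : Cov2 n ℝ} (hg : IsMetricAt 2 g y)
    (hh : ∀ i j, ContDiffAt ℝ 2 (fun z => h z i j) y) (a i j : Fin (n + 1)) :
    DifferentiableAt ℝ (fun z => raiseLast (inv g) (christoffelVar g h) z a i j) y := by
  have hT := hg.differentiableAt_cov2 le_rfl hh
  exact DifferentiableAt.fun_sum fun b _ =>
    ((hg.contDiffAt_inv a b).differentiableAt two_ne_zero).fun_mul
      ((((hT _ _ _).fun_add (hT _ _ _)).fun_sub (hT _ _ _)).const_mul _)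

theorem IsMetricAt.ricciVar_add {g h h' : Cov2 n ℝ} (hg : IsMetricAt 2 g y)
    (hh : ∀ i j, ContDiffAt ℝ 2 (fun z => h z i j) y)
    (hh' : ∀ i j, ContDiffAt ℝ 2 (fun z => h' z i j) y) (j l : Fin (n + 1)) :
    ricciVar g (h + h') y j l = ricciVar g h y j l + ricciVar g h' y j l := by
  set C := raiseLast (inv g) (christoffelVar g h)
  set C' := raiseLast (inv g) (christoffelVar g h')
  have he : ∀ᶠ z in 𝓝 y, ∀ a i j, raiseLast (inv g) (christoffelVar g (h + h')) z a i j =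
      C z a i j + C' z a i j := by
    have h1 : ∀ᶠ z in 𝓝 y, ∀ a b, ContDiffAt ℝ 2 (fun z => h z a b) z :=
      eventually_all.2 fun a => eventually_all.2 fun b => (hh a b).eventually (by simp)
    have h2 : ∀ᶠ z in 𝓝 y, ∀ a b, ContDiffAt ℝ 2 (fun z => h' z a b) z :=
      eventually_all.2 fun a => eventually_all.2 fun b => (hh' a b).eventually (by simp)
    filter_upwards [h1, h2] with z h1 h2 a i j
    have := fun i j l => cov2_add (y := z) g (h := h) (h' := h') (h'' := h + h')
      (Eventually.of_forall fun _ _ _ => rfl) (fun i j => (h1 i j).differentiableAt two_ne_zero)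
      (fun i j => (h2 i j).differentiableAt two_ne_zero) i j l
    simp only [C, C', raiseLast, christoffelVar, this, ← Finset.sum_add_distrib]
    exact Finset.sum_congr rfl fun _ _ => by ring
  have hp : ∀ b a i j, pd b (fun z => raiseLast (inv g) (christoffelVar g (h + h')) z a i j) y =
      pd b (fun z => C z a i j) y + pd b (fun z => C' z a i j) y := fun b a i j => by
    rw [← pd_add (hg.differentiableAt_raiseLast hh a i j) (hg.differentiableAt_raiseLast hh' a i j)]
    exact pd_congr (he.mono fun z hz => hz a i j) b
  simp only [ricciVar, ricciPolar, hp, he.self_of_nhds, ← Finset.sum_add_distrib]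
  refine Finset.sum_congr rfl fun i _ => ?_
  rw [add_add_add_comm, ← Finset.sum_add_distrib, add_sub_add_comm]
  congr 1
  exact Finset.sum_congr rfl fun m _ => by ring

/-- The metric block in terms of the linearized Ricci tensor. -/
theorem metricBlock_eq {g Θ A : Cov2 n ℝ} (hg : IsMetricAt 2 g y)
    (hΘs : ∀ z i j, Θ z i j = Θ z j i) (hAs : ∀ z i j, A z i j = A z j i)
    (hΘ : ∀ i j, ContDiffAt ℝ 2 (fun z => Θ z i j) y)
    (hA : ∀ i j, ContDiffAt ℝ 2 (fun z => A z i j) y) (i j : Fin (n + 1)) :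
    (1 / 2 : ℝ) * (einsteinLin g Θ y i j + lichN g A y i j) =
      ricciVar g Θ y i j + ricciVar g A y i j + n * (Θ y i j + A y i j)
        + deltaStar g (bianchi g A) y i j := by
  -- The Lie derivative in `einsteinLin` accounts for the term `-δ^* B Θ` of the linearized Ricci
  -- tensor, whereas the corresponding term for `A` is cancelled by the explicit `δ^* B A`.
  rw [ricciVar, ricciVar, hg.ricciPolar_eq hΘs hΘ, hg.ricciPolar_eq hAs hA, einsteinLin,
    hg.lieDeriv_sharp one_le_two (hg.differentiableAt_bianchi hΘ), lichN, lichN]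
  ring

theorem dStar2_add (B : 𝔩 →L[ℝ] 𝔩 →L[ℝ] 𝔩) (g : Cov2 n ℝ) (ϖ : Cov1 n 𝔩) {Φ Φ' Φ'' : Cov2 n 𝔩}
    (he : ∀ᶠ z in 𝓝 y, ∀ i j, Φ'' z i j = Φ z i j + Φ' z i j)
    (hh : ∀ i j, DifferentiableAt ℝ (fun z => Φ z i j) y)
    (hh' : ∀ i j, DifferentiableAt ℝ (fun z => Φ' z i j) y) (j : Fin (n + 1)) :
    dStar2 (fun u v => B u v) g ϖ Φ'' y j =
      dStar2 (fun u v => B u v) g ϖ Φ y j + dStar2 (fun u v => B u v) g ϖ Φ' y j := by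
  simp only [dStar2, cov2_add g he hh hh', he.self_of_nhds, map_add, ← neg_add,
    ← Finset.sum_add_distrib, ← smul_add, add_add_add_comm]

theorem dCov1_add (B : 𝔩 →L[ℝ] 𝔩 →L[ℝ] 𝔩) (ϖ : Cov1 n 𝔩) {a a' : Cov1 n 𝔩}
    (ha : ∀ i, DifferentiableAt ℝ (fun z => a z i) y)
    (ha' : ∀ i, DifferentiableAt ℝ (fun z => a' z i) y) (i j : Fin (n + 1)) :
    dCov1 (fun u v => B u v) ϖ (a + a') y i j =
      dCov1 (fun u v => B u v) ϖ a y i j + dCov1 (fun u v => B u v) ϖ a' y i j := by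
  simp only [dCov1, Pi.add_apply, pd_add (ha _) (ha' _), map_add]
  abel

theorem dCov1_smul (B : 𝔩 →L[ℝ] 𝔩 →L[ℝ] 𝔩) (ϖ : Cov1 n 𝔩) (c : ℝ) (a : Cov1 n 𝔩) :
    dCov1 (fun u v => B u v) ϖ (c • a) = fun z i j => c • dCov1 (fun u v => B u v) ϖ a z i j := by
  funext z i j
  simp only [dCov1, Pi.smul_apply, pd_const_smul, map_smul, smul_sub, smul_add]

theorem dStar2_dCov1_smul (B : 𝔩 →L[ℝ] 𝔩 →L[ℝ] 𝔩) (g : Cov2 n ℝ) (ϖ : Cov1 n 𝔩) (c : ℝ)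
    (a : Cov1 n 𝔩) (y : Vec n) (j : Fin (n + 1)) :
    dStar2 (fun u v => B u v) g ϖ (dCov1 (fun u v => B u v) ϖ (c • a)) y j =
      c • dStar2 (fun u v => B u v) g ϖ (dCov1 (fun u v => B u v) ϖ a) y j := by
  rw [dCov1_smul]
  simp only [dStar2, cov2_smul, map_smul, ← smul_add, smul_comm _ c, ← Finset.smul_sum, smul_neg]

theorem hodge1_smul (B : 𝔩 →L[ℝ] 𝔩 →L[ℝ] 𝔩) (g : Cov2 n ℝ) (ϖ : Cov1 n 𝔩) (c : ℝ)
    (a : Cov1 n 𝔩) (y : Vec n) (j : Fin (n + 1)) :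
    hodge1 (fun u v => B u v) g ϖ (c • a) y j = c • hodge1 (fun u v => B u v) g ϖ a y j := by
  have h : dStar1 (fun u v => B u v) g ϖ (c • a) =
      fun z => c • dStar1 (fun u v => B u v) g ϖ a z := by
    funext z
    simp only [dStar1]
    rw [show (c • a) = fun z i => c • a z i from rfl]
    simp only [cov1_smul, map_smul, ← smul_add, smul_comm _ c, ← Finset.smul_sum, smul_neg]
  simp only [hodge1, dStar2_dCov1_smul, h, dCov0, pd_const_smul, map_smul, smul_add]

/-- The matrices `g z`, for `z` in `K`, form a compact subset of the open set of invertible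
matrices. Some closed thickening of it is still contained there and is compact, so the continuous
inverse is bounded on it. The norm on functions is the sup norm, so an entrywise bound on `h`
suffices. -/
theorem exists_inv_bound {g : Cov2 n ℝ} {K : Set (Vec n)} (hK : IsCompact K)
    (hg : ∀ i j, ContinuousOn (fun z => g z i j) K)
    (hdet : ∀ z ∈ K, (Matrix.of (g z)).det ≠ 0) :
    ∃ ρ > 0, ∃ C, ∀ z ∈ K, ∀ h : Fin (n + 1) → Fin (n + 1) → ℝ, (∀ i j, |h i j| ≤ ρ) →
      (Matrix.of (g z + h)).det ≠ 0 ∧ ∀ i j, |(Matrix.of (g z + h))⁻¹ i j| ≤ C := by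
  set V : Set (Fin (n + 1) → Fin (n + 1) → ℝ) := {A | (Matrix.of A).det ≠ 0}
  have hcont : Continuous fun A : Fin (n + 1) → Fin (n + 1) → ℝ => Matrix.of A := continuous_id
  have hV : IsOpen V := isOpen_ne.preimage hcont.matrix_det
  have hK' : IsCompact (g '' K) := hK.image_of_continuousOn
    (continuousOn_pi.2 fun i => continuousOn_pi.2 fun j => hg i j)
  obtain ⟨δ, hδ, hsub⟩ := hK'.exists_cthickening_subset_open hV (by
    rintro _ ⟨z, hz, rfl⟩; exact hdet z hz)
  have hinv : ContinuousOn (fun A : Fin (n + 1) → Fin (n + 1) → ℝ =>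
      fun i j => (Matrix.of A)⁻¹ i j) V := by
    refine continuousOn_pi.2 fun i => continuousOn_pi.2 fun j => ?_
    simp only [Matrix.inv_def, Ring.inverse_eq_inv', Matrix.smul_apply, smul_eq_mul]
    exact (hcont.matrix_det.continuousOn.inv₀ fun A hA => hA).mul
      (hcont.matrix_adjugate.matrix_elem i j).continuousOn
  obtain ⟨C, hC⟩ := hK'.cthickening.exists_bound_of_continuousOn (hinv.mono hsub)
  refine ⟨δ, hδ, C, fun z hz h hh => ?_⟩
  have hmem : g z + h ∈ Metric.cthickening δ (g '' K) := by
    refine Metric.mem_cthickening_of_dist_le _ _ _ _ ⟨z, hz, rfl⟩ ?_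
    rw [dist_eq_norm, add_sub_cancel_left]
    exact (pi_norm_le_iff_of_nonneg hδ.le).2 fun i =>
      (pi_norm_le_iff_of_nonneg hδ.le).2 fun j => hh i j
  refine ⟨hsub hmem, fun i j => ?_⟩
  have h1 := norm_le_pi_norm (fun i j => (Matrix.of (g z + h))⁻¹ i j) i
  have h2 := norm_le_pi_norm (fun j => (Matrix.of (g z + h))⁻¹ i j) j
  exact (h2.trans h1).trans (hC _ hmem)

/-- The bound at `t = 0` already forces `f 0 = 0`, so `f` needs no separate value there. -/
theorem hasDerivAt_of_quadratic {f : ℝ → F} {L : F} {C δ : ℝ} (hδ : 0 < δ)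
    (h : ∀ t, |t| ≤ δ → ‖f t - t • L‖ ≤ C * t ^ 2) : HasDerivAt f L 0 := by
  have h0 : f 0 = 0 := by
    have := h 0 (by simpa using hδ.le)
    simpa using this
  rw [hasDerivAt_iff_isLittleO_nhds_zero]
  have h1 : (fun t : ℝ => f (0 + t) - f 0 - t • L) =O[𝓝 0] fun t : ℝ => t ^ 2 := by
    refine IsBigO.of_bound C ?_
    filter_upwards [Metric.closedBall_mem_nhds (0 : ℝ) hδ] with t ht
    rw [zero_add, h0, sub_zero, Real.norm_of_nonneg (sq_nonneg t)]
    exact h t (by simpa using ht)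
  exact h1.trans_isLittleO (by simpa using isLittleO_pow_pow (𝕜 := ℝ) (m := 1) (n := 2) one_lt_two)

theorem exists_jetBound2 (h : Cov2 n ℝ) (y : Vec n) : ∃ b, JetBound2 h y b := by
  obtain ⟨b₀, h₀⟩ := Finite.exists_le fun s : Fin (n + 1) × Fin (n + 1) => |h y s.1 s.2|
  obtain ⟨b₁, h₁⟩ := Finite.exists_le fun s : Fin (n + 1) × Fin (n + 1) × Fin (n + 1) =>
    |pd s.2.2 (fun z => h z s.1 s.2.1) y|
  obtain ⟨b₂, h₂⟩ := Finite.exists_le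
    fun s : Fin (n + 1) × Fin (n + 1) × Fin (n + 1) × Fin (n + 1) =>
    |pd s.2.2.1 (pd s.2.2.2 (fun z => h z s.1 s.2.1)) y|
  refine ⟨max b₀ (max b₁ b₂), fun i j => ⟨le_max_of_le_left (h₀ (i, j)), fun k =>
    le_max_of_le_right (le_max_of_le_left (h₁ (i, j, k))), fun k l =>
    le_max_of_le_right (le_max_of_le_right (h₂ (i, j, k, l)))⟩⟩

theorem exists_jetBound1 (a : Cov1 n 𝔩) (y : Vec n) : ∃ b, JetBound1 a y b := by
  obtain ⟨b₀, h₀⟩ := Finite.exists_le fun i : Fin (n + 1) => ‖a y i‖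
  obtain ⟨b₁, h₁⟩ := Finite.exists_le fun s : Fin (n + 1) × Fin (n + 1) =>
    ‖pd s.2 (fun z => a z s.1) y‖
  obtain ⟨b₂, h₂⟩ := Finite.exists_le fun s : Fin (n + 1) × Fin (n + 1) × Fin (n + 1) =>
    ‖pd s.2.1 (pd s.2.2 (fun z => a z s.1)) y‖
  refine ⟨max b₀ (max b₁ b₂), fun i => ⟨le_max_of_le_left (h₀ i), fun k =>
    le_max_of_le_right (le_max_of_le_left (h₁ (i, k))), fun k l =>
    le_max_of_le_right (le_max_of_le_right (h₂ (i, k, l)))⟩⟩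

theorem JetBound2.mono {h : Cov2 n ℝ} {b c : ℝ} (hb : JetBound2 h y b) (hc : b ≤ c) :
    JetBound2 h y c := fun i j =>
  ⟨(hb i j).1.trans hc, fun k => ((hb i j).2.1 k).trans hc, fun k l => ((hb i j).2.2 k l).trans hc⟩

theorem JetBound1.mono {a : Cov1 n 𝔩} {b c : ℝ} (hb : JetBound1 a y b) (hc : b ≤ c) :
    JetBound1 a y c := fun i =>
  ⟨(hb i).1.trans hc, fun k => ((hb i).2.1 k).trans hc, fun k l => ((hb i).2.2 k l).trans hc⟩

theorem pd_pd_const_smul (c : ℝ) (f : Vec n → F) (y : Vec n) (k l : Fin (n + 1)) :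
    pd k (pd l fun z => c • f z) y = c • pd k (pd l f) y := by
  rw [← pd_const_smul]
  exact pd_congr (Eventually.of_forall fun z => pd_const_smul c f l) k

theorem JetBound1.smul {a : Cov1 n 𝔩} {b : ℝ} (hb : JetBound1 a y b) (t : ℝ) :
    JetBound1 (t • a) y (|t| * b) := fun i => by
  simp only [Pi.smul_apply, pd_const_smul, pd_pd_const_smul, norm_smul, Real.norm_eq_abs]
  exact ⟨mul_le_mul_of_nonneg_left (hb i).1 (abs_nonneg t), fun k =>
    mul_le_mul_of_nonneg_left ((hb i).2.1 k) (abs_nonneg t), fun k l =>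
    mul_le_mul_of_nonneg_left ((hb i).2.2 k l) (abs_nonneg t)⟩

theorem JetBound2.smul {h : Cov2 n ℝ} {b : ℝ} (hb : JetBound2 h y b) (t : ℝ) :
    JetBound2 (t • h) y (|t| * b) := fun i j => by
  simp only [Pi.smul_apply, pd_const_smul, pd_pd_const_smul]
  simp only [smul_eq_mul, abs_mul]
  exact ⟨mul_le_mul_of_nonneg_left (hb i j).1 (abs_nonneg t), fun k =>
    mul_le_mul_of_nonneg_left ((hb i j).2.1 k) (abs_nonneg t), fun k l =>
    mul_le_mul_of_nonneg_left ((hb i j).2.2 k l) (abs_nonneg t)⟩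

end Linearity

/-! ### The quadratic remainder estimate in coordinates. -/

section LocalRemainder

variable {n : ℕ} {𝔩 : Type*} [NormedAddCommGroup 𝔩] [NormedSpace ℝ 𝔩]

/-- `(g, ϖ)` are the components on `U` of a smooth Einstein metric and of a smooth flat
connection. -/
structure IsTrivialOn (B : 𝔩 →L[ℝ] 𝔩 →L[ℝ] 𝔩) (g : Cov2 n ℝ) (ϖ : Cov1 n 𝔩) (U : Set (Vec n)) :
    Prop where
  isOpen : IsOpen U
  symm : ∀ z i j, g z i j = g z j i
  smooth : ∀ z ∈ U, ∀ i j, ContDiffAt ℝ ∞ (fun w => g w i j) z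
  det_ne : ∀ z ∈ U, (Matrix.of (g z)).det ≠ 0
  einstein : ∀ z ∈ U, ∀ i j, ricci g z i j = -(n : ℝ) * g z i j
  smooth_conn : ∀ z ∈ U, ∀ i, ContDiffAt ℝ ∞ (fun w => ϖ w i) z
  flat : ∀ z ∈ U, ∀ i j, ymCurv (fun u v => B u v) ϖ z i j = 0

theorem IsTrivialOn.isMetricAt {B : 𝔩 →L[ℝ] 𝔩 →L[ℝ] 𝔩} {g : Cov2 n ℝ} {ϖ : Cov1 n 𝔩}
    {U : Set (Vec n)} (h : IsTrivialOn B g ϖ U) {y : Vec n} (hy : y ∈ U) : IsMetricAt 2 g y :=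
  ⟨h.symm, fun i j => (h.smooth y hy i j).of_le (by norm_cast), h.det_ne y hy⟩

/-- A perturbation `(Θ, A; ε, a)` of a metric and a connection, a base point and a size. -/
structure Perturbation (n : ℕ) (𝔩 : Type*) where
  /-- First metric perturbation. -/
  Θ : Cov2 n ℝ
  /-- Second metric perturbation. -/
  A : Cov2 n ℝ
  /-- First perturbation of the connection. -/
  ε : Cov1 n 𝔩
  /-- Second perturbation of the connection. -/
  a : Cov1 n 𝔩
  /-- Base point. -/
  y : Vec n
  /-- Size. -/
  r : ℝ

/-- The perturbation is symmetric, of class `C^2` near its base point, and the 2-jet there is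
bounded by its size. -/
structure Perturbation.IsAdmissible (x : Perturbation n 𝔩) : Prop where
  symm_Θ : ∀ z i j, x.Θ z i j = x.Θ z j i
  symm_A : ∀ z i j, x.A z i j = x.A z j i
  smooth_Θ : ∀ i j, ContDiffAt ℝ 2 (fun z => x.Θ z i j) x.y
  smooth_A : ∀ i j, ContDiffAt ℝ 2 (fun z => x.A z i j) x.y
  smooth_ε : ∀ i, ContDiffAt ℝ 2 (fun z => x.ε z i) x.y
  smooth_a : ∀ i, ContDiffAt ℝ 2 (fun z => x.a z i) x.y
  bound_Θ : JetBound2 x.Θ x.y x.r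
  bound_A : JetBound2 x.A x.y x.r
  bound_ε : JetBound1 x.ε x.y x.r
  bound_a : JetBound1 x.a x.y x.r

/-- The admissible perturbations of size at most `min ρ 1`, based at points of `K`. -/
def perturbationParam (n : ℕ) (𝔩 : Type*) [NormedAddCommGroup 𝔩] [NormedSpace ℝ 𝔩]
    (K : Set (Vec n)) (ρ : ℝ) : JetParam n (Perturbation n 𝔩) where
  S := {x | x.IsAdmissible ∧ x.y ∈ K ∧ x.r ≤ ρ ∧ x.r ≤ 1}
  r := Perturbation.r
  pt := Perturbation.y
  r_nonneg := fun _ hx => (abs_nonneg _).trans (hx.1.bound_Θ 0 0).1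
  r_le_one := fun _ hx => hx.2.2.2

theorem jetO_of_jetBound {X F : Type*} [NormedAddCommGroup F] [NormedSpace ℝ F] {𝒥 : JetParam n X}
    {f : X → Vec n → F} (hf : ∀ x ∈ 𝒥.S, ContDiffAt ℝ 2 (f x) (𝒥.pt x))
    (h0 : ∀ x ∈ 𝒥.S, ‖f x (𝒥.pt x)‖ ≤ 𝒥.r x) (h1 : ∀ x ∈ 𝒥.S, ∀ i, ‖pd i (f x) (𝒥.pt x)‖ ≤ 𝒥.r x)
    (h2 : ∀ x ∈ 𝒥.S, ∀ i j, ‖pd i (pd j (f x)) (𝒥.pt x)‖ ≤ 𝒥.r x) : JetO 𝒥 2 1 f := by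
  have key : ∀ e : X → Vec n → F, (∀ x ∈ 𝒥.S, ‖e x (𝒥.pt x)‖ ≤ 𝒥.r x) →
      (fun x => e x (𝒥.pt x)) =O[𝓟 𝒥.S] fun x => 𝒥.r x ^ 1 := fun e he =>
    IsBigO.of_bound 1 <| eventually_principal.2 fun x hx => by
      rw [one_mul, pow_one, Real.norm_of_nonneg (𝒥.r_nonneg x hx)]
      exact he x hx
  exact ⟨key _ h0, fun x hx => hf x hx, fun j => ⟨key _ fun x hx => h1 x hx j,
    fun x hx => contDiffAt_pd (hf x hx) (by norm_num) j, fun i => key _ fun x hx => h2 x hx i j⟩⟩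

/-- The core of the proof. All admissible perturbations based in `K` are treated as one family, so
that a single pass through the definitions of the operators gives constants independent of the
perturbation and of the base point. -/
theorem exists_quadratic_bound {B : 𝔩 →L[ℝ] 𝔩 →L[ℝ] 𝔩} (hB : ∀ u v, B u v = -B v u)
    (q : 𝔩 →L[ℝ] 𝔩 →L[ℝ] ℝ) {g : Cov2 n ℝ} {ϖ : Cov1 n 𝔩} {U : Set (Vec n)}
    (hc : IsTrivialOn B g ϖ U) {K : Set (Vec n)} (hK : IsCompact K) (hKU : K ⊆ U) :
    ∃ ρ > 0, ∃ C : ℝ, ∀ x : Perturbation n 𝔩, x.IsAdmissible → x.y ∈ K → x.r ≤ ρ →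
      (∀ i j, |opQ (fun u v => B u v) q g x.Θ x.A ϖ x.ε x.a x.y i j
        - (1 / 2 : ℝ) * (einsteinLin g x.Θ x.y i j + lichN g x.A x.y i j)| ≤ C * x.r ^ 2) ∧
      (∀ i, ‖opR (fun u v => B u v) g x.Θ x.A ϖ x.ε x.a x.y i
        - (dStar2 (fun u v => B u v) g ϖ (dCov1 (fun u v => B u v) ϖ x.ε) x.y i
          + hodge1 (fun u v => B u v) g ϖ x.a x.y i)‖ ≤ C * x.r ^ 2) ∧
      ∀ i j, |stressMod (fun u v => B u v) q (g + x.Θ + x.A) (ϖ + x.ε + x.a) x.y i j|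
        ≤ C * x.r ^ 2 := by
  obtain ⟨ρ, hρ, Ci, hCi⟩ := exists_inv_bound (g := g) hK
    (fun i j z hz => (hc.smooth z (hKU hz) i j).continuousAt.continuousWithinAt)
    (fun z hz => hc.det_ne z (hKU hz))
  -- Half of `ρ`, because the entries of `Θ + A` are only bounded by `2r`.
  set 𝒥 := perturbationParam n 𝔩 K (ρ / 2)
  have hS : ∀ x ∈ 𝒥.S, x.IsAdmissible := fun x hx => hx.1
  have hpt : ∀ x, 𝒥.pt x = x.y := fun _ => rfl
  have hyK : ∀ x ∈ 𝒥.S, 𝒥.pt x ∈ K := fun x hx => hx.2.1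
  have hyU : ∀ x ∈ 𝒥.S, x.y ∈ U := fun x hx => hKU hx.2.1
  have hr : ∀ x ∈ 𝒥.S, x.r ≤ ρ / 2 := fun x hx => hx.2.2.1
  have hg₀ : ∀ i j, JetO 𝒥 2 0 fun _ z => g z i j := fun i j =>
    JetO.of_contDiffAt hK hKU hyK (fun z hz => hc.smooth z hz i j) 2
  have hϖ₀ : ∀ i, JetO 𝒥 2 0 fun _ z => ϖ z i := fun i =>
    JetO.of_contDiffAt hK hKU hyK (fun z hz => hc.smooth_conn z hz i) 2
  have hΘ : ∀ i j, JetO 𝒥 2 1 fun x z => x.Θ z i j := fun i j =>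
    jetO_of_jetBound (fun x hx => (hS x hx).smooth_Θ i j)
      (fun x hx => ((hS x hx).bound_Θ i j).1) (fun x hx => ((hS x hx).bound_Θ i j).2.1)
      (fun x hx => ((hS x hx).bound_Θ i j).2.2)
  have hA : ∀ i j, JetO 𝒥 2 1 fun x z => x.A z i j := fun i j =>
    jetO_of_jetBound (fun x hx => (hS x hx).smooth_A i j)
      (fun x hx => ((hS x hx).bound_A i j).1) (fun x hx => ((hS x hx).bound_A i j).2.1)
      (fun x hx => ((hS x hx).bound_A i j).2.2)
  have hε : ∀ i, JetO 𝒥 2 1 fun x z => x.ε z i := fun i =>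
    jetO_of_jetBound (fun x hx => (hS x hx).smooth_ε i)
      (fun x hx => ((hS x hx).bound_ε i).1) (fun x hx => ((hS x hx).bound_ε i).2.1)
      (fun x hx => ((hS x hx).bound_ε i).2.2)
  have ha : ∀ i, JetO 𝒥 2 1 fun x z => x.a z i := fun i =>
    jetO_of_jetBound (fun x hx => (hS x hx).smooth_a i)
      (fun x hx => ((hS x hx).bound_a i).1) (fun x hx => ((hS x hx).bound_a i).2.1)
      (fun x hx => ((hS x hx).bound_a i).2.2)
  -- the metrics `g + Θ` and `g + Θ + A`
  have hΘr : ∀ x ∈ 𝒥.S, ∀ i j, |x.Θ x.y i j| ≤ ρ := fun x hx i j => by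
    linarith [((hS x hx).bound_Θ i j).1, hr x hx]
  have hΘAr : ∀ x ∈ 𝒥.S, ∀ i j, |(x.Θ x.y + x.A x.y) i j| ≤ ρ := fun x hx i j => by
    have := abs_add_le (x.Θ x.y i j) (x.A x.y i j)
    simp only [Pi.add_apply]
    linarith [((hS x hx).bound_Θ i j).1, ((hS x hx).bound_A i j).1, hr x hx]
  have hm₀ : ∀ x ∈ 𝒥.S, IsMetricAt 2 g x.y := fun x hx => hc.isMetricAt (hyU x hx)
  have hm₁ : ∀ x ∈ 𝒥.S, IsMetricAt 2 (g + x.Θ) x.y := fun x hx =>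
    ⟨fun z i j => by simp only [Pi.add_apply, hc.symm z i j, (hS x hx).symm_Θ z i j],
      fun i j => ((hm₀ x hx).smooth i j).add ((hS x hx).smooth_Θ i j),
      (hCi x.y hx.2.1 (x.Θ x.y) (hΘr x hx)).1⟩
  have hm₂ : ∀ x ∈ 𝒥.S, IsMetricAt 2 (g + (x.Θ + x.A)) x.y := fun x hx =>
    ⟨fun z i j => by
      simp only [Pi.add_apply, hc.symm z i j, (hS x hx).symm_Θ z i j, (hS x hx).symm_A z i j],
      fun i j => ((hm₀ x hx).smooth i j).add
        (((hS x hx).smooth_Θ i j).add ((hS x hx).smooth_A i j)),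
      (hCi x.y hx.2.1 (x.Θ x.y + x.A x.y) (hΘAr x hx)).1⟩
  have hg₁ : ∀ i j, JetClose 𝒥 2 0 (fun x z => (g + x.Θ) z i j) (fun _ z => g z i j) :=
    fun i j => JetClose.of_add (hg₀ i j) (hΘ i j)
  have hg₂ : ∀ i j, JetClose 𝒥 2 0 (fun x z => (g + (x.Θ + x.A)) z i j) (fun _ z => g z i j) :=
    fun i j => JetClose.of_add (hg₀ i j) ((hΘ i j).add (hA i j))
  have hbd : ∀ e : Perturbation n 𝔩 → ℝ, (∀ x ∈ 𝒥.S, |e x| ≤ Ci) →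
      e =O[𝓟 𝒥.S] fun x => 𝒥.r x ^ 0 := fun e he =>
    IsBigO.of_bound Ci <| eventually_principal.2 fun x hx => by simpa using he x hx
  have hG₀b : ∀ i j, JetO 𝒥 0 0 fun _ z => inv g z i j := fun i j => hbd _ fun x hx => by
    simpa [hpt, inv] using (hCi x.y hx.2.1 0 (fun i j => by simpa using hρ.le)).2 i j
  have hG₁b : ∀ i j, JetO 𝒥 0 0 fun x z => inv (g + x.Θ) z i j := fun i j => hbd _ fun x hx =>
    (hCi x.y hx.2.1 (x.Θ x.y) (hΘr x hx)).2 i j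
  have hG₂b : ∀ i j, JetO 𝒥 0 0 fun x z => inv (g + (x.Θ + x.A)) z i j := fun i j =>
    hbd _ fun x hx => (hCi x.y hx.2.1 (x.Θ x.y + x.A x.y) (hΘAr x hx)).2 i j
  have hG₁ := JetClose.inv hg₁ (fun x hx => ((hm₁ x hx).of_le zero_le_two).smooth)
    (fun x hx => ((hm₀ x hx).of_le zero_le_two).smooth) (fun x hx => (hm₁ x hx).det_ne)
    (fun x hx => (hm₀ x hx).det_ne) hG₁b hG₀b
  have hG₂ := JetClose.inv hg₂ (fun x hx => ((hm₂ x hx).of_le zero_le_two).smooth)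
    (fun x hx => ((hm₀ x hx).of_le zero_le_two).smooth) (fun x hx => (hm₂ x hx).det_ne)
    (fun x hx => (hm₀ x hx).det_ne) hG₂b hG₀b
  have hΓ₁ := JetClose.christoffel hg₁ fun i j => (hG₁ i j).pred
  have hΓ₂ := JetClose.christoffel hg₂ fun i j => (hG₂ i j).pred
  -- the connections `ϖ + ε` and `ϖ + ε + a`
  have hϖ₁ : ∀ i, JetClose 𝒥 2 0 (fun x z => (ϖ + x.ε) z i) (fun _ z => ϖ z i) :=
    fun i => JetClose.of_add (hϖ₀ i) (hε i)
  have hεa : ∀ i, JetO 𝒥 2 1 fun x z => (x.ε + x.a) z i := fun i => (hε i).add (ha i)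
  have hϖ₂ : ∀ i, JetClose 𝒥 2 0 (fun x z => (ϖ + (x.ε + x.a)) z i) (fun _ z => ϖ z i) :=
    fun i => JetClose.of_add (hϖ₀ i) (hεa i)
  have hΩ : ∀ i j, JetClose 𝒥 1 1 (fun x z => ymCurv (fun u v => B u v) (ϖ + (x.ε + x.a)) z i j)
      (fun x z => dCov1 (fun u v => B u v) ϖ (x.ε + x.a) z i j) :=
    JetClose.ymCurv (ϖ := fun _ => ϖ) B hB hϖ₀ hεa fun x hx => by
      filter_upwards [hc.isOpen.mem_nhds (hyU x hx)] with z hz using hc.flat z hz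
  have hstress : ∀ i j, JetO 𝒥 0 2 fun x z => stressMod (fun u v => B u v) q
      (g + (x.Θ + x.A)) (ϖ + (x.ε + x.a)) z i j :=
    JetO.stressMod B q (fun i j => (hg₂ i j).left.pred.pred) (fun i j => (hG₂ i j).left.pred.pred)
      (fun i j => (hΩ i j).left.pred)
  -- the metric component
  have hbi : ∀ i, JetClose 𝒥 1 1 (fun x z => bianchi (g + x.Θ) x.A z i)
      (fun x z => bianchi g x.A z i) :=
    JetClose.bianchi hΓ₁ hG₁ fun i j => JetClose.refl (hA i j)
  -- The gauge term is linear in `A`, which has order `1`; changing the two metrics it uses to `g`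
  -- costs one more order.
  have hgauge := JetClose.deltaStar (fun a i j => (hΓ₂ a i j).pred) hbi
  have hric := JetO.ricci_add_sub (g₀ := fun _ => g) hm₀ hm₂ (fun a i j => (hΓ₂ a i j).right)
    (fun i j => (hG₂ i j).pred) (fun i j => (hΘ i j).add (hA i j))
  have hQ : ∀ i j, (fun x : Perturbation n 𝔩 =>
      opQ (fun u v => B u v) q g x.Θ x.A ϖ x.ε x.a x.y i j
        - (1 / 2 : ℝ) * (einsteinLin g x.Θ x.y i j + lichN g x.A x.y i j))
      =O[𝓟 𝒥.S] fun x => 𝒥.r x ^ 2 := fun i j => by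
    -- The remainder is exactly the sum of the Ricci, stress and gauge remainders once the Einstein
    -- equation cancels `Ric + n g`.
    refine (((hric i j).sub (hstress i j)).add (hgauge i j).sub).isBigO.congr'
      (eventually_principal.2 fun x hx => ?_) EventuallyEq.rfl
    have hv := (hm₀ x hx).ricciVar_add (hS x hx).smooth_Θ (hS x hx).smooth_A i j
    rw [ricciVar] at hv
    have hblock := metricBlock_eq (hm₀ x hx) (hS x hx).symm_Θ (hS x hx).symm_A (hS x hx).smooth_Θ
      (hS x hx).smooth_A i j
    simp only [hpt, hblock, opQ, add_assoc g, add_assoc ϖ, hv, hc.einstein _ (hyU x hx)]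
    simp only [Pi.add_apply]
    ring
  -- the connection component
  have hdiv := JetClose.dStar2 (fun a i j => (hΓ₂ a i j).pred) (fun i j => (hG₂ i j).pred.pred) B
    (fun i => (hϖ₂ i).pred.pred) hΩ
  have hdS := JetClose.dStar1 hΓ₁ (fun i j => (hG₁ i j).pred) B (fun i => (hϖ₁ i).pred)
    (fun i => JetClose.refl (ha i))
  have hgaugeR := JetClose.dCov0 B (fun i => (hϖ₂ i).pred.pred) hdS
  have hR : ∀ i, (fun x : Perturbation n 𝔩 =>
      opR (fun u v => B u v) g x.Θ x.A ϖ x.ε x.a x.y i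
        - (dStar2 (fun u v => B u v) g ϖ (dCov1 (fun u v => B u v) ϖ x.ε) x.y i
          + hodge1 (fun u v => B u v) g ϖ x.a x.y i))
      =O[𝓟 𝒥.S] fun x => 𝒥.r x ^ 2 := fun i => by
    -- The remainder is that of `d^* Ω` plus that of the gauge term; additivity in `ε + a` then
    -- pairs `d^* d a` with `d d^* a`.
    refine ((hdiv i).sub.add (hgaugeR i).sub).isBigO.congr'
      (eventually_principal.2 fun x hx => ?_) EventuallyEq.rfl
    have hd : ∀ i j, JetO 𝒥 1 1 fun x z => dCov1 (fun u v => B u v) ϖ x.ε z i j :=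
      JetO.dCov1 (ϖ := fun _ => ϖ) B (fun i => (hϖ₀ i).pred) hε
    have hd' : ∀ i j, JetO 𝒥 1 1 fun x z => dCov1 (fun u v => B u v) ϖ x.a z i j :=
      JetO.dCov1 (ϖ := fun _ => ϖ) B (fun i => (hϖ₀ i).pred) ha
    have he : ∀ᶠ z in 𝓝 x.y, ∀ i j, dCov1 (fun u v => B u v) ϖ (x.ε + x.a) z i j =
        dCov1 (fun u v => B u v) ϖ x.ε z i j + dCov1 (fun u v => B u v) ϖ x.a z i j := by
      have h1 : ∀ᶠ z in 𝓝 x.y, ∀ i, DifferentiableAt ℝ (fun z => x.ε z i) z :=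
        eventually_all.2 fun i => (hε i).eventually_differentiableAt hx
      have h2 : ∀ᶠ z in 𝓝 x.y, ∀ i, DifferentiableAt ℝ (fun z => x.a z i) z :=
        eventually_all.2 fun i => (ha i).eventually_differentiableAt hx
      filter_upwards [h1, h2] with z h1 h2 i j using dCov1_add B ϖ h1 h2 i j
    have hsum := dStar2_add B g ϖ he (fun i j => (hd i j).differentiableAt hx)
      (fun i j => (hd' i j).differentiableAt hx) i
    simp only [hpt, opR, hodge1, add_assoc g, add_assoc ϖ, hsum]
    abel
  -- Along a principal filter `O` is a bound by one constant on the whole parameter set, and the sup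
  -- norm merges all components.
  obtain ⟨C₁, hC₁⟩ := isBigO_principal.1 (isBigO_pi.2 fun i => isBigO_pi.2 fun j => hQ i j)
  obtain ⟨C₂, hC₂⟩ := isBigO_principal.1 (isBigO_pi.2 hR)
  obtain ⟨C₃, hC₃⟩ := isBigO_principal.1 (isBigO_pi.2 fun i => isBigO_pi.2 fun j =>
    (hstress i j).isBigO)
  refine ⟨min (ρ / 2) 1, lt_min (half_pos hρ) one_pos, max C₁ (max C₂ C₃), fun x hx hy hxr => ?_⟩
  have hxS : x ∈ 𝒥.S := ⟨hx, hy, hxr.trans (min_le_left _ _), hxr.trans (min_le_right _ _)⟩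
  have hr2 : ‖𝒥.r x ^ 2‖ = x.r ^ 2 := Real.norm_of_nonneg (sq_nonneg _)
  have k₁ := hC₁ x hxS
  have k₂ := hC₂ x hxS
  have k₃ := hC₃ x hxS
  rw [hr2] at k₁ k₂ k₃
  have hle : ∀ {c d : ℝ}, c ≤ d → c * x.r ^ 2 ≤ d * x.r ^ 2 := fun h =>
    mul_le_mul_of_nonneg_right h (sq_nonneg _)
  refine ⟨fun i j => ?_, fun i => ?_, fun i j => ?_⟩
  · exact ((norm_le_pi_norm _ j).trans ((norm_le_pi_norm _ i).trans k₁)).trans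
      (hle (le_max_left _ _))
  · exact ((norm_le_pi_norm _ i).trans k₂).trans (hle (le_max_of_le_right (le_max_left _ _)))
  · rw [add_assoc g, add_assoc ϖ]
    exact ((norm_le_pi_norm _ j).trans ((norm_le_pi_norm _ i).trans k₃)).trans
      (hle (le_max_of_le_right (le_max_right _ _)))

/-- Along a ray, the remainder is quadratic in the parameter. -/
theorem exists_quadratic_bound_ray {B : 𝔩 →L[ℝ] 𝔩 →L[ℝ] 𝔩} (hB : ∀ u v, B u v = -B v u)
    (q : 𝔩 →L[ℝ] 𝔩 →L[ℝ] ℝ) {g : Cov2 n ℝ} {ϖ : Cov1 n 𝔩} {U : Set (Vec n)}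
    (hc : IsTrivialOn B g ϖ U) {y : Vec n} (hy : y ∈ U) {Θ A : Cov2 n ℝ} {ε a : Cov1 n 𝔩}
    (hΘs : ∀ z i j, Θ z i j = Θ z j i) (hAs : ∀ z i j, A z i j = A z j i)
    (hΘ : ∀ i j, ContDiffAt ℝ 2 (fun z => Θ z i j) y)
    (hA : ∀ i j, ContDiffAt ℝ 2 (fun z => A z i j) y)
    (hε : ∀ i, ContDiffAt ℝ 2 (fun z => ε z i) y) (ha : ∀ i, ContDiffAt ℝ 2 (fun z => a z i) y) :
    ∃ δ > 0, ∃ C : ℝ, ∀ t : ℝ, |t| ≤ δ →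
      (∀ i j, ‖opQ (fun u v => B u v) q g (t • Θ) (t • A) ϖ (t • ε) (t • a) y i j
        - t • ((1 / 2 : ℝ) * (einsteinLin g Θ y i j + lichN g A y i j))‖ ≤ C * t ^ 2) ∧
      (∀ i, ‖opR (fun u v => B u v) g (t • Θ) (t • A) ϖ (t • ε) (t • a) y i
        - t • (dStar2 (fun u v => B u v) g ϖ (dCov1 (fun u v => B u v) ϖ ε) y i
          + hodge1 (fun u v => B u v) g ϖ a y i)‖ ≤ C * t ^ 2) ∧
      ∀ i j, ‖stressMod (fun u v => B u v) q (g + t • Θ + t • A) (ϖ + t • ε + t • a) y i j‖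
        ≤ C * t ^ 2 := by
  obtain ⟨ρ, hρ, C, hC⟩ := exists_quadratic_bound hB q hc (isCompact_singleton (x := y))
    (Set.singleton_subset_iff.2 hy)
  obtain ⟨b₁, hb₁⟩ := exists_jetBound2 Θ y
  obtain ⟨b₂, hb₂⟩ := exists_jetBound2 A y
  obtain ⟨b₃, hb₃⟩ := exists_jetBound1 ε y
  obtain ⟨b₄, hb₄⟩ := exists_jetBound1 a y
  set b := max 1 (max (max b₁ b₂) (max b₃ b₄))
  have hb : 0 < b := lt_of_lt_of_le one_pos (le_max_left _ _)
  have h₁ : b₁ ≤ b := le_max_of_le_right (le_max_of_le_left (le_max_left _ _))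
  have h₂ : b₂ ≤ b := le_max_of_le_right (le_max_of_le_left (le_max_right _ _))
  have h₃ : b₃ ≤ b := le_max_of_le_right (le_max_of_le_right (le_max_left _ _))
  have h₄ : b₄ ≤ b := le_max_of_le_right (le_max_of_le_right (le_max_right _ _))
  have hm := hc.isMetricAt hy
  -- The ray at parameter `t` is a perturbation of size `|t| b`, where `b` bounds the 2-jets of all
  -- four fields at `y` and is at least `1`, hence positive.
  refine ⟨ρ / b, div_pos hρ hb, C * b ^ 2, fun t ht => ?_⟩
  have hΘs' : ∀ z i j, (t • Θ) z i j = (t • Θ) z j i := fun z i j => by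
    simp only [Pi.smul_apply, hΘs z i j]
  have hAs' : ∀ z i j, (t • A) z i j = (t • A) z j i := fun z i j => by
    simp only [Pi.smul_apply, hAs z i j]
  have hΘ' : ∀ i j, ContDiffAt ℝ 2 (fun z => (t • Θ) z i j) y := fun i j => (hΘ i j).const_smul t
  have hA' : ∀ i j, ContDiffAt ℝ 2 (fun z => (t • A) z i j) y := fun i j => (hA i j).const_smul t
  obtain ⟨hQ, hR, hK⟩ := hC ⟨t • Θ, t • A, t • ε, t • a, y, |t| * b⟩
    ⟨hΘs', hAs', hΘ', hA', fun i => (hε i).const_smul t, fun i => (ha i).const_smul t,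
      (hb₁.mono h₁).smul t, (hb₂.mono h₂).smul t, (hb₃.mono h₃).smul t, (hb₄.mono h₄).smul t⟩ rfl
    ((le_div_iff₀ hb).1 ht)
  have hCt : C * (|t| * b) ^ 2 = C * b ^ 2 * t ^ 2 := by
    rw [mul_pow, sq_abs]; ring
  simp only [hCt] at hQ hR hK
  refine ⟨fun i j => ?_, fun i => ?_, hK⟩
  · have h := hQ i j
    -- Homogeneity of the metric block is read off from its expression through `ricciVar` and `δ^*
    -- B`.
    rw [metricBlock_eq hm hΘs' hAs' hΘ' hA', ricciVar_smul, ricciVar_smul,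
      deltaStar_bianchi_smul] at h
    rw [metricBlock_eq hm hΘs hAs hΘ hA, Real.norm_eq_abs]
    convert h using 2
    simp only [Pi.smul_apply, smul_eq_mul]
    ring
  · have h := hR i
    rwa [dStar2_dCov1_smul, hodge1_smul, ← smul_add] at h

/-- The trivial configuration is a zero of the gauged operator. -/
theorem IsTrivialOn.op_zero {B : 𝔩 →L[ℝ] 𝔩 →L[ℝ] 𝔩} (hB : ∀ u v, B u v = -B v u)
    (q : 𝔩 →L[ℝ] 𝔩 →L[ℝ] ℝ) {g : Cov2 n ℝ} {ϖ : Cov1 n 𝔩} {U : Set (Vec n)}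
    (hc : IsTrivialOn B g ϖ U) {y : Vec n} (hy : y ∈ U) :
    (∀ i j, opQ (fun u v => B u v) q g 0 0 ϖ 0 0 y i j = 0) ∧
      ∀ i, opR (fun u v => B u v) g 0 0 ϖ 0 0 y i = 0 := by
  obtain ⟨δ, hδ, C, h⟩ := exists_quadratic_bound_ray hB q hc hy (Θ := 0) (A := 0) (ε := 0) (a := 0)
    (fun _ _ _ => rfl) (fun _ _ _ => rfl) (fun _ _ => contDiffAt_const)
    (fun _ _ => contDiffAt_const) (fun _ => contDiffAt_const) (fun _ => contDiffAt_const)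
  -- At `t = 0` the bound `C * t ^ 2` is zero, so the operator vanishes.
  obtain ⟨hQ, hR, -⟩ := h 0 (by simpa using hδ.le)
  exact ⟨fun i j => by simpa using hQ i j, fun i => by simpa using hR i⟩

end LocalRemainder

/-! ### Regularity and nondegeneracy of components in charts and gauges. -/

section Charts

variable {n : ℕ} {M : Type*} [TopologicalSpace M] [ChartedSpace (Vec n) M]

/-- The tangent map of `f` is smooth, and it is composed with the constant section `z ↦ (z, v)`. The
coordinate vector fields used in `rep1` and `rep2` have this form. -/
theorem contMDiffAt_mfderiv_apply {E N : Type*} [NormedAddCommGroup E] [NormedSpace ℝ E]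
    [TopologicalSpace N] [ChartedSpace E N] [IsManifold 𝓘(ℝ, E) ∞ N] {f : Vec n → N}
    {V : Set (Vec n)} (hV : IsOpen V) (hf : ContMDiffOn (𝓡 (n + 1)) 𝓘(ℝ, E) ∞ f V) {y : Vec n}
    (hy : y ∈ V) (v : Vec n) :
    ContMDiffAt (𝓡 (n + 1)) 𝓘(ℝ, E).tangent ∞
      (fun z => (⟨f z, mfderiv (𝓡 (n + 1)) 𝓘(ℝ, E) f z v⟩ : TangentBundle 𝓘(ℝ, E) N)) y := by
  have h1 := hf.contMDiffOn_tangentMapWithin (m := ∞) (by simp) hV.uniqueMDiffOn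
  have h2 : ContMDiff (𝓡 (n + 1)) (𝓡 (n + 1)).tangent ∞
      (fun z : Vec n => (⟨z, v⟩ : TangentBundle (𝓡 (n + 1)) (Vec n))) :=
    contMDiff_vectorSpace_iff_contDiff.2 contDiff_const
  have h3 := (h1.comp (s := V) h2.contMDiffOn fun z hz => hz).contMDiffAt (hV.mem_nhds hy)
  refine h3.congr_of_eventuallyEq ?_
  filter_upwards [hV.mem_nhds hy] with z hz
  simp only [Function.comp, tangentMapWithin, mfderivWithin_of_isOpen hV hz]

theorem contDiffAt_rep2 [IsManifold (𝓡 (n + 1)) ∞ M]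
    {φ : OpenPartialHomeomorph M (Vec n)}
    (hφ : φ ∈ IsManifold.maximalAtlas (𝓡 (n + 1)) ∞ M) {r : ℕ∞ω} (hr : r ≤ ∞) {h : Tensor2 n M}
    (hh : ContMDiff (𝓡 (n + 1)) ((𝓡 (n + 1)).prod 𝓘(ℝ, Vec n →L[ℝ] Vec n →L[ℝ] ℝ)) r
      (fun p => Bundle.TotalSpace.mk' (Vec n →L[ℝ] Vec n →L[ℝ] ℝ)
      (E := fun p : M => TangentSpace (𝓡 (n + 1)) p →L[ℝ] TangentSpace (𝓡 (n + 1)) p →L[ℝ] ℝ)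
      p (h p))) {y : Vec n} (hy : y ∈ φ.target) (i j : Fin (n + 1)) :
    ContDiffAt ℝ r (fun z => rep2 φ h z i j) y := by
  have hs := contMDiffOn_symm_of_mem_maximalAtlas hφ
  have hb : ContMDiffAt (𝓡 (n + 1)) (𝓡 (n + 1)) r φ.symm y :=
    (hs.contMDiffAt (φ.open_target.mem_nhds hy)).of_le hr
  have hv := fun i => (contMDiffAt_mfderiv_apply φ.open_target hs hy
    (EuclideanSpace.single i (1 : ℝ))).of_le hr
  have : ContMDiffAt (𝓡 (n + 1)) ((𝓡 (n + 1)).prod 𝓘(ℝ)) r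
      (fun z => TotalSpace.mk' ℝ (E := Bundle.Trivial M ℝ) (φ.symm z) (rep2 φ h z i j)) y := by
    apply ContMDiffAt.clm_bundle_apply₂ (F₁ := Vec n) (F₂ := Vec n)
    · exact ContMDiffAt.comp y hh.contMDiffAt hb
    · exact hv i
    · exact hv j
  simp only [contMDiffAt_totalSpace] at this
  exact contMDiffAt_iff_contDiffAt.1 this.2

theorem contDiffAt_rep1 {EP P 𝔩 : Type*} [NormedAddCommGroup EP] [NormedSpace ℝ EP]
    [TopologicalSpace P] [ChartedSpace EP P] [IsManifold 𝓘(ℝ, EP) ∞ P] [NormedAddCommGroup 𝔩]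
    [NormedSpace ℝ 𝔩] {φ : OpenPartialHomeomorph M (Vec n)}
    (hφ : φ ∈ IsManifold.maximalAtlas (𝓡 (n + 1)) ∞ M) {s : M → P}
    (hs : ContMDiffOn (𝓡 (n + 1)) 𝓘(ℝ, EP) ∞ s φ.source) {r : ℕ∞ω} (hr : r ≤ ∞)
    {α : Form1 EP P 𝔩} (hα : IsCForm r α) {y : Vec n} (hy : y ∈ φ.target) (i : Fin (n + 1)) :
    ContDiffAt ℝ r (fun z => rep1 φ s α z i) y := by
  have hσ : ContMDiffOn (𝓡 (n + 1)) 𝓘(ℝ, EP) ∞ (fun z => s (φ.symm z)) φ.target :=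
    hs.comp (contMDiffOn_symm_of_mem_maximalAtlas hφ) fun z hz => φ.map_target hz
  have hb : ContMDiffAt (𝓡 (n + 1)) 𝓘(ℝ, EP) r (fun z => s (φ.symm z)) y :=
    (hσ.contMDiffAt (φ.open_target.mem_nhds hy)).of_le hr
  have hv := (contMDiffAt_mfderiv_apply φ.open_target hσ hy
    (EuclideanSpace.single i (1 : ℝ))).of_le hr
  have : ContMDiffAt (𝓡 (n + 1)) (𝓘(ℝ, EP).prod 𝓘(ℝ, 𝔩)) r
      (fun z => TotalSpace.mk' 𝔩 (E := Bundle.Trivial P 𝔩) (s (φ.symm z)) (rep1 φ s α z i)) y := by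
    apply ContMDiffAt.clm_bundle_apply (F₁ := EP)
    · exact ContMDiffAt.comp y hα.contMDiffAt hb
    · exact hv
  simp only [contMDiffAt_totalSpace] at this
  exact contMDiffAt_iff_contDiffAt.1 this.2

theorem bilin_sum_smul {ι W : Type*} [Fintype ι] [AddCommGroup W] [Module ℝ W] [TopologicalSpace W]
    (b : W →L[ℝ] W →L[ℝ] ℝ) (e : ι → W) (v : ι → ℝ) :
    b (∑ i, v i • e i) (∑ i, v i • e i) = ∑ i, v i * ∑ j, b (e i) (e j) * v j := by
  simp only [map_sum, map_smul, sum_apply, smul_apply, smul_eq_mul, Finset.mul_sum]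
  rw [Finset.sum_comm]
  exact Finset.sum_congr rfl fun i _ => Finset.sum_congr rfl fun j _ => by ring

/-- A kernel vector of the component matrix would give a nonzero coordinate vector whose image under
the injective derivative of the inverse chart has zero length, against positivity. -/
theorem det_rep2_ne_zero [IsManifold (𝓡 (n + 1)) ∞ M]
    {φ : OpenPartialHomeomorph M (Vec n)}
    (hφ : φ ∈ IsManifold.maximalAtlas (𝓡 (n + 1)) ∞ M) {h : Tensor2 n M}
    (hpos : ∀ p v, v ≠ 0 → 0 < h p v v) {y : Vec n} (hy : y ∈ φ.target) :
    (Matrix.of (rep2 φ h y)).det ≠ 0 := by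
  have hφd : φ.MDifferentiable (𝓡 (n + 1)) (𝓡 (n + 1)) :=
    ⟨(contMDiffOn_of_mem_maximalAtlas hφ).mdifferentiableOn (by simp),
      (contMDiffOn_symm_of_mem_maximalAtlas hφ).mdifferentiableOn (by simp)⟩
  have hinj := hφd.symm.mfderiv_injective (x := y) hy
  set D := mfderiv (𝓡 (n + 1)) (𝓡 (n + 1)) φ.symm y with hD
  intro hdet
  obtain ⟨v, hv, hv0⟩ := Matrix.exists_mulVec_eq_zero_iff.2 hdet
  set w : Vec n := ∑ i, v i • EuclideanSpace.single i (1 : ℝ) with hw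
  have hwv : ∀ i, w i = v i := fun i => by
    simp [hw, Pi.single_apply]
  have hw0 : w ≠ 0 := fun h0 => hv (funext fun i => by rw [← hwv i, h0]; rfl)
  have hDw : D w ≠ 0 := fun h0 => hw0 (hinj (h0.trans (map_zero D).symm))
  have hq : h (φ.symm y) (D w) (D w) = ∑ i, v i * ∑ j, rep2 φ h y i j * v j := by
    have hDs : D w = ∑ i, v i • D (EuclideanSpace.single i (1 : ℝ) : Vec n) :=
      (map_sum D _ _).trans (Finset.sum_congr rfl fun i _ => map_smul D _ _)
    rw [hDs]
    exact bilin_sum_smul (h (φ.symm y)) _ v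
  have h1 := hpos (φ.symm y) (D w) hDw
  rw [hq] at h1
  have h2 : ∀ i, ∑ j, rep2 φ h y i j * v j = 0 := fun i => congrFun hv0 i
  simp [h2] at h1

end Charts

/-! ### The Lie bracket as a continuous bilinear map. -/

section Bracket

variable {EL : Type*} [NormedAddCommGroup EL] [NormedSpace ℝ EL] [FiniteDimensional ℝ EL]
    {L : Type*} [TopologicalSpace L] [ChartedSpace EL L] [Group L] [LieGroup 𝓘(ℝ, EL) ∞ L]

/-- In finite dimension a bilinear map is continuous. This lets the jet calculus for continuous
bilinear maps apply to the bracket. -/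
theorem exists_lieBr_eq : ∃ B : EL →L[ℝ] EL →L[ℝ] EL, lieBr L = (fun u v => B u v) ∧
    ∀ u v, B u v = -B v u := by
  -- The Lie algebra laws are available for groups of class `minSmoothness ℝ 3`, which over the
  -- reals is `C^3`, on a complete model space.
  have : LieGroup 𝓘(ℝ, EL) (minSmoothness ℝ 3) L := LieGroup.of_le (n := ∞) (by simp only [minSmoothness_of_isRCLikeNormedField]; norm_cast)
  have : CompleteSpace EL := FiniteDimensional.complete ℝ EL
  let 𝔤 := GroupLieAlgebra 𝓘(ℝ, EL) L
  let b : EL →ₗ[ℝ] EL →ₗ[ℝ] EL := LinearMap.mk₂ ℝ (lieBr L)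
    (fun u v w => add_lie (L := 𝔤) (M := 𝔤) u v w)
    (fun c u v => smul_lie (L := 𝔤) (M := 𝔤) c u v)
    (fun u v w => lie_add (L := 𝔤) (M := 𝔤) u v w)
    (fun c u v => lie_smul (L := 𝔤) (M := 𝔤) c u v)
  let B : EL →L[ℝ] EL →L[ℝ] EL := LinearMap.toContinuousLinearMap
    ((LinearMap.toContinuousLinearMap : (EL →ₗ[ℝ] EL) ≃ₗ[ℝ] EL →L[ℝ] EL).toLinearMap ∘ₗ b)
  refine ⟨B, rfl, fun u v => ?_⟩
  exact (lie_skew (L := 𝔤) u v).symm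

end Bracket

end EYM

/-! ### The theorem, from the local estimates. -/

open EYM in
theorem lemma6p4 (n : ℕ) (hn : 2 ≤ n)
    -- the manifold `M` of dimension `n + 1`
    {M : Type*} [TopologicalSpace M] [ChartedSpace (Vec n) M] [IsManifold (𝓡 (n + 1)) ∞ M]
    -- the compact Lie group `L` with an `Ad`-invariant inner product on its Lie algebra
    {EL : Type*} [NormedAddCommGroup EL] [NormedSpace ℝ EL] [FiniteDimensional ℝ EL]
    {L : Type*} [TopologicalSpace L] [ChartedSpace EL L] [Group L] [LieGroup 𝓘(ℝ, EL) ∞ L]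
    [CompactSpace L] (q : EL →L[ℝ] EL →L[ℝ] ℝ) (hq : IsAdInvariantInner L q)
    -- the principal bundle `π : P → M`
    {EP : Type*} [NormedAddCommGroup EP] [NormedSpace ℝ EP] [FiniteDimensional ℝ EP]
    {P : Type*} [TopologicalSpace P] [ChartedSpace EP P] [IsManifold 𝓘(ℝ, EP) ∞ P]
    [MulAction Lᵐᵒᵖ P] (π : P → M) (hπ : IsPrincipalBundle n EL L EP π)
    -- the trivial configuration `(g₀, ϖ₀)`
    (g₀ : Bundle.ContMDiffRiemannianMetric (𝓡 (n + 1)) ∞ (Vec n)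
      (fun p : M => TangentSpace (𝓡 (n + 1)) p))
    (hg₀ : IsEinstein n g₀.inner)
    (ϖ₀ : Form1 EP P EL) (hϖ₀ : IsConnection L ϖ₀) (hflat : IsFlat n L π ϖ₀)
    -- a chart of `M` and a local gauge over its domain
    (φ : OpenPartialHomeomorph M (Vec n)) (hφ : φ ∈ IsManifold.maximalAtlas (𝓡 (n + 1)) ∞ M)
    (s : M → P) (hs : IsLocalSection n EP π φ.source s) :
    -- `(g₀, ϖ₀)` is a zero of the gauged operator
    (∀ y ∈ φ.target, (∀ i j, gaugedQ L q φ s g₀.inner ϖ₀ 0 0 0 0 y i j = 0) ∧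
      ∀ i, gaugedR L φ s g₀.inner ϖ₀ 0 0 0 0 y i = 0) ∧
    -- directional derivatives; the modified stress-energy tensor does not contribute
    (∀ Θ A : Tensor2 n M, IsSymTensor 2 Θ → IsSymTensor 2 A →
      ∀ ε a : Form1 EP P EL, IsAdForm L 2 ε → IsAdForm L 2 a → ∀ y ∈ φ.target,
        (∀ i j, HasDerivAt
          (fun t : ℝ => gaugedQ L q φ s g₀.inner ϖ₀ (t • Θ) (t • A) (t • ε) (t • a) y i j)
          (metricBlock φ g₀.inner Θ A y i j) 0) ∧
        (∀ i, HasDerivAt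
          (fun t : ℝ => gaugedR L φ s g₀.inner ϖ₀ (t • Θ) (t • A) (t • ε) (t • a) y i)
          (connectionBlock L φ s g₀.inner ϖ₀ ε a y i) 0) ∧
        (∀ i j, HasDerivAt
          (fun t : ℝ => stressModRep L q φ s (g₀.inner + t • Θ + t • A)
            (ϖ₀ + t • ε + t • a) y i j) 0 0)) ∧
    -- Fréchet differentiability, with a quadratic remainder that is uniform on compact sets
    (∀ K : Set (Vec n), IsCompact K → K ⊆ φ.target → ∃ C : ℝ, ∃ ρ > 0,
      ∀ Θ A : Tensor2 n M, IsSymTensor 2 Θ → IsSymTensor 2 A →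
      ∀ ε a : Form1 EP P EL, IsAdForm L 2 ε → IsAdForm L 2 a → ∀ y ∈ K, ∀ r ≤ ρ,
        JetBound2 (rep2 φ Θ) y r → JetBound2 (rep2 φ A) y r →
        JetBound1 (rep1 φ s ε) y r → JetBound1 (rep1 φ s a) y r →
          (∀ i j, |gaugedQ L q φ s g₀.inner ϖ₀ Θ A ε a y i j
            - metricBlock φ g₀.inner Θ A y i j| ≤ C * r ^ 2) ∧
          ∀ i, ‖gaugedR L φ s g₀.inner ϖ₀ Θ A ε a y i
            - connectionBlock L φ s g₀.inner ϖ₀ ε a y i‖ ≤ C * r ^ 2) := by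
  obtain ⟨B, hBr, hB⟩ := exists_lieBr_eq (EL := EL) (L := L)
  have hc : IsTrivialOn B (rep2 φ g₀.inner) (rep1 φ s ϖ₀) φ.target :=
    { isOpen := φ.open_target
      symm := fun z i j => g₀.symm _ _ _
      smooth := fun z hz i j => contDiffAt_rep2 hφ le_rfl g₀.contMDiff hz i j
      det_ne := fun z hz => det_rep2_ne_zero hφ g₀.pos hz
      einstein := fun z hz i j => hg₀ φ hφ z hz i j
      smooth_conn := fun z hz i => contDiffAt_rep1 hφ hs.1 le_rfl hϖ₀.smooth hz i
      flat := fun z hz i j => by rw [← hBr]; exact hflat φ hφ s hs z hz i j }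
  have h2 : (2 : WithTop ℕ∞) ≤ ∞ := by norm_cast
  have hsm2 : ∀ T : Tensor2 n M, IsSymTensor 2 T → ∀ y ∈ φ.target, ∀ i j,
      ContDiffAt ℝ 2 (fun z => rep2 φ T z i j) y := fun T hT y hy i j =>
    contDiffAt_rep2 hφ h2 hT.contMDiff hy i j
  have hsy : ∀ T : Tensor2 n M, IsSymTensor 2 T → ∀ z i j, rep2 φ T z i j = rep2 φ T z j i :=
    fun T hT z i j => hT.symm _ _ _
  have hsm1 : ∀ α : Form1 EP P EL, IsAdForm L 2 α → ∀ y ∈ φ.target, ∀ i,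
      ContDiffAt ℝ 2 (fun z => rep1 φ s α z i) y := fun α hα y hy i =>
    contDiffAt_rep1 hφ hs.1 h2 hα.contMDiff hy i
  simp only [gaugedQ, gaugedR, metricBlock, connectionBlock, stressModRep, hBr]
  refine ⟨fun y hy => hc.op_zero hB q hy, fun Θ A hΘ hA ε a hε ha y hy => ?_,
    fun K hK hKU => ?_⟩
  · obtain ⟨δ, hδ, C, h⟩ := exists_quadratic_bound_ray hB q hc hy (hsy Θ hΘ) (hsy A hA)
      (hsm2 Θ hΘ y hy) (hsm2 A hA y hy) (hsm1 ε hε y hy) (hsm1 a ha y hy)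
    refine ⟨fun i j => hasDerivAt_of_quadratic hδ fun t ht => (h t ht).1 i j,
      fun i => hasDerivAt_of_quadratic hδ fun t ht => (h t ht).2.1 i,
      fun i j => hasDerivAt_of_quadratic hδ (C := C) fun t ht => ?_⟩
    -- For the stress-energy tensor the linear part is `0`, so the quadratic bound applies to the
    -- tensor itself.
    rw [smul_zero, sub_zero]
    exact (h t ht).2.2 i j
  · obtain ⟨ρ, hρ, C, h⟩ := exists_quadratic_bound hB q hc hK hKU
    refine ⟨C, ρ, hρ, fun Θ A hΘ hA ε a hε ha y hy r hr bΘ bA bε ba => ?_⟩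
    have hx := h ⟨rep2 φ Θ, rep2 φ A, rep1 φ s ε, rep1 φ s a, y, r⟩
      ⟨hsy Θ hΘ, hsy A hA, hsm2 Θ hΘ y (hKU hy), hsm2 A hA y (hKU hy), hsm1 ε hε y (hKU hy),
        hsm1 a ha y (hKU hy), bΘ, bA, bε, ba⟩ hy hr
    exact ⟨hx.1, hx.2.1⟩
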